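/- Call a connected component $L$ of the set $\{s\in\mathbb C\setminus\{1\}:\zeta(s)\in\mathbb R\}$ a \emph{parallel line} if it contains points of arbitrarily large real part and $\zeta'(s)\neq 0$ for every $s\in L$. Let $T>0$ and let $L$ be a parallel line containing the point $-1+iT$. A point of $\mathbb C\setminus L$ is said to lie \emph{below} $L$ if it can be joined to the real axis by a path that does not meet $L$. Zeros are counted with multiplicity, and an integer is called nearest to $x\in\mathbb R$ if it is strictly nearer to $x$ than every other integer. (a) If $\zeta$ has no zero on $L$, then there are finitely many zeros $\rho=\beta+i\gamma$ of $\zeta$ with $\beta>0$, $\gamma>0$ lying below $L$, and their number is the integer nearest to $$\frac{T}{2\pi}\log\frac{T}{2\pi}-\frac{T}{2\pi}+\frac78 .$$ (b) If $\zeta$ has a zero on $L$, then there are finitely many zeros $\rho=\beta+i\gamma$ of $\zeta$ with $\beta>0$, $\gamma>0$ lying below $L$ or on $L$, and their number is the integer nearest to $$\frac{T}{2\pi}\log\frac{T}{2\pi}-\frac{T}{2\pi}+\frac{11}8 .$$ -/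

import Mathlib

/-- The thick set: the points `s ≠ 1` (so off the pole) at which `ζ(s)` is real. -/
def zetaRealSet : Set ℂ := {s | s ≠ 1 ∧ (riemannZeta s).im = 0}

/-- A parallel line: a whole curve on which `ζ` is real (a connected component of the set where
`ζ` is real) that comes from the far right, `Re s → +∞`, and on which `ζ'` has no zero. -/
structure IsParallelLine (L : Set ℂ) : Prop where
  isComponent : ∃ s ∈ zetaRealSet, L = connectedComponentIn zetaRealSet s
  comesFromRight : ∀ M : ℝ, ∃ s ∈ L, M < s.re
  deriv_ne_zero : ∀ s ∈ L, deriv riemannZeta s ≠ 0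

/-- The points below the line `L` (for `L` in the upper half plane): those on the same side of `L`
as the real axis, i.e. those that a path not meeting `L` joins to the real axis. -/
def belowLine (L : Set ℂ) : Set ℂ := {s | ∃ x : ℝ, JoinedIn Lᶜ s (x : ℂ)}

/-- The zeros `ρ = β + iγ` of `ζ` in `A` with `β > 0` and `γ > 0`. -/
def zetaZerosIn (A : Set ℂ) : Set ℂ :=
  {ρ | ρ ∈ A ∧ riemannZeta ρ = 0 ∧ 0 < ρ.re ∧ 0 < ρ.im}

/-- The number of the zeros in `zetaZerosIn A`, counted with multiplicity (meaningful when there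
are finitely many of them). -/
noncomputable def zetaZeroCount (A : Set ℂ) : ℕ :=
  ∑ᶠ ρ ∈ zetaZerosIn A, analyticOrderNatAt riemannZeta ρ

/-- `n` is the integer nearest to `x`: it is strictly nearer to `x` than any other integer. -/
def IsNearestInt (n : ℤ) (x : ℝ) : Prop := ∀ m : ℤ, m ≠ n → |x - n| < |x - m|

section

open Set Filter Topology

/-! The count is an argument principle in which the line itself is part of the contour. The contour
goes up a vertical segment from the real axis to a base point of the line far to the right, follows
the line to -1 + iT, and descends along Re s = -1. All functions involved are real on the real axis,
so the reflected half of the contour is not needed: a pair of conjugate zeros enclosed by the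
contour contributes 2π (`contourVar_conjQuad_of_mem_belowLine`), a pair whose upper member is above
the line contributes 0 (`contourVar_conjQuad_of_notMem`), and s - 1 contributes π. After dividing (s
- 1)ζ(s) by the finitely many relevant quadratic factors, the quotient has no zero under the contour
and contributes nothing (`contourVar_eq_zero`).

The argument of ζ itself is known on each piece. On the right vertical ζ is close to 1 and real at
both ends, so the variation is 0. On the line ζ is real. If it has no zero there, the variation is
0. If it has one, the curve is pushed above it and ζ passes from the positive to the negative reals
through the upper half plane, which gives π (`exists_isSeparating`). On Re s = -1 the functional
equation gives the variation `leftArg T`, namely T log 2π - Im log Γ(2 + iT) - arg ζ(2 + iT). So 2πN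
= π + θ - `leftArg T` with θ = 0 or π (`finite_and_count`). Explicit Stirling bounds, together with
a bound for the argument of ζ on Re s = 2, put this within π of 2π times the stated main term
(`abs_leftArg_add_lt`); hence N is the nearest integer.

The geometry of the line has to be controlled as well. Since ζ' has no zero on it, ζ is locally
injective and open from the line to ℝ, hence injective (`IsParallelLine.injOn`). It tends to 1 at
the right end and so omits 1, and the line is parametrized by ζ = 1 + εy with a sign ε and y > 0
(`LineParam`). Numerical work on Re s = -1 shows that ζ is real there, above the axis, only at
heights below 3.4 with 0 < ζ < 1, or above 8.7 with |ζ| > 1 (`zeta_neg_one_add_real`). The sign of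
Re ζ'/ζ makes the line cross leftwards in both cases, so only once. A crossing of the first kind
would trap the line in a compact set; after one of the second kind it runs off to Re s = -∞
(`left_end`). The line is also closed and stays off the real axis, and its two sides are told apart
by the sign of ε Im ζ near it. A zero can therefore be moved, without meeting the line, either to
the real axis or up to infinity, and this homotopy computes its contribution. -/

/-! ### Locally injective open maps to the real line -/

/-- The interval f(A) ∩ f(B) is covered by two open sets: the values taken on A ∩ B, and the values
taken at distinct points of A and B (open by the Hausdorff property). Injectivity on A and on B
makes them disjoint, so connectedness leaves only the first, which is nonempty. -/
theorem injOn_union_of_isOpenMap {X : Type*} [TopologicalSpace X] [T2Space X] {f : X → ℝ}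
    (hc : Continuous f) (ho : IsOpenMap f) {A B : Set X} (hA : IsOpen A) (hB : IsOpen B)
    (hA' : IsPreconnected A) (hB' : IsPreconnected B) (hfA : InjOn f A) (hfB : InjOn f B)
    (hAB : (A ∩ B).Nonempty) : InjOn f (A ∪ B) := by
  have hI : IsPreconnected (f '' A ∩ f '' B) :=
    ((hA'.image f hc.continuousOn).ordConnected.inter
      (hB'.image f hc.continuousOn).ordConnected).isPreconnected
  set W : Set ℝ := {x | ∃ a ∈ A, ∃ b ∈ B, f a = x ∧ f b = x ∧ a ≠ b} with hW
  have hWo : IsOpen W := by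
    rw [isOpen_iff_mem_nhds]
    rintro x ⟨a, ha, b, hb, rfl, hba, hab⟩
    obtain ⟨U, V, hU, hV, haU, hbV, hUV⟩ := t2_separation hab
    have h1 : f '' (U ∩ A) ∈ 𝓝 (f a) := (ho _ (hU.inter hA)).mem_nhds ⟨a, ⟨haU, ha⟩, rfl⟩
    have h2 : f '' (V ∩ B) ∈ 𝓝 (f a) := (ho _ (hV.inter hB)).mem_nhds ⟨b, ⟨hbV, hb⟩, hba⟩
    filter_upwards [h1, h2]
    rintro y ⟨a', ⟨ha'U, ha'⟩, rfl⟩ ⟨b', ⟨hb'V, hb'⟩, hy⟩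
    exact ⟨a', ha', b', hb', rfl, hy, fun h => hUV.le_bot ⟨ha'U, h ▸ hb'V⟩⟩
  have hsub : f '' A ∩ f '' B ⊆ f '' (A ∩ B) := by
    refine hI.subset_left_of_subset_union (ho _ (hA.inter hB)) hWo ?_ ?_ ?_
    · rw [Set.disjoint_left]
      rintro _ ⟨c, ⟨hcA, hcB⟩, rfl⟩ ⟨a, ha, b, hb, h1, h2, hab⟩
      exact hab ((hfA ha hcA h1).trans (hfB hb hcB h2).symm)
    · rintro x ⟨⟨a, ha, rfl⟩, ⟨b, hb, hba⟩⟩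
      by_cases hab : a = b
      · exact Or.inl ⟨a, ⟨ha, hab ▸ hb⟩, rfl⟩
      · exact Or.inr ⟨a, ha, b, hb, rfl, hba, hab⟩
    · obtain ⟨c, hcA, hcB⟩ := hAB
      exact ⟨f c, ⟨⟨c, hcA, rfl⟩, ⟨c, hcB, rfl⟩⟩, ⟨c, ⟨hcA, hcB⟩, rfl⟩⟩
  have key : ∀ a ∈ A, ∀ b ∈ B, f a = f b → a = b := by
    intro a ha b hb hab
    obtain ⟨c, ⟨hcA, hcB⟩, hcf⟩ := hsub ⟨⟨a, ha, rfl⟩, ⟨b, hb, hab.symm⟩⟩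
    exact (hfA ha hcA hcf.symm).trans (hfB hb hcB (hab.symm.trans hcf.symm)).symm
  rintro x (hx | hx) y (hy | hy) hxy
  · exact hfA hx hy hxy
  · exact key x hx y hy hxy
  · exact (key y hy x hx hxy.symm).symm
  · exact hfB hx hy hxy

/-- A continuous open map from a connected Hausdorff space to `ℝ` which is injective on a connected
open neighbourhood of every point is injective. -/
theorem injective_of_isOpenMap_of_locally {X : Type*} [TopologicalSpace X] [T2Space X]
    [ConnectedSpace X] {f : X → ℝ} (hc : Continuous f) (ho : IsOpenMap f)
    (hl : ∀ x, ∃ U, IsOpen U ∧ IsPreconnected U ∧ x ∈ U ∧ InjOn f U) : Function.Injective f := by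
  obtain ⟨x₀⟩ := (inferInstance : Nonempty X)
  -- By the union lemma the union of this family belongs to the family; being maximal, it absorbs a
  -- good neighbourhood of each of its limit points and is therefore closed.
  set 𝒜 : Set (Set X) := {A | IsOpen A ∧ IsPreconnected A ∧ x₀ ∈ A ∧ InjOn f A} with h𝒜
  have hUo : IsOpen (⋃₀ 𝒜) := isOpen_sUnion fun A hA => hA.1
  have hUc : IsPreconnected (⋃₀ 𝒜) :=
    isPreconnected_sUnion x₀ _ (fun A hA => hA.2.2.1) (fun A hA => hA.2.1)
  have hUi : InjOn f (⋃₀ 𝒜) := by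
    rintro x ⟨A, hA, hx⟩ y ⟨B, hB, hy⟩ hxy
    exact injOn_union_of_isOpenMap hc ho hA.1 hB.1 hA.2.1 hB.2.1 hA.2.2.2 hB.2.2.2
      ⟨x₀, hA.2.2.1, hB.2.2.1⟩ (Or.inl hx) (Or.inr hy) hxy
  have hx₀ : x₀ ∈ ⋃₀ 𝒜 := by
    obtain ⟨U, h1, h2, h3, h4⟩ := hl x₀
    exact ⟨U, ⟨h1, h2, h3, h4⟩, h3⟩
  have hcl : IsClosed (⋃₀ 𝒜) := by
    refine isClosed_of_closure_subset fun p hp => ?_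
    obtain ⟨N, h1, h2, h3, h4⟩ := hl p
    obtain ⟨q, hqN, hqU⟩ := mem_closure_iff.1 hp N h1 h3
    have : ⋃₀ 𝒜 ∪ N ∈ 𝒜 := ⟨hUo.union h1, hUc.union q hqU hqN h2, Or.inl hx₀,
      injOn_union_of_isOpenMap hc ho hUo h1 hUc h2 hUi h4 ⟨q, hqU, hqN⟩⟩
    exact ⟨_, this, Or.inr h3⟩
  have := IsClopen.eq_univ ⟨hcl, hUo⟩ ⟨x₀, hx₀⟩
  rw [this] at hUi
  exact injOn_univ.1 hUi

/-! ### Variation of the argument along a curve -/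

open Classical in
/-- The variation of the argument of `f` over `[a, b]`: the increment of the imaginary part of
a continuous logarithm of `f`. -/
noncomputable def argVar (f : ℝ → ℂ) (a b : ℝ) : ℝ :=
  if h : ∃ l : ℝ → ℂ, ContinuousOn l (Icc a b) ∧ ∀ t ∈ Icc a b, Complex.exp (l t) = f t
  then (h.choose b - h.choose a).im else 0

theorem eqOn_of_exp_eq {S : Set ℝ} (hS : IsPreconnected S) {l m : ℝ → ℂ} (hl : ContinuousOn l S)
    (hm : ContinuousOn m S) (h : ∀ t ∈ S, Complex.exp (l t) = Complex.exp (m t)) {a : ℝ}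
    (ha : a ∈ S) (hla : l a = m a) : EqOn l m S := by
  refine Complex.isCoveringMap_exp.eqOn_of_comp_eqOn hS hl hm (fun t ht => ?_) ha hla
  exact Subtype.ext (h t ht)

/-- Two continuous logarithms on an interval differ by a constant, by uniqueness of lifts through
the covering exp, so the chosen logarithm may be replaced by any other. -/
theorem argVar_eq {f l : ℝ → ℂ} {a b : ℝ} (hab : a ≤ b) (hl : ContinuousOn l (Icc a b))
    (h : ∀ t ∈ Icc a b, Complex.exp (l t) = f t) : argVar f a b = (l b - l a).im := by
  have hex : ∃ l : ℝ → ℂ, ContinuousOn l (Icc a b) ∧ ∀ t ∈ Icc a b, Complex.exp (l t) = f t :=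
    ⟨l, hl, h⟩
  rw [argVar, dif_pos hex]
  obtain ⟨hm, hm'⟩ := hex.choose_spec
  set m := hex.choose
  have ha : a ∈ Icc a b := left_mem_Icc.2 hab
  have : EqOn (fun t => l t + (m a - l a)) m (Icc a b) := by
    refine eqOn_of_exp_eq isPreconnected_Icc (hl.add continuousOn_const) hm (fun t ht => ?_) ha
      (by ring)
    rw [Complex.exp_add, Complex.exp_sub, hm' a ha, h a ha, h t ht, hm' t ht, div_self, mul_one]
    rw [← h a ha]; exact Complex.exp_ne_zero _
  have h2 := this (right_mem_Icc.2 hab)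
  simp only at h2
  rw [← h2]; congr 1; ring

/-- Clamping the coordinates extends H to a nonvanishing continuous function on the whole plane,
which is simply connected, so it lifts through exp. -/
theorem exists_log_rect {H : ℝ → ℝ → ℂ} {s₀ s₁ a b : ℝ} (hs : s₀ ≤ s₁) (hab : a ≤ b)
    (hH : ContinuousOn (fun p : ℝ × ℝ => H p.1 p.2) (Icc s₀ s₁ ×ˢ Icc a b))
    (h0 : ∀ s ∈ Icc s₀ s₁, ∀ t ∈ Icc a b, H s t ≠ 0) :
    ∃ l : ℝ → ℝ → ℂ, ContinuousOn (fun p : ℝ × ℝ => l p.1 p.2) (Icc s₀ s₁ ×ˢ Icc a b) ∧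
      ∀ s ∈ Icc s₀ s₁, ∀ t ∈ Icc a b, Complex.exp (l s t) = H s t := by
  set g : ℝ × ℝ → ℂ := fun p => H (projIcc s₀ s₁ hs p.1) (projIcc a b hab p.2) with hg
  have hgc : Continuous g := by
    have : Continuous fun p : ℝ × ℝ =>
        (((projIcc s₀ s₁ hs p.1 : ℝ), (projIcc a b hab p.2 : ℝ)) : ℝ × ℝ) := by fun_prop
    exact hH.comp_continuous this fun p => ⟨Subtype.coe_prop _, Subtype.coe_prop _⟩
  have hsc : SimplyConnectedSpace (univ : Set (ℝ × ℝ)) :=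
    have := convex_univ.contractibleSpace (s := (univ : Set (ℝ × ℝ))) univ_nonempty
    inferInstance
  obtain ⟨l, hl, hle⟩ := Complex.exists_continuousOn_eqOn_exp_comp
    (U := univ) (show SimplyConnectedSpace (univ : Set (ℝ × ℝ)) from hsc) isOpen_univ hgc.continuousOn (by
      rintro ⟨p, -, hp⟩
      exact h0 _ (Subtype.coe_prop _) _ (Subtype.coe_prop _) hp)
  refine ⟨fun s t => l (s, t), by simpa using hl.mono (subset_univ _), fun s hs' t ht => ?_⟩
  have := hle (mem_univ (s, t))
  simpa [g, projIcc_of_mem _ hs', projIcc_of_mem _ ht] using this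

theorem exists_log_Icc {f : ℝ → ℂ} {a b : ℝ} (hab : a ≤ b) (hf : ContinuousOn f (Icc a b))
    (h0 : ∀ t ∈ Icc a b, f t ≠ 0) :
    ∃ l : ℝ → ℂ, ContinuousOn l (Icc a b) ∧ ∀ t ∈ Icc a b, Complex.exp (l t) = f t := by
  obtain ⟨l, hl, h⟩ := exists_log_rect (H := fun _ t => f t) (le_refl (0:ℝ)) hab
    (hf.comp continuousOn_snd fun p hp => hp.2) (fun s _ t ht => h0 t ht)
  refine ⟨l 0, ?_, h 0 (by simp)⟩
  exact hl.comp (f := fun t => ((0:ℝ), t)) (by fun_prop) fun t ht => ⟨by simp, ht⟩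

/-- The variation of the argument around the boundary of a rectangle vanishes. -/
theorem argVar_rect {H : ℝ → ℝ → ℂ} {s₀ s₁ a b : ℝ} (hs : s₀ ≤ s₁) (hab : a ≤ b)
    (hH : ContinuousOn (fun p : ℝ × ℝ => H p.1 p.2) (Icc s₀ s₁ ×ˢ Icc a b))
    (h0 : ∀ s ∈ Icc s₀ s₁, ∀ t ∈ Icc a b, H s t ≠ 0) :
    argVar (H s₁) a b - argVar (H s₀) a b =
      argVar (fun s => H s b) s₀ s₁ - argVar (fun s => H s a) s₀ s₁ := by
  obtain ⟨l, hl, h⟩ := exists_log_rect hs hab hH h0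
  have hv : ∀ s ∈ Icc s₀ s₁, argVar (H s) a b = (l s b - l s a).im := fun s hs' =>
    argVar_eq hab (hl.comp (f := fun t => (s, t)) (by fun_prop) fun t ht => ⟨hs', ht⟩) (h s hs')
  have hw : ∀ t ∈ Icc a b, argVar (fun s => H s t) s₀ s₁ = (l s₁ t - l s₀ t).im := fun t ht =>
    argVar_eq (l := fun s => l s t) hs
      (hl.comp (f := fun s => (s, t)) (by fun_prop) fun s hs' => ⟨hs', ht⟩) fun s hs' => h s hs' t ht
  rw [hv _ (right_mem_Icc.2 hs), hv _ (left_mem_Icc.2 hs), hw _ (right_mem_Icc.2 hab),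
    hw _ (left_mem_Icc.2 hab)]
  simp only [Complex.sub_im]; ring

theorem argVar_congr {f g : ℝ → ℂ} {a b : ℝ} (hab : a ≤ b) (hf : ContinuousOn f (Icc a b))
    (h0 : ∀ t ∈ Icc a b, f t ≠ 0) (h : EqOn f g (Icc a b)) : argVar f a b = argVar g a b := by
  obtain ⟨l, hl, hl'⟩ := exists_log_Icc hab hf h0
  rw [argVar_eq hab hl hl', argVar_eq hab hl fun t ht => (hl' t ht).trans (h ht)]

theorem argVar_mul {f g : ℝ → ℂ} {a b : ℝ} (hab : a ≤ b) (hf : ContinuousOn f (Icc a b))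
    (hg : ContinuousOn g (Icc a b)) (hf0 : ∀ t ∈ Icc a b, f t ≠ 0) (hg0 : ∀ t ∈ Icc a b, g t ≠ 0) :
    argVar (fun t => f t * g t) a b = argVar f a b + argVar g a b := by
  obtain ⟨l, hl, hl'⟩ := exists_log_Icc hab hf hf0
  obtain ⟨m, hm, hm'⟩ := exists_log_Icc hab hg hg0
  rw [argVar_eq hab hl hl', argVar_eq hab hm hm', argVar_eq hab (hl.add hm) fun t ht => by
    simp only [Pi.add_apply]; rw [Complex.exp_add, hl' t ht, hm' t ht]]
  simp only [Pi.add_apply, Complex.sub_im, Complex.add_im]; ring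

theorem argVar_pow {f : ℝ → ℂ} {a b : ℝ} (hab : a ≤ b) (hf : ContinuousOn f (Icc a b))
    (hf0 : ∀ t ∈ Icc a b, f t ≠ 0) (n : ℕ) :
    argVar (fun t => f t ^ n) a b = n * argVar f a b := by
  obtain ⟨l, hl, hl'⟩ := exists_log_Icc hab hf hf0
  rw [argVar_eq hab hl hl', argVar_eq (l := fun t => n * l t) hab (continuousOn_const.mul hl)
    fun t ht => by rw [Complex.exp_nat_mul, hl' t ht]]
  rw [← mul_sub, ← Complex.ofReal_natCast, Complex.im_ofReal_mul]

theorem argVar_prod {ι : Type*} (S : Finset ι) {f : ι → ℝ → ℂ} {a b : ℝ} (hab : a ≤ b)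
    (hf : ∀ i ∈ S, ContinuousOn (f i) (Icc a b)) (hf0 : ∀ i ∈ S, ∀ t ∈ Icc a b, f i t ≠ 0) :
    argVar (fun t => ∏ i ∈ S, f i t) a b = ∑ i ∈ S, argVar (f i) a b := by
  have : ∀ i ∈ S, ∃ l : ℝ → ℂ, ContinuousOn l (Icc a b) ∧
      ∀ t ∈ Icc a b, Complex.exp (l t) = f i t := fun i hi => exists_log_Icc hab (hf i hi) (hf0 i hi)
  choose! l hl hl' using this
  rw [argVar_eq (l := fun t => ∑ i ∈ S, l i t) hab (continuousOn_finsetSum _ hl) fun t ht => by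
    rw [Complex.exp_sum]; exact Finset.prod_congr rfl fun i hi => hl' i hi t ht]
  rw [← Finset.sum_sub_distrib, Complex.im_sum]
  exact Finset.sum_congr rfl fun i hi => (argVar_eq hab (hl i hi) (hl' i hi)).symm

theorem argVar_add_adjacent {f : ℝ → ℂ} {a b c : ℝ} (hab : a ≤ b) (hbc : b ≤ c)
    (hf : ContinuousOn f (Icc a c)) (h0 : ∀ t ∈ Icc a c, f t ≠ 0) :
    argVar f a b + argVar f b c = argVar f a c := by
  obtain ⟨l, hl, hl'⟩ := exists_log_Icc (hab.trans hbc) hf h0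
  have h1 : Icc a b ⊆ Icc a c := Icc_subset_Icc_right hbc
  have h2 : Icc b c ⊆ Icc a c := Icc_subset_Icc_left hab
  rw [argVar_eq (hab.trans hbc) hl hl', argVar_eq hab (hl.mono h1) fun t ht => hl' t (h1 ht),
    argVar_eq hbc (hl.mono h2) fun t ht => hl' t (h2 ht)]
  simp only [Complex.sub_im]; ring

/-- In a rotated slit plane the variation of the argument is given by the principal argument. -/
theorem argVar_of_mem_slitPlane (c : ℂ) (hc : c ≠ 0) {f : ℝ → ℂ} {a b : ℝ} (hab : a ≤ b)
    (hf : ContinuousOn f (Icc a b)) (h : ∀ t ∈ Icc a b, c * f t ∈ Complex.slitPlane) :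
    argVar f a b = (c * f b).arg - (c * f a).arg := by
  rw [argVar_eq (l := fun t => Complex.log (c * f t) - Complex.log c) hab
    (((continuousOn_const.mul hf).clog h).sub continuousOn_const) fun t ht => by
      have h1 := Complex.slitPlane_ne_zero (h t ht)
      rw [Complex.exp_sub, Complex.exp_log h1, Complex.exp_log hc, mul_div_cancel_left₀ _ hc]]
  simp [Complex.log_im]

/-- Squaring doubles the variation and makes the values positive, where the principal argument is 0;
no case distinction on the sign of f is needed. -/
theorem argVar_real {f : ℝ → ℂ} {a b : ℝ} (hab : a ≤ b) (hf : ContinuousOn f (Icc a b))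
    (h0 : ∀ t ∈ Icc a b, f t ≠ 0) (h : ∀ t ∈ Icc a b, (f t).im = 0) : argVar f a b = 0 := by
  have h1 : argVar (fun t => f t * f t) a b = 0 := by
    rw [argVar_of_mem_slitPlane (f := fun t => f t * f t) 1 one_ne_zero hab (hf.mul hf)]
    · have : ∀ t ∈ Icc a b, (1 * (f t * f t)).arg = 0 := fun t ht => by
        rw [one_mul, Complex.arg_eq_zero_iff]
        have := h t ht
        simp [Complex.mul_re, Complex.mul_im, this, mul_self_nonneg]
      rw [this _ (right_mem_Icc.2 hab), this _ (left_mem_Icc.2 hab), sub_zero]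
    · intro t ht
      left
      have h2 := h t ht
      have h3 : (f t).re ≠ 0 := fun h3 => h0 t ht (Complex.ext h3 h2)
      simp only [one_mul, Complex.mul_re, h2, mul_zero, sub_zero]
      exact mul_self_pos.2 h3
  rw [argVar_mul hab hf hf h0 h0] at h1
  linarith

/-! ### The logarithm of the Gamma function on the right half-plane -/

/-- The logarithm of the Gamma function on the right half-plane. -/
noncomputable def logGammaSeries (w : ℂ) : ℂ :=
  ∑' k : ℕ, (w * (Real.log ((k + 2) / (k + 1)) : ℂ) - Complex.log (1 + w / (k + 1)))
    - Complex.log w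

/-- The logarithmic derivative of the Gamma function on the right half-plane. -/
noncomputable def digammaSeries (w : ℂ) : ℂ :=
  ∑' k : ℕ, ((Real.log ((k + 2) / (k + 1)) : ℂ) - 1 / (k + 1 + w)) - 1 / w

theorem norm_add_le_of_re_pos {w : ℂ} (hw : 0 < w.re) {r : ℝ} (hr : 0 ≤ r) :
    r ≤ ‖(r : ℂ) + w‖ := by
  refine le_trans ?_ (Complex.abs_re_le_norm _)
  simp only [Complex.add_re, Complex.ofReal_re]
  rw [abs_of_pos (by linarith)]; linarith

theorem abs_log_sub_inv_le (k : ℕ) :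
    |Real.log (((k : ℝ) + 2) / (k + 1)) - 1 / (k + 1)| ≤ 1 / ((k : ℝ) + 1) ^ 2 := by
  have hk : (0 : ℝ) < k + 1 := by positivity
  have h1 : Real.log (((k : ℝ) + 2) / (k + 1)) ≤ 1 / (k + 1) := by
    refine (Real.log_le_sub_one_of_pos (by positivity)).trans (le_of_eq ?_)
    field_simp; ring
  have h2 : 1 - ((k + 1 : ℝ)) / (k + 2) ≤ Real.log (((k : ℝ) + 2) / (k + 1)) := by
    have := Real.one_sub_inv_le_log_of_pos (x := ((k : ℝ) + 2) / (k + 1)) (by positivity)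
    rwa [inv_div] at this
  rw [abs_le]
  have h3 : 1 / ((k : ℝ) + 1) - (1 - ((k + 1 : ℝ)) / (k + 2)) ≤ 1 / ((k : ℝ) + 1) ^ 2 := by
    have e : 1 / ((k : ℝ) + 1) - (1 - ((k + 1 : ℝ)) / (k + 2)) = 1 / ((k + 1) * (k + 2)) := by
      field_simp; ring
    rw [e, sq]
    gcongr
    norm_num
  have h4 : 0 ≤ 1 / ((k : ℝ) + 1) ^ 2 := by positivity
  constructor <;> linarith

theorem norm_digamma_term_le {w : ℂ} (hw : 0 < w.re) (k : ℕ) :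
    ‖(Real.log ((k + 2) / (k + 1)) : ℂ) - 1 / (k + 1 + w)‖ ≤ (1 + ‖w‖) / ((k : ℝ) + 1) ^ 2 := by
  have hk : (0 : ℝ) < k + 1 := by positivity
  have hn := norm_add_le_of_re_pos hw hk.le
  push_cast at hn
  have h0 : (k : ℂ) + 1 + w ≠ 0 := norm_pos_iff.1 (hk.trans_le hn)
  have hk0 : (k : ℂ) + 1 ≠ 0 := by exact_mod_cast hk.ne'
  have e : (Real.log ((k + 2) / (k + 1)) : ℂ) - 1 / (k + 1 + w)
      = ((Real.log (((k : ℝ) + 2) / (k + 1)) - 1 / (k + 1) : ℝ) : ℂ) + w / ((k + 1) * (k + 1 + w)) := by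
    push_cast
    field_simp
    ring
  rw [e]
  refine (norm_add_le _ _).trans ?_
  rw [add_div 1 ‖w‖]
  refine add_le_add ?_ ?_
  · rw [Complex.norm_real]; exact abs_log_sub_inv_le k
  · rw [norm_div, norm_mul, sq]
    have : ‖(k : ℂ) + 1‖ = k + 1 := by
      rw [← Nat.cast_one, ← Nat.cast_add, Complex.norm_natCast]; push_cast; ring
    rw [this]
    gcongr

theorem summable_inv_succ_sq : Summable fun k : ℕ => 1 / ((k : ℝ) + 1) ^ 2 := by
  have := (summable_nat_add_iff 1).2 (Real.summable_one_div_nat_pow.2 one_lt_two)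
  simpa using this

theorem summable_digamma_term {w : ℂ} (hw : 0 < w.re) :
    Summable fun k : ℕ => (Real.log ((k + 2) / (k + 1)) : ℂ) - 1 / (k + 1 + w) := by
  refine Summable.of_norm_bounded (g := fun k : ℕ => (1 + ‖w‖) * (1 / ((k : ℝ) + 1) ^ 2))
    (summable_inv_succ_sq.mul_left _) fun k => ?_
  rw [mul_one_div]; exact norm_digamma_term_le hw k

theorem one_add_div_mem_slitPlane {w : ℂ} (hw : 0 < w.re) (k : ℕ) :
    1 + w / (k + 1) ∈ Complex.slitPlane := by
  left
  have : (w / (k + 1)).re = w.re / (k + 1) := by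
    rw [show ((k : ℂ) + 1) = ((k + 1 : ℝ) : ℂ) by push_cast; ring, Complex.div_ofReal_re]
  rw [Complex.add_re, this, Complex.one_re]; positivity

theorem hasDerivAt_logGamma_term {w : ℂ} (hw : 0 < w.re) (k : ℕ) :
    HasDerivAt (fun w : ℂ => w * (Real.log ((k + 2) / (k + 1)) : ℂ) - Complex.log (1 + w / (k + 1)))
      ((Real.log ((k + 2) / (k + 1)) : ℂ) - 1 / (k + 1 + w)) w := by
  have hk : (0 : ℝ) < k + 1 := by positivity
  have hk0 : (k : ℂ) + 1 ≠ 0 := by exact_mod_cast hk.ne'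
  have h1 := (hasDerivAt_id w).mul_const (Real.log ((k + 2) / (k + 1)) : ℂ)
  have h2 := (((hasDerivAt_id w).div_const ((k : ℂ) + 1)).const_add 1).clog
    (one_add_div_mem_slitPlane hw k)
  refine (h1.sub h2).congr_deriv ?_
  have h0 := Complex.slitPlane_ne_zero (one_add_div_mem_slitPlane hw k)
  have h3 : (k : ℂ) + 1 + w ≠ 0 := by
    intro h; apply h0; field_simp; rw [h, mul_zero]
  rw [id_eq, one_mul]; congr 1
  field_simp

theorem hasDerivAt_logGamma_tsum {w : ℂ} (hw : 0 < w.re) :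
    (Summable fun k : ℕ =>
      (w * (Real.log ((k + 2) / (k + 1)) : ℂ) - Complex.log (1 + w / (k + 1)))) ∧
    HasDerivAt (fun w => ∑' k : ℕ,
      (w * (Real.log ((k + 2) / (k + 1)) : ℂ) - Complex.log (1 + w / (k + 1))))
      (∑' k : ℕ, ((Real.log ((k + 2) / (k + 1)) : ℂ) - 1 / (k + 1 + w))) w := by
  -- The half-disc must contain w and also 1: at 1 every term of the series vanishes, which supplies
  -- the point of convergence needed for termwise differentiation.
  set R := max ‖w‖ 1 + 1
  set t : Set ℂ := {z | 0 < z.re} ∩ Metric.ball 0 R with ht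
  have hto : IsOpen t := (isOpen_lt continuous_const Complex.continuous_re).inter Metric.isOpen_ball
  have htc : IsPreconnected t :=
    ((convex_halfSpace_re_gt 0).inter (convex_ball _ _)).isPreconnected
  have hwt : w ∈ t := ⟨hw, by
    rw [mem_ball_zero_iff]; exact (le_max_left _ _).trans_lt (lt_add_one _)⟩
  have h1t : (1 : ℂ) ∈ t := ⟨by simp, by
    rw [mem_ball_zero_iff, norm_one]; exact (le_max_right _ _).trans_lt (lt_add_one _)⟩
  have hu : Summable fun k : ℕ => (1 + R) * (1 / ((k : ℝ) + 1) ^ 2) :=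
    summable_inv_succ_sq.mul_left _
  have hb : ∀ (k : ℕ) (y : ℂ), y ∈ t → ‖(Real.log ((k + 2) / (k + 1)) : ℂ) - 1 / (k + 1 + y)‖ ≤
      (1 + R) * (1 / ((k : ℝ) + 1) ^ 2) := fun k y hy => by
    rw [mul_one_div]
    refine (norm_digamma_term_le hy.1 k).trans ?_
    have := (mem_ball_zero_iff.1 hy.2).le
    gcongr
  have hz : ∀ k : ℕ, (1 : ℂ) * (Real.log ((k + 2) / (k + 1)) : ℂ) - Complex.log (1 + 1 / (k + 1)) = 0 := by
    intro k
    have hk : (0 : ℝ) < k + 1 := by positivity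
    have : (1 : ℂ) + 1 / (k + 1) = (((k + 2) / (k + 1) : ℝ) : ℂ) := by
      push_cast
      have hk0 : (k : ℂ) + 1 ≠ 0 := by exact_mod_cast hk.ne'
      field_simp; ring
    rw [this, ← Complex.ofReal_log (by positivity)]; ring
  have h1s : Summable fun k : ℕ =>
      ((1 : ℂ) * (Real.log ((k + 2) / (k + 1)) : ℂ) - Complex.log (1 + 1 / (k + 1))) := by
    simp_rw [hz]; exact summable_zero
  have hg := fun (k : ℕ) (y : ℂ) (hy : y ∈ t) => hasDerivAt_logGamma_term hy.1 k
  clear_value t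
  set g : ℕ → ℂ → ℂ := fun k w =>
    w * (Real.log ((k + 2) / (k + 1)) : ℂ) - Complex.log (1 + w / (k + 1)) with hgdef
  set g' : ℕ → ℂ → ℂ := fun k w => (Real.log ((k + 2) / (k + 1)) : ℂ) - 1 / (k + 1 + w) with hg'def
  exact ⟨summable_of_summable_hasDerivAt_of_isPreconnected (g := g) (g' := g') hu hto htc hg hb
      h1t h1s hwt,
    hasDerivAt_tsum_of_isPreconnected (g := g) (g' := g') hu hto htc hg hb h1t h1s hwt⟩

theorem hasDerivAt_logGammaSeries {w : ℂ} (hw : 0 < w.re) :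
    HasDerivAt logGammaSeries (digammaSeries w) w := by
  have h := (hasDerivAt_logGamma_tsum hw).2.sub (Complex.hasDerivAt_log (z := w) (Or.inl hw))
  rw [← one_div] at h
  exact h

theorem sum_log_succ (n : ℕ) :
    ∑ k ∈ Finset.range n, Real.log (((k : ℝ) + 2) / (k + 1)) = Real.log (n + 1) := by
  induction n with
  | zero => simp
  | succ n ih =>
    rw [Finset.sum_range_succ, ih, ← Real.log_mul (by positivity) (by positivity)]
    congr 1; push_cast; field_simp; ring

theorem tendsto_logGammaSeries {w : ℂ} (hw : 0 < w.re) :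
    Tendsto (fun n : ℕ => w * (Real.log (n + 1) : ℂ)
      - ∑ k ∈ Finset.range n, Complex.log (1 + w / (k + 1)) - Complex.log w) atTop
      (𝓝 (logGammaSeries w)) := by
  have h := (hasDerivAt_logGamma_tsum hw).1.hasSum.tendsto_sum_nat.sub_const (Complex.log w)
  refine h.congr fun n => ?_
  rw [Finset.sum_sub_distrib, ← Finset.mul_sum, ← sum_log_succ n]
  push_cast; rfl

/-- Exponentiated, the partial sums are Euler's sequence `Complex.GammaSeq` with (n + 1)^w in place
of n^w; the extra factor (1 + 1/n)^w tends to 1. -/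
theorem exp_logGammaSeries {w : ℂ} (hw : 0 < w.re) :
    Complex.exp (logGammaSeries w) = Complex.Gamma w := by
  have hw0 : w ≠ 0 := fun h => by simp [h] at hw
  refine tendsto_nhds_unique
    ((Complex.continuous_exp.tendsto _).comp (tendsto_logGammaSeries hw)) ?_
  have hlim : Tendsto (fun n : ℕ => Complex.exp (w * ((Real.log (1 + 1 / (n : ℝ)) : ℝ) : ℂ)))
      atTop (𝓝 1) := by
    have h1 : Tendsto (fun n : ℕ => Real.log (1 + 1 / (n : ℝ))) atTop (𝓝 0) := by
      have : Tendsto (fun n : ℕ => 1 + 1 / (n : ℝ)) atTop (𝓝 (1 + 0)) :=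
        tendsto_const_nhds.add tendsto_one_div_atTop_nhds_zero_nat
      have h2 := this.log (by norm_num)
      simpa using h2
    have h2 : Tendsto (fun n : ℕ => w * ((Real.log (1 + 1 / (n : ℝ)) : ℝ) : ℂ)) atTop (𝓝 (w * (0:ℝ))) :=
      ((Complex.continuous_ofReal.tendsto _).comp h1).const_mul w
    have h3 := (Complex.continuous_exp.tendsto _).comp h2
    simpa [Function.comp_def] using h3
  have hG := (Complex.GammaSeq_tendsto_Gamma w).mul hlim
  rw [mul_one] at hG
  refine hG.congr' ?_
  filter_upwards [eventually_ge_atTop 1] with n hn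
  have hn0 : (0 : ℝ) < n := by exact_mod_cast hn
  have hprod : ∀ m : ℕ, (∏ k ∈ Finset.range m, (1 + w / ((k : ℂ) + 1))) * w * (m.factorial : ℂ)
      = ∏ j ∈ Finset.range (m + 1), (w + j) := by
    intro m
    induction m with
    | zero => simp
    | succ m ih =>
      have hm0 : (m : ℂ) + 1 ≠ 0 := by exact_mod_cast (Nat.succ_ne_zero m)
      rw [Finset.prod_range_succ _ (m + 1), ← ih, Finset.prod_range_succ, Nat.factorial_succ]
      push_cast; field_simp; ring
  simp only [Function.comp]
  rw [Complex.exp_sub, Complex.exp_sub, Complex.exp_sum, Complex.exp_log hw0, Complex.GammaSeq]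
  have hp : ∏ k ∈ Finset.range n, Complex.exp (Complex.log (1 + w / ((k : ℂ) + 1)))
      = ∏ k ∈ Finset.range n, (1 + w / ((k : ℂ) + 1)) :=
    Finset.prod_congr rfl fun k _ =>
      Complex.exp_log (Complex.slitPlane_ne_zero (one_add_div_mem_slitPlane hw k))
  have hp0 : ∏ k ∈ Finset.range n, (1 + w / ((k : ℂ) + 1)) ≠ 0 :=
    Finset.prod_ne_zero_iff.2 fun k _ => Complex.slitPlane_ne_zero (one_add_div_mem_slitPlane hw k)
  rw [hp, ← hprod, Complex.cpow_def_of_ne_zero (by exact_mod_cast hn0.ne')]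
  have hf : (n.factorial : ℂ) ≠ 0 := by exact_mod_cast n.factorial_ne_zero
  have hlog : (Real.log (n + 1) : ℂ) = Complex.log n + (Real.log (1 + 1 / (n : ℝ)) : ℝ) := by
    rw [← Complex.ofReal_natCast, ← Complex.ofReal_log hn0.le, ← Complex.ofReal_add,
      ← Real.log_mul hn0.ne' (by positivity)]
    congr 2; field_simp
  rw [hlog, mul_add, Complex.exp_add, mul_comm w (Complex.log _)]
  field_simp

theorem Complex.arg_eq_arctan_of_re_pos {z : ℂ} (hz : 0 < z.re) :
    z.arg = Real.arctan (z.im / z.re) := by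
  have h := Complex.abs_arg_lt_pi_div_two_iff.2 (Or.inl hz)
  rw [abs_lt] at h
  rw [← Complex.tan_arg, Real.arctan_tan h.1 h.2]

/-- The factor 1 + (2 + it)/(k + 1) is a positive multiple of k + 3 + it and has argument
arctan(t/(k + 3)). The term -log w supplies the missing arctan(t/2), whence n + 1 summands starting
at 2. -/
theorem tendsto_logGammaSeries_im (t : ℝ) :
    Tendsto (fun n : ℕ => t * Real.log (n + 1)
      - ∑ k ∈ Finset.range (n + 1), Real.arctan (t / (k + 2))) atTop
      (𝓝 (logGammaSeries (2 + t * Complex.I)).im) := by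
  have hw : 0 < (2 + t * Complex.I : ℂ).re := by simp
  have h := (Complex.continuous_im.tendsto _).comp (tendsto_logGammaSeries hw)
  refine h.congr fun n => ?_
  simp only [Function.comp, Complex.sub_im, Complex.im_sum, Complex.log_im]
  rw [Finset.sum_range_succ', Complex.im_mul_ofReal]
  have e1 : (2 + t * Complex.I : ℂ).arg = Real.arctan (t / 2) := by
    rw [Complex.arg_eq_arctan_of_re_pos hw]; simp
  have e2 : ∀ k : ℕ, (1 + (2 + t * Complex.I : ℂ) / (k + 1)).arg
      = Real.arctan (t / ((k + 1 : ℕ) + 2)) := fun k => by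
    have hk : (0 : ℝ) < k + 1 := by positivity
    have hk0 : (k : ℂ) + 1 ≠ 0 := by exact_mod_cast hk.ne'
    have e3 : (1 + (2 + t * Complex.I : ℂ) / (k + 1))
        = (((k + 1 : ℝ)⁻¹ : ℝ) : ℂ) * (((k : ℝ) + 3 : ℝ) + t * Complex.I) := by
      push_cast; field_simp; ring
    rw [e3, Complex.arg_real_mul _ (by positivity), Complex.arg_eq_arctan_of_re_pos]
    · have h3 : (k : ℝ) + 3 = k + 1 + 2 := by ring
      simp [h3]
    · simp; positivity
  simp_rw [e1, e2]
  simp; ring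

/-! ### Stirling-type estimates -/

/-- An antiderivative of `x ↦ arctan (t / x)` on the positive half-line. -/
noncomputable def arctanDivPrim (t x : ℝ) : ℝ :=
  x * Real.arctan (t / x) + t / 2 * Real.log (x ^ 2 + t ^ 2)

theorem hasDerivAt_arctan_div (t : ℝ) {x : ℝ} (hx : 0 < x) :
    HasDerivAt (fun x => Real.arctan (t / x)) (-t / (x ^ 2 + t ^ 2)) x := by
  have h := ((hasDerivAt_const x t).div (hasDerivAt_id x) hx.ne').arctan
  refine h.congr_deriv ?_
  have : 0 < x ^ 2 + t ^ 2 := by positivity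
  simp only [id, Pi.div_apply]
  field_simp
  ring

theorem hasDerivAt_arctanDivPrim (t : ℝ) {x : ℝ} (hx : 0 < x) :
    HasDerivAt (arctanDivPrim t) (Real.arctan (t / x)) x := by
  have h0 : 0 < x ^ 2 + t ^ 2 := by positivity
  have h1 := (hasDerivAt_id x).mul (hasDerivAt_arctan_div t hx)
  have h2 := (((((hasDerivAt_id x).pow 2).add_const (t ^ 2)).log h0.ne').const_mul (t / 2))
  refine (h1.add h2).congr_deriv ?_
  simp only [id, Pi.pow_apply]
  field_simp
  ring

theorem antitoneOn_arctan_div {t : ℝ} (ht : 0 ≤ t) :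
    AntitoneOn (fun x => Real.arctan (t / x)) (Ioi 0) := by
  intro x hx y hy hxy
  exact Real.arctan_mono (div_le_div_of_nonneg_left ht hx hxy)

/-- The function x ↦ arctan(t/x) is convex on the positive half-line, so the trapezoidal rule
overestimates its integral. With a variable step h, the derivative of the error is half the defect
in the tangent inequality at x + h. -/
theorem arctanDivPrim_step_le_trapezoid {t x : ℝ} (ht : 0 ≤ t) (hx : 0 < x) :
    arctanDivPrim t (x + 1) - arctanDivPrim t x ≤
      (Real.arctan (t / x) + Real.arctan (t / (x + 1))) / 2 := by
  have hsh : ∀ h : ℝ, HasDerivAt (fun h => x + h) 1 h := fun h => (hasDerivAt_id h).const_add x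
  have hf : ∀ h : ℝ, 0 ≤ h → HasDerivAt (fun h => Real.arctan (t / (x + h)))
      (-t / ((x + h) ^ 2 + t ^ 2)) h := fun h hh => by
    have := (hasDerivAt_arctan_div t (x := x + h) (by linarith)).comp h (hsh h)
    exact this.congr_deriv (by simp)
  -- tangent line inequality
  have hχ : ∀ h : ℝ, 0 ≤ h →
      0 ≤ Real.arctan (t / x) - Real.arctan (t / (x + h)) + h * (-t / ((x + h) ^ 2 + t ^ 2)) := by
    have hd : ∀ h : ℝ, 0 ≤ h → HasDerivAt (fun h => Real.arctan (t / x) - Real.arctan (t / (x + h))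
        + h * (-t / ((x + h) ^ 2 + t ^ 2))) (h * (2 * t * (x + h) / ((x + h) ^ 2 + t ^ 2) ^ 2)) h := by
      intro h hh
      have hp : 0 < x + h := by linarith
      have h0 : 0 < (x + h) ^ 2 + t ^ 2 := by positivity
      have h1 := ((hasDerivAt_const h (-t)).div (((hsh h).pow 2).add_const (t ^ 2)) h0.ne')
      refine (((hasDerivAt_const h (Real.arctan (t / x))).sub (hf h hh)).add
        ((hasDerivAt_id h).mul h1)).congr_deriv ?_
      simp only [id, Pi.div_apply, Pi.pow_apply]
      field_simp
      ring
    intro h hh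
    have hm : MonotoneOn (fun h => Real.arctan (t / x) - Real.arctan (t / (x + h))
        + h * (-t / ((x + h) ^ 2 + t ^ 2))) (Ici 0) := by
      refine monotoneOn_of_hasDerivWithinAt_nonneg (convex_Ici 0)
        (fun u hu => (hd u hu).continuousAt.continuousWithinAt)
        (fun u hu => (hd u (interior_subset hu)).hasDerivWithinAt) fun u hu => ?_
      have hu' : (0 : ℝ) ≤ u := interior_subset hu
      positivity
    simpa using hm (mem_Ici.2 le_rfl) (mem_Ici.2 hh) hh
  have hd : ∀ h : ℝ, 0 ≤ h → HasDerivAt (fun h =>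
      h * ((Real.arctan (t / x) + Real.arctan (t / (x + h))) / 2) - arctanDivPrim t (x + h))
      ((Real.arctan (t / x) - Real.arctan (t / (x + h)) + h * (-t / ((x + h) ^ 2 + t ^ 2))) / 2) h := by
    intro h hh
    have hp : 0 < x + h := by linarith
    have h1 := (hasDerivAt_id h).mul (((hf h hh).const_add (Real.arctan (t / x))).div_const 2)
    have h2 := (hasDerivAt_arctanDivPrim t hp).comp h (hsh h)
    refine (h1.sub h2).congr_deriv ?_
    simp only [id]; ring
  have hm : MonotoneOn (fun h =>
      h * ((Real.arctan (t / x) + Real.arctan (t / (x + h))) / 2) - arctanDivPrim t (x + h))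
      (Ici 0) := by
    refine monotoneOn_of_hasDerivWithinAt_nonneg (convex_Ici 0)
      (fun u hu => (hd u hu).continuousAt.continuousWithinAt)
      (fun u hu => (hd u (interior_subset hu)).hasDerivWithinAt) fun u hu => ?_
    have := hχ u (interior_subset hu); positivity
  have := hm (mem_Ici.2 le_rfl) (mem_Ici.2 zero_le_one) zero_le_one
  simp only [zero_mul, zero_sub, add_zero, one_mul] at this
  linarith

theorem tendsto_arctanDivPrim {t : ℝ} (ht : 0 < t) :
    Tendsto (fun n : ℕ => t * Real.log (n + 1) - arctanDivPrim t (n + 2)) atTop (𝓝 (-t)) := by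
  have hy : Tendsto (fun n : ℕ => (n : ℝ) + 2) atTop atTop :=
    tendsto_atTop_add_const_right _ _ tendsto_natCast_atTop_atTop
  have hz : Tendsto (fun n : ℕ => (n : ℝ) + 1) atTop atTop :=
    tendsto_atTop_add_const_right _ _ tendsto_natCast_atTop_atTop
  have h1 : Tendsto (fun n : ℕ => ((n : ℝ) + 2) * Real.arctan (t / (n + 2))) atTop (𝓝 t) := by
    have hs := (Real.hasDerivAt_arctan 0).tendsto_slope
    have hw : Tendsto (fun n : ℕ => t / ((n : ℝ) + 2)) atTop (𝓝[≠] 0) := by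
      refine tendsto_nhdsWithin_iff.2 ⟨hy.const_div_atTop t, Eventually.of_forall fun n => ?_⟩
      have : 0 < t / ((n : ℝ) + 2) := by positivity
      exact this.ne'
    have := (hs.comp hw).const_mul t
    simp only [Function.comp_def, slope_def_field, Real.arctan_zero, sub_zero] at this
    norm_num at this
    refine this.congr fun n => ?_
    have : (n : ℝ) + 2 ≠ 0 := by positivity
    field_simp
  have h2 : Tendsto (fun n : ℕ => t / 2 * Real.log ((((n : ℝ) + 2) ^ 2 + t ^ 2) / (n + 1) ^ 2)) atTop
      (𝓝 0) := by
    have hi : Tendsto (fun n : ℕ => ((n : ℝ) + 1)⁻¹) atTop (𝓝 0) := tendsto_inv_atTop_zero.comp hz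
    have : Tendsto (fun n : ℕ => (1 + ((n : ℝ) + 1)⁻¹) ^ 2 + (t * ((n : ℝ) + 1)⁻¹) ^ 2) atTop
        (𝓝 ((1 + 0) ^ 2 + (t * 0) ^ 2)) := ((hi.const_add 1).pow 2).add ((hi.const_mul t).pow 2)
    have h3 := (this.log (by norm_num)).const_mul (t / 2)
    norm_num at h3
    refine h3.congr fun n => ?_
    have : (n : ℝ) + 1 ≠ 0 := by positivity
    congr 2; field_simp; ring
  have h3 := (h1.neg.sub h2)
  rw [sub_zero] at h3
  refine h3.congr fun n => ?_
  rw [Real.log_div (by positivity) (by positivity), Real.log_pow, arctanDivPrim]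
  push_cast; ring

/-- The trapezoidal rule bounds the arctangent sum below. The coefficient 3/2 is 2 - 1/2: the
primitive at 2 contributes 2 arctan(t/2), and half of the first term is subtracted. -/
theorem logGammaSeries_im_le {t : ℝ} (ht : 0 < t) :
    (logGammaSeries (2 + t * Complex.I)).im ≤
      3 / 2 * Real.arctan (t / 2) + t / 2 * Real.log (4 + t ^ 2) - t := by
  have hb : ∀ n : ℕ, t * Real.log (n + 1) - ∑ k ∈ Finset.range (n + 1), Real.arctan (t / (k + 2))
      ≤ t * Real.log (n + 1) - arctanDivPrim t (n + 2) + (arctanDivPrim t 2 - Real.arctan (t / 2) / 2) := by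
    intro n
    have : arctanDivPrim t (n + 2) - arctanDivPrim t 2 + Real.arctan (t / 2) / 2
        + Real.arctan (t / (n + 2)) / 2 ≤ ∑ k ∈ Finset.range (n + 1), Real.arctan (t / (k + 2)) := by
      induction n with
      | zero => simp
      | succ n ih =>
        rw [Finset.sum_range_succ]
        have := arctanDivPrim_step_le_trapezoid ht.le (x := (n : ℝ) + 2) (by positivity)
        rw [show ((n : ℝ) + 2 + 1) = ((n + 1 : ℕ) : ℝ) + 2 by push_cast; ring] at this
        linarith
    have h2 : 0 ≤ Real.arctan (t / (n + 2)) := Real.arctan_nonneg.2 (by positivity)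
    linarith
  have := le_of_tendsto_of_tendsto' (tendsto_logGammaSeries_im t)
    ((tendsto_arctanDivPrim ht).add_const _) hb
  rw [arctanDivPrim] at this
  norm_num at this
  linarith

/-- Here monotonicity suffices: every summand after the first is at most the integral over the
preceding unit interval. Keeping the whole first term changes the coefficient of arctan(t/2) from 2
to 1. -/
theorem le_logGammaSeries_im {t : ℝ} (ht : 0 < t) :
    Real.arctan (t / 2) + t / 2 * Real.log (4 + t ^ 2) - t ≤
      (logGammaSeries (2 + t * Complex.I)).im := by
  have hb : ∀ n : ℕ, t * Real.log (n + 1) - arctanDivPrim t (n + 2)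
      + (arctanDivPrim t 2 - Real.arctan (t / 2)) ≤
      t * Real.log (n + 1) - ∑ k ∈ Finset.range (n + 1), Real.arctan (t / (k + 2)) := by
    intro n
    have : ∑ k ∈ Finset.range (n + 1), Real.arctan (t / (k + 2)) ≤
        arctanDivPrim t (n + 2) - arctanDivPrim t 2 + Real.arctan (t / 2) := by
      have key : ∀ x : ℝ, 0 < x → Real.arctan (t / (x + 1)) ≤
          arctanDivPrim t (x + 1) - arctanDivPrim t x := by
        intro x hx
        have hpos : ∀ u ∈ Icc x (x + 1), 0 < u := fun u hu => hx.trans_le hu.1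
        obtain ⟨c, hc, hc'⟩ := exists_hasDerivAt_eq_slope (arctanDivPrim t)
          (fun x => Real.arctan (t / x)) (lt_add_one x)
          (fun u hu => (hasDerivAt_arctanDivPrim t (hpos u hu)).continuousAt.continuousWithinAt)
          (fun u hu => hasDerivAt_arctanDivPrim t (hpos u ⟨hu.1.le, hu.2.le⟩))
        rw [add_sub_cancel_left, div_one] at hc'
        rw [← hc']
        exact antitoneOn_arctan_div ht.le (hx.trans hc.1) (show 0 < x + 1 by linarith) hc.2.le
      induction n with
      | zero => simp
      | succ n ih =>
        rw [Finset.sum_range_succ]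
        have := key ((n : ℝ) + 2) (by positivity)
        rw [show ((n : ℝ) + 2 + 1) = ((n + 1 : ℕ) : ℝ) + 2 by push_cast; ring] at this
        linarith
    linarith
  have := le_of_tendsto_of_tendsto' ((tendsto_arctanDivPrim ht).add_const _)
    (tendsto_logGammaSeries_im t) hb
  rw [arctanDivPrim] at this
  norm_num at this
  linarith

/-- This is the trapezoidal error for 1/z over a unit step. As a function of the step h its
derivative is h²/(2z(z + h)²), at most h²/(2|z|³) in modulus because |z + h| ≥ |z| in the right
half-plane; integrate from 0 to 1. -/
theorem norm_trapezoid_log_le {z : ℂ} (hz : 0 < z.re) :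
    ‖(1 / z + 1 / (z + 1)) / 2 - (Complex.log (z + 1) - Complex.log z)‖ ≤ 1 / (6 * ‖z‖ ^ 3) := by
  have hz0 : z ≠ 0 := fun h => by simp [h] at hz
  have hn0 : 0 < ‖z‖ := norm_pos_iff.2 hz0
  have hre : ∀ h : ℝ, 0 ≤ h → 0 < (z + h).re := fun h hh => by simp; linarith
  have hne : ∀ h : ℝ, 0 ≤ h → z + h ≠ 0 := fun h hh h0 => by
    have := hre h hh; simp [h0] at this
  have hle : ∀ h : ℝ, 0 ≤ h → ‖z‖ ≤ ‖z + h‖ := fun h hh => by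
    rw [← sq_le_sq₀ (norm_nonneg _) (norm_nonneg _), Complex.sq_norm, Complex.sq_norm,
      Complex.normSq_apply, Complex.normSq_apply]
    simp; nlinarith
  set f : ℝ → ℂ := fun h => h * ((1 / z + 1 / (z + h)) / 2) - (Complex.log (z + h) - Complex.log z)
  have hd : ∀ h : ℝ, 0 ≤ h → HasDerivAt f (h ^ 2 / (2 * z * (z + h) ^ 2)) h := by
    intro h hh
    have h1 : HasDerivAt (fun h : ℝ => (h : ℂ)) 1 h := Complex.ofRealCLM.hasDerivAt
    have h2 := h1.const_add z
    have h3 := (h1.mul ((((hasDerivAt_const h (1 : ℂ)).div h2 (hne h hh)).const_add (1 / z)).div_const 2)).sub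
      ((h2.clog_real (Or.inl (hre h hh))).sub_const (Complex.log z))
    refine h3.congr_deriv ?_
    have := hne h hh
    simp only [Pi.div_apply]
    field_simp
    ring
  have hB : ∀ h : ℝ, HasDerivAt (fun h : ℝ => h ^ 3 / (6 * ‖z‖ ^ 3)) (h ^ 2 / (2 * ‖z‖ ^ 3)) h := by
    intro h
    refine ((hasDerivAt_pow 3 h).div_const _).congr_deriv ?_
    field_simp; push_cast; ring
  have := image_norm_le_of_norm_deriv_right_le_deriv_boundary (f := f) (a := 0) (b := 1)
    (f' := fun h => h ^ 2 / (2 * z * (z + h) ^ 2)) (B := fun h : ℝ => h ^ 3 / (6 * ‖z‖ ^ 3))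
    (B' := fun h => h ^ 2 / (2 * ‖z‖ ^ 3))
    (fun h hh => (hd h hh.1).continuousAt.continuousWithinAt)
    (fun h hh => (hd h hh.1).hasDerivWithinAt) (by simp [f]) hB
    (fun h hh => by
      simp only [norm_div, norm_mul, norm_pow, Complex.norm_real, Real.norm_eq_abs, sq_abs,
        RCLike.norm_ofNat]
      have := hle h hh.1
      rw [show 2 * ‖z‖ ^ 3 = 2 * ‖z‖ * ‖z‖ ^ 2 by ring]
      gcongr) (right_mem_Icc.2 zero_le_one)
  simpa [f] using this

/-- Replacing each 1/(w + k) by trapezoids makes the logarithms telescope, so the partial sums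
differ from log w - 1/(2w) by the trapezoidal errors and a remainder `r n` tending to 0. -/
theorem norm_digammaSeries_sub_le {w : ℂ} (hw : 0 < w.re) {C : ℝ}
    (hC : ∀ n : ℕ, ∑ k ∈ Finset.range n, 1 / ‖w + k‖ ^ 3 ≤ C) :
    ‖digammaSeries w - (Complex.log w - 1 / (2 * w))‖ ≤ C / 6 := by
  have hre : ∀ k : ℕ, 0 < (w + k).re := fun k => by simp; positivity
  have hne : ∀ k : ℕ, w + k ≠ 0 := fun k h => by have := hre k; simp [h] at this
  have hw0 : w ≠ 0 := by simpa using hne 0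
  set E : ℕ → ℂ := fun k => (1 / (w + k) + 1 / (w + k + 1)) / 2
    - (Complex.log (w + k + 1) - Complex.log (w + k)) with hE
  have hψ := (summable_digamma_term hw).hasSum.tendsto_sum_nat.sub_const (1 / w)
  set r : ℕ → ℂ := fun n => Complex.log ((w + n) / (n + 1)) + 1 / (2 * (w + n)) with hr
  have hi : Tendsto (fun n : ℕ => ((n : ℂ) + 1)⁻¹) atTop (𝓝 0) := by
    have := tendsto_one_div_add_atTop_nhds_zero_nat (𝕜 := ℂ)
    simpa using this
  have hr0 : Tendsto r atTop (𝓝 0) := by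
    have h1 : Tendsto (fun n : ℕ => (w + n) / ((n : ℂ) + 1)) atTop (𝓝 1) := by
      have := ((hi.const_mul (w - 1)).const_add 1)
      rw [mul_zero, add_zero] at this
      refine this.congr fun n => ?_
      have : (n : ℂ) + 1 ≠ 0 := by exact_mod_cast n.succ_ne_zero
      field_simp; ring
    have h2 : Tendsto (fun n : ℕ => 1 / (2 * (w + n))) atTop (𝓝 0) := by
      have h3 : Tendsto (fun n : ℕ => ((n : ℂ) + 1)⁻¹ * (1 / 2 * ((w + n) / ((n : ℂ) + 1))⁻¹)) atTop
          (𝓝 (0 * (1 / 2 * 1⁻¹))) := hi.mul ((h1.inv₀ one_ne_zero).const_mul _)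
      rw [zero_mul] at h3
      refine h3.congr fun n => ?_
      have : (n : ℂ) + 1 ≠ 0 := by exact_mod_cast n.succ_ne_zero
      have := hne n
      field_simp
    have h4 := (h1.clog (by simp)).add h2
    simpa [hr] using h4
  have hid : ∀ n : ℕ, (∑ k ∈ Finset.range n, ((Real.log ((k + 2) / (k + 1)) : ℂ) - 1 / (k + 1 + w))
      - 1 / w) - (Complex.log w - 1 / (2 * w)) = -∑ k ∈ Finset.range n, E k - r n := by
    intro n
    have h1 : ∀ n : ℕ, (∑ k ∈ Finset.range n, ((Real.log ((k + 2) / (k + 1)) : ℂ) - 1 / (k + 1 + w))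
        - 1 / w) - (Complex.log w - 1 / (2 * w)) = -∑ k ∈ Finset.range n, E k
        - (Complex.log (w + n) - Real.log (n + 1) + 1 / (2 * (w + n))) := by
      intro n
      induction n with
      | zero => simp; field_simp; ring
      | succ n ih =>
        rw [Finset.sum_range_succ, Finset.sum_range_succ, add_sub_right_comm, add_sub_right_comm, ih]
        have h2 : Real.log (((n + 1 : ℕ) : ℝ) + 1) = Real.log (n + 1) + Real.log ((n + 2) / (n + 1)) := by
          rw [← Real.log_mul (by positivity) (by positivity)]
          congr 1; push_cast; field_simp; ring
        have h3 : (n : ℂ) + 1 + w = w + n + 1 := by ring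
        have h4 := hne n
        have h5 : w + n + 1 ≠ 0 := by have := hne (n + 1); push_cast at this; rwa [← add_assoc] at this
        have h6 : w + ((n + 1 : ℕ) : ℂ) = w + n + 1 := by push_cast; ring
        simp only [hE]
        rw [h2, h3, h6]
        push_cast
        field_simp
        ring
    rw [h1, hr]
    congr 2
    have h2 : (w + n) = ((n + 1 : ℝ) : ℂ) * ((w + n) / (n + 1)) := by
      have : (n : ℂ) + 1 ≠ 0 := by exact_mod_cast n.succ_ne_zero
      push_cast; field_simp
    have h3 : (w + n) / (n + 1) ≠ 0 := div_ne_zero (hne n) (by exact_mod_cast n.succ_ne_zero)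
    conv_lhs => rw [h2, Complex.log_ofReal_mul (by positivity) h3]
    ring
  have hb : ∀ n : ℕ, ‖(∑ k ∈ Finset.range n, ((Real.log ((k + 2) / (k + 1)) : ℂ) - 1 / (k + 1 + w))
      - 1 / w) - (Complex.log w - 1 / (2 * w))‖ ≤ C / 6 + ‖r n‖ := by
    intro n
    rw [hid]
    refine (norm_sub_le _ _).trans (add_le_add ?_ le_rfl)
    rw [norm_neg]
    refine (norm_sum_le _ _).trans ?_
    calc ∑ k ∈ Finset.range n, ‖E k‖ ≤ ∑ k ∈ Finset.range n, (1 / ‖w + k‖ ^ 3) / 6 := by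
          refine Finset.sum_le_sum fun k _ => (norm_trapezoid_log_le (hre k)).trans (le_of_eq ?_)
          rw [div_div, mul_comm]
      _ ≤ C / 6 := by rw [← Finset.sum_div]; gcongr; exact hC n
  have hlim := hr0.norm.const_add (C / 6)
  rw [norm_zero, add_zero] at hlim
  exact le_of_tendsto_of_tendsto' (hψ.sub_const _).norm hlim hb

theorem sum_le_of_telescope {f : ℕ → ℝ} {g : ℕ → ℝ} (hg : ∀ n, 0 ≤ g n)
    (h : ∀ k, f k ≤ g k - g (k + 1)) (n : ℕ) : ∑ k ∈ Finset.range n, f k ≤ g 0 := by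
  calc ∑ k ∈ Finset.range n, f k ≤ ∑ k ∈ Finset.range n, (g k - g (k + 1)) :=
        Finset.sum_le_sum fun k _ => h k
    _ = g 0 - g n := Finset.sum_range_sub' g n
    _ ≤ g 0 := by linarith [hg n]

theorem one_div_sq_le_telescope {y : ℝ} (hy : 1 < y) : 1 / y ^ 2 ≤ 1 / (y - 1) - 1 / y := by
  have h1 : 0 < y - 1 := by linarith
  rw [div_sub_div _ _ h1.ne' (by linarith), div_le_div_iff₀ (by positivity) (by positivity)]
  nlinarith

theorem norm_le_norm_add_natCast {w : ℂ} (hw : 0 ≤ w.re) (k : ℕ) : ‖w‖ ≤ ‖w + k‖ := by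
  rw [← sq_le_sq₀ (norm_nonneg _) (norm_nonneg _), Complex.sq_norm, Complex.sq_norm,
    Complex.normSq_apply, Complex.normSq_apply]
  simp; nlinarith [mul_nonneg hw (Nat.cast_nonneg (α := ℝ) k), sq_nonneg (k : ℝ)]

/-- On Re w = 2 the real part of 1/(2w) is 1/|w|². The sum of cubes is handled by |w + k|³ ≥ |w| (2
+ k + |Im w|)²/2, whose reciprocal is dominated by a telescoping series; this keeps the decay in the
height. -/
theorem abs_digammaSeries_re_sub_le {w : ℂ} (hw : w.re = 2) :
    |(digammaSeries w).re - (Real.log ‖w‖ - 1 / ‖w‖ ^ 2)| ≤ 1 / (3 * (‖w‖ * (1 + |w.im|))) := by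
  have hpos : 0 < w.re := by rw [hw]; norm_num
  have hw0 : w ≠ 0 := fun h => by simp [h] at hpos
  have hn0 : 0 < ‖w‖ := norm_pos_iff.2 hw0
  set t := |w.im| with ht
  have ht0 : 0 ≤ t := abs_nonneg _
  have hC : ∀ n : ℕ, ∑ k ∈ Finset.range n, 1 / ‖w + k‖ ^ 3 ≤ 2 / (‖w‖ * (1 + t)) := by
    intro n
    have := sum_le_of_telescope (f := fun k : ℕ => 1 / ‖w + k‖ ^ 3)
      (g := fun k : ℕ => 2 / ‖w‖ * (1 / (1 + t + k))) (fun n => by positivity) (fun k => ?_) n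
    · refine this.trans (le_of_eq ?_)
      simp; field_simp
    · have h1 := norm_le_norm_add_natCast hpos.le k
      have h2 : (2 + k + t) ^ 2 / 2 ≤ ‖w + k‖ ^ 2 := by
        rw [Complex.sq_norm, Complex.normSq_apply]
        simp only [Complex.add_re, Complex.natCast_re, Complex.add_im, Complex.natCast_im, hw, add_zero]
        have : w.im * w.im = t * t := (abs_mul_abs_self _).symm
        rw [this]
        nlinarith [sq_nonneg (2 + (k : ℝ) - t)]
      have hk0 : 0 < (2 + (k : ℝ) + t) := by positivity
      calc 1 / ‖w + k‖ ^ 3 = 1 / (‖w + k‖ * ‖w + k‖ ^ 2) := by ring_nf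
        _ ≤ 1 / (‖w‖ * ((2 + k + t) ^ 2 / 2)) := by gcongr
        _ = 2 / ‖w‖ * (1 / (2 + k + t) ^ 2) := by field_simp
        _ ≤ 2 / ‖w‖ * (1 / ((2 + k + t) - 1) - 1 / (2 + k + t)) := by
            gcongr; exact one_div_sq_le_telescope (by linarith)
        _ = _ := by push_cast; rw [mul_sub]; ring_nf
  have h := norm_digammaSeries_sub_le hpos hC
  have h2 := (Complex.abs_re_le_norm _).trans h
  rw [Complex.sub_re, Complex.sub_re, Complex.log_re] at h2
  have h3 : (1 / (2 * w)).re = 1 / ‖w‖ ^ 2 := by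
    rw [Complex.sq_norm, one_div, Complex.inv_re]
    simp [hw]
    field_simp
  rw [h3] at h2
  refine h2.trans (le_of_eq ?_)
  field_simp; norm_num

theorem norm_digammaSeries_sub_log_le {w : ℂ} (hw : 2 ≤ w.re) :
    ‖digammaSeries w - Complex.log w‖ ≤ 1 / ‖w‖ := by
  have hpos : 0 < w.re := by linarith
  have hw0 : w ≠ 0 := fun h => by simp [h] at hpos
  have hn0 : 0 < ‖w‖ := norm_pos_iff.2 hw0
  have hC : ∀ n : ℕ, ∑ k ∈ Finset.range n, 1 / ‖w + k‖ ^ 3 ≤ 1 / ‖w‖ := by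
    intro n
    have := sum_le_of_telescope (f := fun k : ℕ => 1 / ‖w + k‖ ^ 3)
      (g := fun k : ℕ => 1 / ‖w‖ * (1 / (1 + (k : ℝ)))) (fun n => by positivity) (fun k => ?_) n
    · refine this.trans (le_of_eq (by simp))
    · have h1 := norm_le_norm_add_natCast hpos.le k
      have h2 : (2 + k : ℝ) ≤ ‖w + k‖ := by
        refine le_trans ?_ (Complex.re_le_norm _)
        simp; linarith
      calc 1 / ‖w + k‖ ^ 3 = 1 / (‖w + k‖ * ‖w + k‖ ^ 2) := by ring_nf
        _ ≤ 1 / (‖w‖ * (2 + k) ^ 2) := by gcongr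
        _ = 1 / ‖w‖ * (1 / (2 + k) ^ 2) := by field_simp
        _ ≤ 1 / ‖w‖ * (1 / ((2 + k) - 1) - 1 / (2 + k)) := by
            gcongr; exact one_div_sq_le_telescope (by linarith [Nat.cast_nonneg (α := ℝ) k])
        _ = _ := by push_cast; rw [mul_sub]; ring_nf
  have h := norm_digammaSeries_sub_le hpos hC
  have h3 : ‖1 / (2 * w)‖ = 1 / (2 * ‖w‖) := by simp
  have h4 : 1 / ‖w‖ / 6 + 1 / (2 * ‖w‖) ≤ 1 / ‖w‖ := by
    field_simp; norm_num
  have h5 := norm_sub_le (digammaSeries w - (Complex.log w - 1 / (2 * w))) (1 / (2 * w))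
  rw [h3, show digammaSeries w - (Complex.log w - 1 / (2 * w)) - 1 / (2 * w) =
    digammaSeries w - Complex.log w by ring] at h5
  linarith

theorem le_digammaSeries_re {w : ℂ} (hw : 2 ≤ w.re) :
    Real.log ‖w‖ - 1 / ‖w‖ ≤ (digammaSeries w).re := by
  have h2 := (abs_le.1 ((Complex.abs_re_le_norm _).trans (norm_digammaSeries_sub_log_le hw))).1
  rw [Complex.sub_re, Complex.log_re] at h2
  linarith

/-! ### Estimates for `ζ` and `ζ'/ζ` to the right of the line `Re s = 2` -/

theorem LSeries_term_two_eq (a : ℕ → ℝ) (n : ℕ) :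
    LSeries.term (fun n => (a n : ℂ)) 2 n = ((if n = 0 then 0 else a n / (n : ℝ) ^ 2 : ℝ) : ℂ) := by
  rw [LSeries.term_def]
  split_ifs with h
  · simp
  · push_cast
    rw [← Complex.cpow_natCast]; norm_num

/-- With nonnegative coefficients the terms at s are dominated by those at 2, which are nonnegative
reals with sum L(2). So one exact value at 2 controls the whole half-plane. -/
theorem norm_LSeries_sub_le {a : ℕ → ℝ} (ha : ∀ n, 0 ≤ a n)
    (hs2 : LSeriesSummable (fun n => (a n : ℂ)) 2) {s : ℂ} (hs : 2 ≤ s.re) :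
    ‖LSeries (fun n => (a n : ℂ)) s‖ ≤ (LSeries (fun n => (a n : ℂ)) 2).re ∧
    ‖LSeries (fun n => (a n : ℂ)) s - a 1‖ ≤ (LSeries (fun n => (a n : ℂ)) 2).re - a 1 := by
  set f : ℕ → ℂ := fun n => (a n : ℂ)
  have hle : ∀ n, ‖LSeries.term f s n‖ ≤ ‖LSeries.term f 2 n‖ :=
    LSeries.norm_term_le_of_re_le_re f (by simpa using hs)
  have hsum2 : Summable fun n => ‖LSeries.term f 2 n‖ := hs2.norm
  have hsum : Summable fun n => ‖LSeries.term f s n‖ :=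
    hsum2.of_nonneg_of_le (fun _ => norm_nonneg _) hle
  have hre : ∀ n, ‖LSeries.term f 2 n‖ = (LSeries.term f 2 n).re := fun n => by
    rw [LSeries_term_two_eq, Complex.norm_real, Complex.ofReal_re, Real.norm_of_nonneg]
    split_ifs
    · exact le_rfl
    · have := ha n; positivity
  have htot : ∑' n, ‖LSeries.term f 2 n‖ = (LSeries f 2).re := by
    rw [LSeries, Complex.re_tsum hs2]; exact tsum_congr hre
  refine ⟨?_, ?_⟩
  · rw [← htot]
    exact (norm_tsum_le_tsum_norm hsum).trans (hsum.tsum_le_tsum hle hsum2)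
  · have h1 : LSeries.term f s 1 = a 1 := by simp [f]
    have h12 : ‖LSeries.term f 2 1‖ = a 1 := by
      simp [f, abs_of_nonneg (ha 1)]
    rw [← htot, LSeries, hsum.of_norm.tsum_eq_add_tsum_ite 1, h1, add_sub_cancel_left,
      hsum2.tsum_eq_add_tsum_ite 1, h12, add_sub_cancel_left]
    have hs3 : Summable fun n => ‖if n = 1 then 0 else LSeries.term f s n‖ := by
      refine hsum.of_nonneg_of_le (fun _ => norm_nonneg _) fun n => ?_
      split_ifs <;> simp
    have hs4 : Summable fun n => if n = 1 then 0 else ‖LSeries.term f 2 n‖ := by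
      refine hsum2.of_nonneg_of_le (fun n => ?_) fun n => ?_
      · split_ifs <;> simp
      · split_ifs <;> simp
    refine (norm_tsum_le_tsum_norm hs3).trans (hs3.tsum_le_tsum (fun n => ?_) hs4)
    split_ifs
    · simp
    · exact hle n

/-- The `L`-function of the trivial character mod `6`: the zeta function without its Euler factors
at `2` and `3`. -/
noncomputable def zetaSix (s : ℂ) : ℂ := DirichletCharacter.LFunctionTrivChar 6 s

/-- The indicator of the integers prime to `6`. -/
noncomputable def coprimeSix (n : ℕ) : ℝ := if Nat.Coprime n 6 then 1 else 0

theorem trivChar_six_apply (n : ℕ) : (1 : DirichletCharacter ℂ 6) n = (coprimeSix n : ℂ) := by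
  rw [coprimeSix]
  split_ifs with h
  · rw [MulChar.one_apply ((ZMod.isUnit_iff_coprime n 6).2 h)]; simp
  · rw [MulChar.map_nonunit _ fun h' => h ((ZMod.isUnit_iff_coprime n 6).1 h')]; simp

theorem zetaSix_eq_LSeries {s : ℂ} (hs : 1 < s.re) :
    zetaSix s = LSeries (fun n => (coprimeSix n : ℂ)) s := by
  rw [zetaSix, DirichletCharacter.LFunctionTrivChar, DirichletCharacter.LFunction_eq_LSeries _ hs]
  simp_rw [trivChar_six_apply]

theorem zetaSix_eq_mul {s : ℂ} (hs : s ≠ 1) :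
    zetaSix s = (1 - 2 ^ (-s)) * (1 - 3 ^ (-s)) * riemannZeta s := by
  rw [zetaSix, DirichletCharacter.LFunctionTrivChar_eq_mul_riemannZeta hs]
  have : Nat.primeFactors 6 = {2, 3} := by
    rw [show 6 = 2 * 3 by norm_num, Nat.primeFactors_mul (by norm_num) (by norm_num),
      Nat.prime_two.primeFactors, Nat.prime_three.primeFactors]; rfl
  rw [this, Finset.prod_pair (by norm_num)]; push_cast; rfl

theorem two_cpow_neg_two : (2 : ℂ) ^ (-2 : ℂ) = 1 / 4 := by
  rw [Complex.cpow_neg, show (2 : ℂ) ^ (2 : ℂ) = 2 ^ 2 by exact_mod_cast Complex.cpow_natCast 2 2]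
  norm_num

theorem three_cpow_neg_two : (3 : ℂ) ^ (-2 : ℂ) = 1 / 9 := by
  rw [Complex.cpow_neg, show (3 : ℂ) ^ (2 : ℂ) = 3 ^ 2 by exact_mod_cast Complex.cpow_natCast 3 2]
  norm_num

theorem zetaSix_two : zetaSix 2 = ((Real.pi ^ 2 / 9 : ℝ) : ℂ) := by
  rw [zetaSix_eq_mul (by norm_num), riemannZeta_two, two_cpow_neg_two, three_cpow_neg_two]
  push_cast; ring

theorem coprimeSix_nonneg (n : ℕ) : 0 ≤ coprimeSix n := by
  rw [coprimeSix]; split_ifs <;> norm_num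

/-- Splitting off the Euler factors at 2 and 3 lowers the radius from π²/6 - 1 (about 0.645) to π²/9
- 1 (below 0.097). The two factors are treated exactly, and this gives the sharp bounds for arg ζ on
Re s = 2. -/
theorem norm_zetaSix_sub_one_le {s : ℂ} (hs : 2 ≤ s.re) : ‖zetaSix s - 1‖ ≤ Real.pi ^ 2 / 9 - 1 := by
  have h2 : LSeriesSummable (fun n => (coprimeSix n : ℂ)) 2 := by
    have := DirichletCharacter.LSeriesSummable_of_one_lt_re (1 : DirichletCharacter ℂ 6)
      (s := 2) (by norm_num)
    simp_rw [trivChar_six_apply] at this; exact this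
  have h := (norm_LSeries_sub_le coprimeSix_nonneg h2 hs).2
  have h1 : coprimeSix 1 = 1 := by simp [coprimeSix]
  rwa [← zetaSix_eq_LSeries (by linarith), ← zetaSix_eq_LSeries (by norm_num), h1, zetaSix_two,
    Complex.ofReal_re, Complex.ofReal_one] at h

theorem norm_zeta_sub_one_le {s : ℂ} (hs : 2 ≤ s.re) :
    ‖riemannZeta s - 1‖ ≤ Real.pi ^ 2 / 6 - 1 := by
  have h2 : LSeriesSummable (fun _ => ((1 : ℝ) : ℂ)) 2 := by
    have := (LSeriesSummable_one_iff (s := 2)).2 (by norm_num)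
    simpa [Pi.one_def] using this
  have h := (norm_LSeries_sub_le (a := fun _ => 1) (fun _ => zero_le_one) h2 hs).2
  have e : (fun _ : ℕ => ((1 : ℝ) : ℂ)) = 1 := by ext; simp
  rw [e, LSeries_one_eq_riemannZeta (by linarith), LSeries_one_eq_riemannZeta (by norm_num),
    riemannZeta_two, Complex.ofReal_one] at h
  have e2 : ((Real.pi : ℂ) ^ 2 / 6).re = Real.pi ^ 2 / 6 := by
    rw [show ((Real.pi : ℂ) ^ 2 / 6) = ((Real.pi ^ 2 / 6 : ℝ) : ℂ) by push_cast; rfl]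
    exact Complex.ofReal_re _
  rwa [e2] at h

/-! ### The value of `ζ'/ζ` at `2` -/

/-- Midpoint rule: log x / x² is convex for x ≥ 9, so its value at x is at most its integral over [x
- 1/2, x + 1/2]; a primitive is -(log y + 1)/y. -/
theorem log_div_sq_le_telescope {x : ℝ} (hx : 10 ≤ x) :
    Real.log x / x ^ 2 ≤ (Real.log (x - 1 / 2) + 1) / (x - 1 / 2)
      - (Real.log (x + 1 / 2) + 1) / (x + 1 / 2) := by
  set f : ℝ → ℝ := fun y => Real.log y / y ^ 2
  set f' : ℝ → ℝ := fun y => (1 - 2 * Real.log y) / y ^ 3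
  have hG : ∀ y : ℝ, 0 < y → HasDerivAt (fun y => (Real.log y + 1) / y) (-f y) y := fun y hy => by
    refine (((Real.hasDerivAt_log hy.ne').add_const 1).div (hasDerivAt_id y) hy.ne').congr_deriv ?_
    simp only [f, id]; field_simp; ring
  have hf : ∀ y : ℝ, 0 < y → HasDerivAt f (f' y) y := fun y hy => by
    refine ((Real.hasDerivAt_log hy.ne').div (hasDerivAt_pow 2 y) (by positivity)).congr_deriv ?_
    simp only [f']; field_simp; push_cast; ring
  have hf' : ∀ y : ℝ, 0 < y → HasDerivAt f' ((6 * Real.log y - 5) / y ^ 4) y := fun y hy => by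
    refine ((((Real.hasDerivAt_log hy.ne').const_mul 2).const_sub 1).div
      (hasDerivAt_pow 3 y) (by positivity)).congr_deriv ?_
    field_simp; push_cast; ring
  have hmono : MonotoneOn f' (Ici 9) := by
    refine monotoneOn_of_hasDerivWithinAt_nonneg (convex_Ici 9)
      (fun u hu => (hf' u (by linarith [mem_Ici.1 hu])).continuousAt.continuousWithinAt)
      (fun u hu => (hf' u (by linarith [mem_Ici.1 (interior_subset hu)])).hasDerivWithinAt)
      fun u hu => ?_
    have hu' : (9 : ℝ) ≤ u := interior_subset hu
    have : 1 ≤ Real.log u := by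
      rw [Real.le_log_iff_exp_le (by linarith)]
      linarith [Real.exp_one_lt_three]
    have : 0 ≤ 6 * Real.log u - 5 := by linarith
    positivity
  have hsub : ∀ h : ℝ, HasDerivAt (fun h => x - h) (-1) h := fun h => (hasDerivAt_id h).const_sub x
  have hadd : ∀ h : ℝ, HasDerivAt (fun h => x + h) 1 h := fun h => (hasDerivAt_id h).const_add x
  have hI : ∀ h ∈ Icc (0 : ℝ) (1 / 2), 9 ≤ x - h ∧ 9 ≤ x + h ∧ x - h ≤ x + h := fun h hh => by
    refine ⟨?_, ?_, ?_⟩ <;> linarith [hh.1, hh.2]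
  have hψd : ∀ h ∈ Icc (0 : ℝ) (1 / 2), HasDerivAt (fun h => f (x - h) + f (x + h) - 2 * f x)
      (f' (x + h) - f' (x - h)) h := fun h hh => by
    obtain ⟨h1, h2, -⟩ := hI h hh
    refine ((((hf (x - h) (by linarith)).comp h (hsub h)).add
      ((hf (x + h) (by linarith)).comp h (hadd h))).sub_const (2 * f x)).congr_deriv ?_
    ring
  have h0 : (0 : ℝ) ∈ Icc (0 : ℝ) (1 / 2) := by constructor <;> norm_num
  have h1 : (1 / 2 : ℝ) ∈ Icc (0 : ℝ) (1 / 2) := by constructor <;> norm_num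
  have hψ : ∀ h ∈ Icc (0 : ℝ) (1 / 2), 0 ≤ f (x - h) + f (x + h) - 2 * f x := fun h hh => by
    have hm : MonotoneOn (fun h => f (x - h) + f (x + h) - 2 * f x) (Icc 0 (1 / 2)) := by
      refine monotoneOn_of_hasDerivWithinAt_nonneg (convex_Icc _ _)
        (fun u hu => (hψd u hu).continuousAt.continuousWithinAt)
        (fun u hu => (hψd u (interior_subset hu)).hasDerivWithinAt) fun u hu => ?_
      obtain ⟨h1, h2, h3⟩ := hI u (interior_subset hu)
      linarith [hmono (mem_Ici.2 h1) (mem_Ici.2 h2) h3]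
    have := hm h0 hh hh.1
    simp only [sub_zero, add_zero] at this
    linarith
  have hm : MonotoneOn (fun h => (Real.log (x - h) + 1) / (x - h) - (Real.log (x + h) + 1) / (x + h)
      - 2 * f x * h) (Icc 0 (1 / 2)) := by
    have hd : ∀ h ∈ Icc (0 : ℝ) (1 / 2), HasDerivAt (fun h => (Real.log (x - h) + 1) / (x - h)
        - (Real.log (x + h) + 1) / (x + h) - 2 * f x * h) (f (x - h) + f (x + h) - 2 * f x) h := by
      intro h hh
      obtain ⟨h1, h2, -⟩ := hI h hh
      have h3 := (((hG (x - h) (by linarith)).comp h (hsub h)).sub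
        ((hG (x + h) (by linarith)).comp h (hadd h))).sub ((hasDerivAt_id h).const_mul (2 * f x))
      refine h3.congr_deriv ?_
      ring
    refine monotoneOn_of_hasDerivWithinAt_nonneg (convex_Icc _ _)
      (fun u hu => (hd u hu).continuousAt.continuousWithinAt)
      (fun u hu => (hd u (interior_subset hu)).hasDerivWithinAt) fun u hu => ?_
    exact hψ u (interior_subset hu)
  have := hm h0 h1 (by norm_num)
  simp only [sub_zero, add_zero, sub_self, mul_zero] at this
  simp only [f] at this
  linarith

/-- The sum tends to -ζ'(2), about 0.9375. The terms below 10 are evaluated, and the rest is bounded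
by the telescoping midpoint estimate starting at 19/2. -/
theorem sum_log_div_sq_le (n : ℕ) :
    ∑ k ∈ Finset.range n, Real.log k / (k : ℝ) ^ 2 ≤ 0.9382 := by
  have htail : ∀ m : ℕ, ∑ k ∈ Finset.range m, Real.log (k + 10 : ℕ) / ((k + 10 : ℕ) : ℝ) ^ 2 ≤
      (Real.log (19 / 2) + 1) / (19 / 2) := by
    intro m
    refine (sum_le_of_telescope (f := fun k : ℕ => Real.log (k + 10 : ℕ) / ((k + 10 : ℕ) : ℝ) ^ 2)
      (g := fun k : ℕ => (Real.log (k + 19 / 2) + 1) / (k + 19 / 2)) (fun k => ?_) (fun k => ?_) m).trans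
      (by norm_num)
    · have : 0 ≤ Real.log ((k : ℝ) + 19 / 2) := Real.log_nonneg (by
        have := Nat.cast_nonneg (α := ℝ) k; linarith)
      positivity
    · have := log_div_sq_le_telescope (x := ((k + 10 : ℕ) : ℝ)) (by push_cast; linarith [Nat.cast_nonneg (α := ℝ) k])
      refine this.trans (le_of_eq ?_)
      push_cast
      ring_nf
  have hnn : ∀ k : ℕ, 0 ≤ Real.log k / (k : ℝ) ^ 2 := fun k =>
    div_nonneg (Real.log_natCast_nonneg k) (by positivity)
  have h1 : ∑ k ∈ Finset.range n, Real.log k / (k : ℝ) ^ 2 ≤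
      ∑ k ∈ Finset.range (10 + n), Real.log k / (k : ℝ) ^ 2 :=
    Finset.sum_le_sum_of_subset_of_nonneg (Finset.range_mono (by omega)) fun k _ _ => hnn k
  rw [Finset.sum_range_add] at h1
  have h2 : ∑ x ∈ Finset.range n, Real.log ((10 + x : ℕ) : ℝ) / ((10 + x : ℕ) : ℝ) ^ 2 ≤
      (Real.log (19 / 2) + 1) / (19 / 2) := by
    have := htail n
    simp_rw [add_comm _ 10] at this
    exact this
  have l2 := Real.log_two_lt_d9
  have l3 := Real.log_three_lt_d9
  have l5 := Real.log_five_lt_d9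
  have l2' := Real.log_two_gt_d9
  have l4 : Real.log 4 = 2 * Real.log 2 := by rw [show (4 : ℝ) = 2 ^ 2 by norm_num, Real.log_pow]; norm_num
  have l6 : Real.log 6 = Real.log 2 + Real.log 3 := by rw [← Real.log_mul (by norm_num) (by norm_num)]; norm_num
  have l8 : Real.log 8 = 3 * Real.log 2 := by rw [show (8 : ℝ) = 2 ^ 3 by norm_num, Real.log_pow]; norm_num
  have l9 : Real.log 9 = 2 * Real.log 3 := by rw [show (9 : ℝ) = 3 ^ 2 by norm_num, Real.log_pow]; norm_num
  -- The primes 7 and 19 are reduced to 2, 3 and 5 through the near coincidences 49/50 and 361/360.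
  have l7 : 2 * Real.log 7 ≤ Real.log 2 + 2 * Real.log 5 - 1 / 50 := by
    have h := Real.log_le_sub_one_of_pos (x := 49 / 50) (by norm_num)
    rw [Real.log_div (by norm_num) (by norm_num), show (49 : ℝ) = 7 ^ 2 by norm_num,
      show (50 : ℝ) = 2 * 5 ^ 2 by norm_num, Real.log_mul (by norm_num) (by norm_num),
      Real.log_pow, Real.log_pow] at h
    norm_num at h ⊢
    linarith
  have l19 : 2 * Real.log (19 / 2) ≤ Real.log 2 + 2 * Real.log 3 + Real.log 5 + 1 / 360 := by
    have h := Real.log_le_sub_one_of_pos (x := 361 / 360) (by norm_num)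
    have e : (361 / 360 : ℝ) = (19 / 2) ^ 2 / (2 * 3 ^ 2 * 5) := by norm_num
    rw [e, Real.log_div (by norm_num) (by norm_num), Real.log_mul (by norm_num) (by norm_num),
      Real.log_mul (by norm_num) (by norm_num), Real.log_pow, Real.log_pow] at h
    norm_num at h ⊢
    linarith
  simp only [Finset.sum_range_succ, Finset.sum_range_zero] at h1
  norm_num [l4, l6, l8, l9] at h1 h2
  linarith

theorem neg_deriv_zeta_two_le : -(deriv riemannZeta 2 / riemannZeta 2).re ≤ 0.5704 := by
  have habs : LSeries.abscissaOfAbsConv (1 : ℕ → ℂ) < ((2 : ℂ).re : EReal) := by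
    rw [LSeries.abscissaOfAbsConv_one, Complex.re_ofNat]; exact_mod_cast (one_lt_two : (1 : ℝ) < 2)
  have hev : riemannZeta =ᶠ[𝓝 2] LSeries 1 := by
    have : {s : ℂ | 1 < s.re} ∈ 𝓝 (2 : ℂ) :=
      (isOpen_lt continuous_const Complex.continuous_re).mem_nhds (by simp)
    filter_upwards [this] with s hs using (LSeries_one_eq_riemannZeta hs).symm
  have hd : deriv riemannZeta 2 = -LSeries (LSeries.logMul 1) 2 := by
    rw [hev.deriv_eq, LSeries_deriv habs]
  have hsum : LSeriesSummable (LSeries.logMul 1) 2 :=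
    LSeriesSummable_logMul_of_lt_re habs
  have hre : (LSeries (LSeries.logMul 1) 2).re ≤ 0.9382 := by
    have h1 := (Complex.reCLM.hasSum hsum.hasSum).tendsto_sum_nat
    refine le_of_tendsto' h1 fun n => ?_
    refine le_trans (le_of_eq ?_) (sum_log_div_sq_le n)
    refine Finset.sum_congr rfl fun k _ => ?_
    have e : LSeries.logMul 1 = fun n : ℕ => ((Real.log n : ℝ) : ℂ) := by
      ext m; simp [LSeries.logMul, Complex.natCast_log]
    rw [e]
    simp only [Complex.reCLM_apply]
    rw [LSeries_term_two_eq, Complex.ofReal_re]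
    split_ifs with h
    · simp [h]
    · rfl
  rw [hd, riemannZeta_two, show ((Real.pi : ℂ) ^ 2 / 6) = ((Real.pi ^ 2 / 6 : ℝ) : ℂ) by push_cast; rfl,
    Complex.div_ofReal_re, Complex.neg_re, neg_div, neg_neg, div_le_iff₀ (by positivity)]
  have := Real.pi_gt_d6
  nlinarith

theorem hasDerivAt_one_sub_cpow_neg {c : ℂ} (hc : c ≠ 0) (s : ℂ) :
    HasDerivAt (fun s => 1 - c ^ (-s)) (c ^ (-s) * Complex.log c) s := by
  refine (((hasDerivAt_neg s).const_cpow (Or.inl hc)).const_sub 1).congr_deriv ?_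
  ring

theorem norm_nat_cpow_neg {p : ℕ} (hp : 0 < p) (s : ℂ) : ‖(p : ℂ) ^ (-s)‖ = (p : ℝ) ^ (-s.re) := by
  rw [Complex.norm_natCast_cpow_of_pos hp, Complex.neg_re]

theorem one_sub_two_cpow_ne_zero {s : ℂ} (hs : 0 < s.re) : (1 : ℂ) - 2 ^ (-s) ≠ 0 := by
  intro h
  have h1 := norm_nat_cpow_neg (p := 2) (by norm_num) s
  have h2 : ((2 : ℕ) : ℝ) ^ (-s.re) < 1 := Real.rpow_lt_one_of_one_lt_of_neg (by norm_num) (by linarith)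
  push_cast at h1 h2
  rw [← sub_eq_zero.1 h, norm_one] at h1
  linarith

theorem one_sub_three_cpow_ne_zero {s : ℂ} (hs : 0 < s.re) : (1 : ℂ) - 3 ^ (-s) ≠ 0 := by
  intro h
  have h1 := norm_nat_cpow_neg (p := 3) (by norm_num) s
  have h2 : ((3 : ℕ) : ℝ) ^ (-s.re) < 1 := Real.rpow_lt_one_of_one_lt_of_neg (by norm_num) (by linarith)
  push_cast at h1 h2
  rw [← sub_eq_zero.1 h, norm_one] at h1
  linarith

/-- The Euler factor part `log p / (p ^ s - 1)` of `-ζ'/ζ`. -/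
noncomputable def eulerLogDeriv (p : ℕ) (s : ℂ) : ℂ := Real.log p / ((p : ℂ) ^ s - 1)

theorem eulerLogDeriv_eq {p : ℕ} (hp : p ≠ 0) (s : ℂ) :
    eulerLogDeriv p s = (p : ℂ) ^ (-s) * Complex.log p / (1 - (p : ℂ) ^ (-s)) := by
  have hp0 : (p : ℂ) ≠ 0 := by exact_mod_cast hp
  have h0 : (p : ℂ) ^ s ≠ 0 := by rw [Complex.cpow_def_of_ne_zero hp0]; exact Complex.exp_ne_zero _
  rw [eulerLogDeriv, Complex.cpow_neg, ← Complex.natCast_log]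
  have e : (1 : ℂ) - ((p : ℂ) ^ s)⁻¹ = ((p : ℂ) ^ s - 1) / (p : ℂ) ^ s := by field_simp
  rw [e]
  by_cases h : (p : ℂ) ^ s - 1 = 0
  · simp [h]
  · field_simp

/-- The part of `-ζ'/ζ` coming from the primes greater than `3`. -/
noncomputable def logDerivSix (s : ℂ) : ℂ :=
  -deriv riemannZeta s / riemannZeta s - eulerLogDeriv 2 s - eulerLogDeriv 3 s

theorem logDerivSix_eq {s : ℂ} (hs : 1 < s.re) : logDerivSix s =
    LSeries (fun n => ((coprimeSix n * ArithmeticFunction.vonMangoldt n : ℝ) : ℂ)) s := by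
  have hs1 : s ≠ 1 := fun h => by simp [h] at hs
  have h := DirichletCharacter.LSeries_twist_vonMangoldt_eq (1 : DirichletCharacter ℂ 6) hs
  rw [← DirichletCharacter.deriv_LFunction_eq_deriv_LSeries _ hs,
    ← DirichletCharacter.LFunction_eq_LSeries _ hs] at h
  have e : ((fun n : ℕ => (1 : DirichletCharacter ℂ 6) n) * fun n => (ArithmeticFunction.vonMangoldt n : ℂ))
      = fun n => ((coprimeSix n * ArithmeticFunction.vonMangoldt n : ℝ) : ℂ) := by
    ext n; simp [trivChar_six_apply]
  rw [e] at h
  rw [h]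
  have hev : DirichletCharacter.LFunction (1 : DirichletCharacter ℂ 6) =ᶠ[𝓝 s]
      fun s => (1 - 2 ^ (-s)) * (1 - 3 ^ (-s)) * riemannZeta s := by
    filter_upwards [isOpen_ne.mem_nhds hs1] with z hz using zetaSix_eq_mul hz
  have h2 := hasDerivAt_one_sub_cpow_neg (c := 2) two_ne_zero s
  have h3 := hasDerivAt_one_sub_cpow_neg (c := 3) three_ne_zero s
  have hd := (h2.mul h3).mul (differentiableAt_riemannZeta hs1).hasDerivAt
  have hd' : deriv (fun s => (1 - 2 ^ (-s)) * (1 - 3 ^ (-s)) * riemannZeta s) s = _ := hd.deriv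
  rw [hev.deriv_eq, show DirichletCharacter.LFunction (1 : DirichletCharacter ℂ 6) s = _ from
    zetaSix_eq_mul hs1, hd']
  have n2 := one_sub_two_cpow_ne_zero (s := s) (by linarith)
  have n3 := one_sub_three_cpow_ne_zero (s := s) (by linarith)
  have nz := riemannZeta_ne_zero_of_one_lt_re hs
  rw [logDerivSix, eulerLogDeriv_eq two_ne_zero, eulerLogDeriv_eq three_ne_zero]
  push_cast
  simp only [Pi.mul_apply]
  field_simp
  ring

theorem vonMangoldt_summable_two :
    LSeriesSummable (fun n => ((ArithmeticFunction.vonMangoldt n : ℝ) : ℂ)) 2 :=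
  ArithmeticFunction.LSeriesSummable_vonMangoldt (by norm_num)

/-- The Dirichlet coefficients are nonnegative, so the maximum is the value at 2, which is at most
0.5704 - log 2 / 3 - log 3 / 8. -/
theorem norm_logDerivSix_le {s : ℂ} (hs : 2 ≤ s.re) : ‖logDerivSix s‖ ≤ 0.2021 := by
  have h2 : LSeriesSummable (fun n => ((coprimeSix n * ArithmeticFunction.vonMangoldt n : ℝ) : ℂ)) 2 := by
    have := DirichletCharacter.LSeriesSummable_twist_vonMangoldt (1 : DirichletCharacter ℂ 6)
      (s := 2) (by norm_num)
    have e : ((fun n : ℕ => (1 : DirichletCharacter ℂ 6) n) *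
        fun n => (ArithmeticFunction.vonMangoldt n : ℂ)) =
        fun n => ((coprimeSix n * ArithmeticFunction.vonMangoldt n : ℝ) : ℂ) := by
      ext n; simp [trivChar_six_apply]
    rwa [e] at this
  have h := (norm_LSeries_sub_le (fun n => mul_nonneg (coprimeSix_nonneg n)
    ArithmeticFunction.vonMangoldt_nonneg) h2 hs).1
  rw [← logDerivSix_eq (by linarith), ← logDerivSix_eq (by norm_num)] at h
  refine h.trans ?_
  have hD := neg_deriv_zeta_two_le
  have e2 : eulerLogDeriv 2 2 = ((Real.log 2 / 3 : ℝ) : ℂ) := by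
    rw [eulerLogDeriv_eq two_ne_zero]; push_cast
    rw [two_cpow_neg_two, ← Complex.ofReal_ofNat, Complex.ofReal_log (by norm_num)]; push_cast; ring
  have e3 : eulerLogDeriv 3 2 = ((Real.log 3 / 8 : ℝ) : ℂ) := by
    rw [eulerLogDeriv_eq three_ne_zero]; push_cast
    rw [three_cpow_neg_two, ← Complex.ofReal_ofNat, Complex.ofReal_log (by norm_num)]; push_cast; ring
  rw [logDerivSix, Complex.sub_re, Complex.sub_re, e2, e3, Complex.ofReal_re, Complex.ofReal_re,
    neg_div, Complex.neg_re]
  have l2 := Real.log_two_gt_d9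
  have l3 := Real.log_three_gt_d9
  linarith

theorem norm_zeta_logDeriv_le {s : ℂ} (hs : 2 ≤ s.re) :
    ‖deriv riemannZeta s / riemannZeta s‖ ≤ 0.5704 := by
  have h := (norm_LSeries_sub_le (fun n => ArithmeticFunction.vonMangoldt_nonneg)
    vonMangoldt_summable_two hs).1
  have e1 := ArithmeticFunction.LSeries_vonMangoldt_eq_deriv_riemannZeta_div (s := s) (by linarith)
  have e2 := ArithmeticFunction.LSeries_vonMangoldt_eq_deriv_riemannZeta_div (s := 2) (by norm_num)
  rw [e1, e2, neg_div, norm_neg, neg_div, Complex.neg_re] at h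
  exact h.trans neg_deriv_zeta_two_le

theorem neg_zeta_logDeriv_eq (s : ℂ) : -deriv riemannZeta s / riemannZeta s =
    eulerLogDeriv 2 s + eulerLogDeriv 3 s + logDerivSix s := by
  rw [logDerivSix]; ring

/-! ### The argument of `ζ` on the line `Re s = 2` -/

/-- Seen from the origin, the disc of radius r about 1 has half-angle arcsin r. -/
theorem abs_arg_le_arcsin {z : ℂ} {r : ℝ} (hr : r < 1) (h : ‖z - 1‖ ≤ r) :
    0 < z.re ∧ |z.arg| ≤ Real.arcsin r := by
  have hr0 : 0 ≤ r := (norm_nonneg _).trans h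
  have hre : 0 < z.re := by
    have := (abs_le.1 ((Complex.abs_re_le_norm (z - 1)).trans h)).1
    simp at this; linarith
  refine ⟨hre, ?_⟩
  have hz0 : z ≠ 0 := fun h => by simp [h] at hre
  have hn := norm_pos_iff.2 hz0
  have hsq : (z.re - 1) ^ 2 + z.im ^ 2 ≤ r ^ 2 := by
    have : ‖z - 1‖ ^ 2 ≤ r ^ 2 := by gcongr
    rw [Complex.sq_norm, Complex.normSq_apply] at this
    simp at this; nlinarith
  have hsin : |z.im / ‖z‖| ≤ r := by
    rw [abs_div, abs_of_pos hn, div_le_iff₀ hn]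
    refine abs_le_of_sq_le_sq ?_ (by positivity)
    rw [mul_pow, Complex.sq_norm, Complex.normSq_apply]
    have hr2 : 0 ≤ 1 - r ^ 2 := by nlinarith
    nlinarith [sq_nonneg (z.re - 1 + r ^ 2), mul_le_mul_of_nonneg_left hsq hr2]
  rw [Complex.arg_of_re_nonneg hre.le]
  rw [abs_le] at hsin ⊢
  constructor
  · rw [← Real.arcsin_neg]; exact Real.arcsin_le_arcsin (by linarith)
  · exact Real.arcsin_le_arcsin hsin.2

theorem arcsin_le_of_le_sin {r x : ℝ} (hx : 0 < x) (hx1 : x ≤ 1) (h : r ≤ x - x ^ 3 / 6) :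
    Real.arcsin r ≤ x := by
  have h1 := Real.sin_gt_sub_cube hx
  have := Real.pi_gt_three
  calc Real.arcsin r ≤ Real.arcsin (Real.sin x) := Real.arcsin_le_arcsin (by linarith)
    _ = x := Real.arcsin_sin (by linarith) (by linarith)

theorem norm_two_cpow_neg {s : ℂ} (hs : s.re = 2) : ‖(2 : ℂ) ^ (-s)‖ = 1 / 4 := by
  have := norm_nat_cpow_neg (p := 2) (by norm_num) s
  rw [hs] at this
  push_cast at this
  rw [this, Real.rpow_neg (by norm_num)]; norm_num

theorem norm_three_cpow_neg {s : ℂ} (hs : s.re = 2) : ‖(3 : ℂ) ^ (-s)‖ = 1 / 9 := by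
  have := norm_nat_cpow_neg (p := 3) (by norm_num) s
  rw [hs] at this
  push_cast at this
  rw [this, Real.rpow_neg (by norm_num)]; norm_num

theorem pi_sq_lt : Real.pi ^ 2 < 9.8697 := by
  have := Real.pi_lt_d6
  have := Real.pi_pos
  nlinarith

/-- The continuous logarithm of `ζ` on the line `Re s = 2`. -/
noncomputable def logZetaTwo (s : ℂ) : ℂ :=
  Complex.log (zetaSix s) - Complex.log (1 - 2 ^ (-s)) - Complex.log (1 - 3 ^ (-s))

/-- The angles are upper bounds for arcsin(π²/9 - 1), arcsin(1/4) and arcsin(1/9). Their sum 0.4609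
bounds the argument of ζ on the line. -/
theorem arg_factors_two {s : ℂ} (hs : s.re = 2) :
    (0 < (zetaSix s).re ∧ |(zetaSix s).arg| ≤ 0.0968) ∧
    (0 < (1 - 2 ^ (-s) : ℂ).re ∧ |(1 - 2 ^ (-s) : ℂ).arg| ≤ 0.2527) ∧
    (0 < (1 - 3 ^ (-s) : ℂ).re ∧ |(1 - 3 ^ (-s) : ℂ).arg| ≤ 0.1114) := by
  have h1 := norm_zetaSix_sub_one_le hs.ge
  have h2 : ‖(1 - 2 ^ (-s) : ℂ) - 1‖ ≤ 1 / 4 := by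
    rw [sub_right_comm, sub_self, zero_sub, norm_neg, norm_two_cpow_neg hs]
  have h3 : ‖(1 - 3 ^ (-s) : ℂ) - 1‖ ≤ 1 / 9 := by
    rw [sub_right_comm, sub_self, zero_sub, norm_neg, norm_three_cpow_neg hs]
  have hpi := pi_sq_lt
  have g1 := abs_arg_le_arcsin (r := 0.09664) (by norm_num) (h1.trans (by linarith))
  have g2 := abs_arg_le_arcsin (by norm_num) h2
  have g3 := abs_arg_le_arcsin (by norm_num) h3
  exact ⟨⟨g1.1, g1.2.trans (arcsin_le_of_le_sin (by norm_num) (by norm_num) (by norm_num))⟩,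
    ⟨g2.1, g2.2.trans (arcsin_le_of_le_sin (by norm_num) (by norm_num) (by norm_num))⟩,
    ⟨g3.1, g3.2.trans (arcsin_le_of_le_sin (by norm_num) (by norm_num) (by norm_num))⟩⟩

theorem exp_logZetaTwo {s : ℂ} (hs : s.re = 2) : Complex.exp (logZetaTwo s) = riemannZeta s := by
  obtain ⟨⟨h1, -⟩, ⟨h2, -⟩, ⟨h3, -⟩⟩ := arg_factors_two hs
  have n1 := Complex.slitPlane_ne_zero (Or.inl h1)
  have n2 := Complex.slitPlane_ne_zero (Or.inl h2)
  have n3 := Complex.slitPlane_ne_zero (Or.inl h3)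
  rw [logZetaTwo, Complex.exp_sub, Complex.exp_sub, Complex.exp_log n1, Complex.exp_log n2,
    Complex.exp_log n3, zetaSix_eq_mul (fun h => by simp [h] at hs)]
  field_simp

theorem differentiableAt_logZetaTwo {s : ℂ} (hs : s.re = 2) : DifferentiableAt ℂ logZetaTwo s := by
  obtain ⟨⟨h1, -⟩, ⟨h2, -⟩, ⟨h3, -⟩⟩ := arg_factors_two hs
  have hs1 : s ≠ 1 := fun h => by simp [h] at hs
  have d1 : DifferentiableAt ℂ zetaSix s :=
    DirichletCharacter.differentiableAt_LFunction _ s (Or.inl hs1)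
  exact ((d1.clog (Or.inl h1)).sub
    ((hasDerivAt_one_sub_cpow_neg two_ne_zero s).differentiableAt.clog (Or.inl h2))).sub
    ((hasDerivAt_one_sub_cpow_neg three_ne_zero s).differentiableAt.clog (Or.inl h3))

/-- The continuous argument of `ζ(2 + it)`. -/
noncomputable def argZetaTwo (t : ℝ) : ℝ := (logZetaTwo (2 + t * Complex.I)).im

theorem re_two_add (t : ℝ) : (2 + t * Complex.I : ℂ).re = 2 := by simp

theorem argZetaTwo_eq (t : ℝ) : argZetaTwo t = (zetaSix (2 + t * Complex.I)).arg
    - (1 - 2 ^ (-(2 + t * Complex.I)) : ℂ).arg - (1 - 3 ^ (-(2 + t * Complex.I)) : ℂ).arg := by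
  rw [argZetaTwo, logZetaTwo]; simp [Complex.log_im]

theorem abs_argZetaTwo_le (t : ℝ) : |argZetaTwo t| ≤ 0.4609 := by
  obtain ⟨⟨-, h1⟩, ⟨-, h2⟩, ⟨-, h3⟩⟩ := arg_factors_two (re_two_add t)
  rw [argZetaTwo_eq]
  rw [abs_le] at *
  constructor <;> linarith [h1.1, h1.2, h2.1, h2.2, h3.1, h3.2]

theorem two_cpow_neg_eq (p : ℕ) (hp : 0 < p) (t : ℝ) : (p : ℂ) ^ (-(2 + t * Complex.I) : ℂ) =
    ((1 / (p : ℝ) ^ 2 : ℝ) : ℂ) * Complex.exp (((-(t * Real.log p) : ℝ) : ℂ) * Complex.I) := by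
  have hp0 : (p : ℂ) ≠ 0 := by exact_mod_cast hp.ne'
  rw [neg_add, Complex.cpow_add _ _ hp0, Complex.cpow_neg, Complex.cpow_def_of_ne_zero hp0 (-(_)),
    ← Complex.natCast_log]
  have : (p : ℂ) ^ (2 : ℂ) = (p : ℂ) ^ 2 := by exact_mod_cast Complex.cpow_natCast p 2
  rw [this]
  push_cast
  rw [one_div]
  congr 2; ring

/-- When sin(t log 2) ≥ 0 the factor 1 - 2^(-s) has nonnegative argument, which is subtracted; only
0.0968 + 0.1114 remains. -/
theorem argZetaTwo_le_of_sin {t : ℝ} (ht : 0 ≤ Real.sin (t * Real.log 2)) : argZetaTwo t ≤ 0.2082 := by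
  obtain ⟨⟨-, h1⟩, ⟨-, h2⟩, ⟨-, h3⟩⟩ := arg_factors_two (re_two_add t)
  have h4 : 0 ≤ (1 - 2 ^ (-(2 + t * Complex.I)) : ℂ).arg := by
    rw [Complex.arg_nonneg_iff]
    have := two_cpow_neg_eq 2 (by norm_num) t
    push_cast at this
    have e : ((1 : ℂ) - 2 ^ (-(2 + t * Complex.I))).im = 1 / 4 * Real.sin (t * Real.log 2) := by
      have h5 := two_cpow_neg_eq 2 (by norm_num) t
      rw [Nat.cast_ofNat] at h5
      rw [h5, Complex.sub_im, Complex.im_ofReal_mul, Complex.exp_ofReal_mul_I_im, Real.sin_neg]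
      norm_num
    rw [e]; positivity
  rw [argZetaTwo_eq]
  rw [abs_le] at *
  linarith [h1.1, h1.2, h2.1, h2.2, h3.1, h3.2]

theorem norm_zeta_two_add_ge {s : ℂ} (hs : s.re = 2) : 0.65 ≤ ‖riemannZeta s‖ := by
  have h1 := norm_zetaSix_sub_one_le hs.ge
  have e := zetaSix_eq_mul (s := s) (fun h => by simp [h] at hs)
  have h2 : 2 - Real.pi ^ 2 / 9 ≤ ‖zetaSix s‖ := by
    have := norm_sub_norm_le (1 : ℂ) (1 - zetaSix s)
    rw [sub_sub_cancel, norm_one, norm_sub_rev] at this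
    linarith
  rw [e, norm_mul, norm_mul] at h2
  have h3 : ‖(1 : ℂ) - 2 ^ (-s)‖ ≤ 5 / 4 := by
    refine (norm_sub_le _ _).trans ?_
    rw [norm_two_cpow_neg hs, norm_one]; norm_num
  have h4 : ‖(1 : ℂ) - 3 ^ (-s)‖ ≤ 10 / 9 := by
    refine (norm_sub_le _ _).trans ?_
    rw [norm_three_cpow_neg hs, norm_one]; norm_num
  have h5 : ‖(1 : ℂ) - 2 ^ (-s)‖ * ‖(1 : ℂ) - 3 ^ (-s)‖ * ‖riemannZeta s‖ ≤
      5 / 4 * (10 / 9) * ‖riemannZeta s‖ := by gcongr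
  have := pi_sq_lt
  linarith

theorem norm_zeta_le {s : ℂ} (hs : 2 ≤ s.re) : ‖riemannZeta s‖ ≤ 1.645 := by
  have h1 := norm_zeta_sub_one_le hs
  have := norm_add_le (riemannZeta s - 1) 1
  rw [sub_add_cancel, norm_one] at this
  have := pi_sq_lt
  linarith

theorem norm_zeta_ge {s : ℂ} (hs : 2 ≤ s.re) : 0.35 ≤ ‖riemannZeta s‖ := by
  have h1 := norm_zeta_sub_one_le hs
  have := norm_sub_norm_le (1 : ℂ) (1 - riemannZeta s)
  rw [sub_sub_cancel, norm_one, norm_sub_rev] at this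
  have := pi_sq_lt
  linarith

/-- The real part of `1 / (w - 1)` on a circle `|w| = r`. -/
theorem re_eulerLogDeriv {p : ℕ} (hp : 1 < p) (t : ℝ) :
    (eulerLogDeriv p (2 + t * Complex.I)).re =
      Real.log p * (((p : ℝ) ^ 2 * Real.cos (t * Real.log p) - 1) /
        ((p : ℝ) ^ 4 + 1 - 2 * (p : ℝ) ^ 2 * Real.cos (t * Real.log p))) := by
  have hp0 : (p : ℂ) ≠ 0 := by exact_mod_cast (by omega : p ≠ 0)
  have hw : (p : ℂ) ^ (2 + t * Complex.I : ℂ) =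
      (((p : ℝ) ^ 2 : ℝ) : ℂ) * Complex.exp (((t * Real.log p : ℝ) : ℂ) * Complex.I) := by
    rw [Complex.cpow_add _ _ hp0, Complex.cpow_def_of_ne_zero hp0 (t * _), ← Complex.natCast_log]
    have : (p : ℂ) ^ (2 : ℂ) = (p : ℂ) ^ 2 := by exact_mod_cast Complex.cpow_natCast p 2
    rw [this]; push_cast; congr 2; ring
  rw [eulerLogDeriv, hw, div_eq_mul_inv, Complex.re_ofReal_mul, Complex.inv_re, Complex.normSq_apply]
  congr 1
  simp only [Complex.sub_re, Complex.re_ofReal_mul, Complex.exp_ofReal_mul_I_re, Complex.one_re,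
    Complex.sub_im, Complex.im_ofReal_mul, Complex.exp_ofReal_mul_I_im, Complex.one_im, sub_zero]
  congr 1
  have := Real.sin_sq_add_cos_sq (t * Real.log p)
  linear_combination ((p : ℝ) ^ 4) * this

/-- With q = p², the quotient (qc - 1)/(q² + 1 - 2qc) increases with c: after cross multiplication
two of its values differ by q(q² - 1) times the difference of the cosines. -/
theorem re_eulerLogDeriv_le {p : ℕ} (hp : 1 < p) {t c : ℝ} (hc1 : c ≤ 1)
    (hc : Real.cos (t * Real.log p) ≤ c) :
    (eulerLogDeriv p (2 + t * Complex.I)).re ≤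
      Real.log p * (((p : ℝ) ^ 2 * c - 1) / ((p : ℝ) ^ 4 + 1 - 2 * (p : ℝ) ^ 2 * c)) := by
  rw [re_eulerLogDeriv hp]
  have hp1 : (1 : ℝ) < p := by exact_mod_cast hp
  have hp2 : (1 : ℝ) < (p : ℝ) ^ 2 := one_lt_pow₀ hp1 two_ne_zero
  have hlog : 0 ≤ Real.log p := Real.log_natCast_nonneg p
  set q := (p : ℝ) ^ 2
  have e4 : (p : ℝ) ^ 4 = q ^ 2 := by ring
  rw [e4]
  have hpos : ∀ c : ℝ, c ≤ 1 → 0 < q ^ 2 + 1 - 2 * q * c := fun c hc => by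
    nlinarith [mul_le_mul_of_nonneg_left hc (by linarith : 0 ≤ 2 * q), sq_pos_of_pos (by linarith : 0 < q - 1)]
  refine mul_le_mul_of_nonneg_left ?_ hlog
  rw [div_le_div_iff₀ (hpos _ (Real.cos_le_one _)) (hpos _ hc1)]
  nlinarith [mul_le_mul_of_nonneg_left hc (by nlinarith : 0 ≤ q * (q ^ 2 - 1))]

theorem neg_le_re_eulerLogDeriv {p : ℕ} (hp : 1 < p) (t : ℝ) :
    -(Real.log p / ((p : ℝ) ^ 2 + 1)) ≤ (eulerLogDeriv p (2 + t * Complex.I)).re := by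
  rw [re_eulerLogDeriv hp]
  have hp1 : (1 : ℝ) < p := by exact_mod_cast hp
  have hp2 : (1 : ℝ) < (p : ℝ) ^ 2 := one_lt_pow₀ hp1 two_ne_zero
  have hlog : 0 ≤ Real.log p := Real.log_natCast_nonneg p
  set q := (p : ℝ) ^ 2
  have e4 : (p : ℝ) ^ 4 = q ^ 2 := by ring
  rw [e4, ← neg_div, ← mul_neg_one, mul_div_assoc]
  set c := Real.cos (t * Real.log p)
  have hc := Real.cos_le_one (t * Real.log p)
  have hc' := Real.neg_one_le_cos (t * Real.log p)
  have hpos : 0 < q ^ 2 + 1 - 2 * q * c := by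
    nlinarith [mul_le_mul_of_nonneg_left hc (by linarith : 0 ≤ 2 * q), sq_pos_of_pos (by linarith : 0 < q - 1)]
  refine mul_le_mul_of_nonneg_left ?_ hlog
  rw [div_le_div_iff₀ (by linarith) hpos]
  nlinarith [mul_le_mul_of_nonneg_left hc' (by nlinarith : 0 ≤ q * (q - 1))]

/-! ### The functional equation to the left of the critical strip -/

theorem hasDerivAt_Gamma_of_re_pos {w : ℂ} (hw : 0 < w.re) :
    HasDerivAt Complex.Gamma (digammaSeries w * Complex.Gamma w) w := by
  have h := (hasDerivAt_logGammaSeries hw).cexp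
  rw [exp_logGammaSeries hw, mul_comm] at h
  refine h.congr_of_eventuallyEq ?_
  have : {z : ℂ | 0 < z.re} ∈ 𝓝 w := (isOpen_lt continuous_const Complex.continuous_re).mem_nhds hw
  filter_upwards [this] with z hz using (exp_logGammaSeries hz).symm

theorem zeta_one_sub {w : ℂ} (hw : 1 < w.re) : riemannZeta (1 - w) =
    2 * (2 * Real.pi) ^ (-w) * Complex.Gamma w * Complex.cos (Real.pi * w / 2) * riemannZeta w :=
  riemannZeta_one_sub (fun n h => by
    have : w.re = -n := by rw [h]; simp
    have : (0 : ℝ) ≤ n := n.cast_nonneg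
    linarith) (fun h => by simp [h] at hw)

theorem zeta_one_sub_ne_zero {w : ℂ} (hw : 1 < w.re) (hc : Complex.cos (Real.pi * w / 2) ≠ 0) :
    riemannZeta (1 - w) ≠ 0 := by
  rw [zeta_one_sub hw]
  have h2 : (2 * Real.pi : ℂ) ≠ 0 := by simp [Real.pi_ne_zero]
  have h3 : Complex.Gamma w ≠ 0 := Complex.Gamma_ne_zero_of_re_pos (by linarith)
  have h4 := riemannZeta_ne_zero_of_one_lt_re hw
  have h5 : (2 * Real.pi : ℂ) ^ (-w) ≠ 0 := by simp [Complex.cpow_eq_zero_iff, Real.pi_ne_zero]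
  simp [h3, h4, h5, hc]

theorem zeta_logDeriv_one_sub {w : ℂ} (hw : 1 < w.re) (hc : Complex.cos (Real.pi * w / 2) ≠ 0) :
    deriv riemannZeta (1 - w) / riemannZeta (1 - w) =
      Real.log (2 * Real.pi) - digammaSeries w
        + Real.pi / 2 * (Complex.sin (Real.pi * w / 2) / Complex.cos (Real.pi * w / 2))
        - deriv riemannZeta w / riemannZeta w := by
  have hw1 : w ≠ 1 := fun h => by simp [h] at hw
  have hw2 : 1 - w ≠ 1 := fun h => by
    have : w = 0 := by linear_combination -h
    simp [this] at hw; linarith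
  have h2 : (2 * Real.pi : ℂ) ≠ 0 := by simp [Real.pi_ne_zero]
  have h3 : Complex.Gamma w ≠ 0 := Complex.Gamma_ne_zero_of_re_pos (by linarith)
  have h4 := riemannZeta_ne_zero_of_one_lt_re hw
  have h5 : (2 * Real.pi : ℂ) ^ (-w) ≠ 0 := by simp [Complex.cpow_eq_zero_iff, Real.pi_ne_zero]
  have d1 : HasDerivAt (fun w : ℂ => riemannZeta (1 - w)) (deriv riemannZeta (1 - w) * (-1)) w :=
    (differentiableAt_riemannZeta hw2).hasDerivAt.comp w ((hasDerivAt_id w).const_sub 1)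
  have d2 : HasDerivAt (fun w : ℂ => (2 * Real.pi : ℂ) ^ (-w))
      ((2 * Real.pi : ℂ) ^ (-w) * Complex.log (2 * Real.pi) * (-1)) w :=
    (hasDerivAt_neg w).const_cpow (Or.inl h2)
  have d3 := hasDerivAt_Gamma_of_re_pos (w := w) (by linarith)
  have d4 : HasDerivAt (fun w : ℂ => Complex.cos (Real.pi * w / 2))
      (-Complex.sin (Real.pi * w / 2) * (Real.pi * 1 / 2)) w :=
    (((hasDerivAt_id w).const_mul (Real.pi : ℂ)).div_const 2).ccos
  have d5 := (differentiableAt_riemannZeta hw1).hasDerivAt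
  have d6 := (((d2.const_mul 2).mul d3).mul d4).mul d5
  have hev : (fun w : ℂ => riemannZeta (1 - w)) =ᶠ[𝓝 w] fun w =>
      2 * (2 * Real.pi) ^ (-w) * Complex.Gamma w * Complex.cos (Real.pi * w / 2) * riemannZeta w := by
    have : {z : ℂ | 1 < z.re} ∈ 𝓝 w := (isOpen_lt continuous_const Complex.continuous_re).mem_nhds hw
    filter_upwards [this] with z hz using zeta_one_sub hz
  have e := d1.unique (d6.congr_of_eventuallyEq hev)
  simp only [Pi.mul_apply] at e
  have elog : (Real.log (2 * Real.pi) : ℂ) = Complex.log (2 * Real.pi) := by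
    rw [Complex.ofReal_log (by positivity)]; push_cast; rfl
  rw [elog, show deriv riemannZeta (1 - w) = -(deriv riemannZeta (1 - w) * (-1)) by ring, e,
    zeta_one_sub hw]
  field_simp
  ring

theorem digamma_bounds (t : ℝ) :
    |(digammaSeries (2 + t * Complex.I)).re - (Real.log (4 + t ^ 2) / 2 - 1 / (4 + t ^ 2))| ≤
      1 / (3 * (‖(2 + t * Complex.I : ℂ)‖ * (1 + |t|))) := by
  have h := abs_digammaSeries_re_sub_le (re_two_add t)
  have e : ‖(2 + t * Complex.I : ℂ)‖ ^ 2 = 4 + t ^ 2 := by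
    rw [Complex.sq_norm, Complex.normSq_apply]; simp; ring
  have e2 : Real.log ‖(2 + t * Complex.I : ℂ)‖ = Real.log (4 + t ^ 2) / 2 := by
    rw [← e, Real.log_pow]; push_cast; ring
  rw [e, e2] at h
  simpa using h

theorem cos_pi_mul_two_add (t : ℝ) : Complex.cos (Real.pi * (2 + t * Complex.I) / 2) =
    -((Real.cosh (Real.pi * t / 2) : ℝ) : ℂ) := by
  rw [show (Real.pi * (2 + t * Complex.I) / 2 : ℂ) = ((Real.pi * t / 2 : ℝ) : ℂ) * Complex.I + Real.pi by
    push_cast; ring, Complex.cos_add_pi, Complex.cos_mul_I, Complex.ofReal_cosh]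

theorem sin_pi_mul_two_add (t : ℝ) : Complex.sin (Real.pi * (2 + t * Complex.I) / 2) =
    -((Real.sinh (Real.pi * t / 2) : ℝ) : ℂ) * Complex.I := by
  rw [show (Real.pi * (2 + t * Complex.I) / 2 : ℂ) = ((Real.pi * t / 2 : ℝ) : ℂ) * Complex.I + Real.pi by
    push_cast; ring, Complex.sin_add_pi, Complex.sin_mul_I, Complex.ofReal_sinh]; ring

theorem neg_one_add_eq (t : ℝ) :
    (-1 + t * Complex.I : ℂ) = 1 - (2 + (-t : ℝ) * Complex.I) := by push_cast; ring

theorem zeta_neg_one_add_ne_zero (t : ℝ) : riemannZeta (-1 + t * Complex.I) ≠ 0 := by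
  rw [neg_one_add_eq]
  refine zeta_one_sub_ne_zero (by rw [re_two_add]; norm_num) ?_
  rw [cos_pi_mul_two_add, neg_ne_zero]
  exact_mod_cast (Real.cosh_pos _).ne'

/-- In the logarithmic derivative of the functional equation at w = 2 - it, the tangent of πw/2 is
purely imaginary and disappears from the real part. -/
theorem re_zeta_logDeriv_neg_one_add (t : ℝ) :
    (deriv riemannZeta (-1 + t * Complex.I) / riemannZeta (-1 + t * Complex.I)).re =
      Real.log (2 * Real.pi) - (digammaSeries (2 + (-t : ℝ) * Complex.I)).re
        - (deriv riemannZeta (2 + (-t : ℝ) * Complex.I) / riemannZeta (2 + (-t : ℝ) * Complex.I)).re := by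
  rw [neg_one_add_eq, zeta_logDeriv_one_sub (by rw [re_two_add]; norm_num)]
  · rw [sin_pi_mul_two_add, cos_pi_mul_two_add]
    simp only [Complex.sub_re, Complex.add_re, Complex.ofReal_re]
    have : (Real.pi / 2 * (-((Real.sinh (Real.pi * (-t) / 2) : ℝ) : ℂ) * Complex.I /
        -((Real.cosh (Real.pi * (-t) / 2) : ℝ) : ℂ)) : ℂ) =
        ((Real.pi / 2 * (Real.sinh (Real.pi * (-t) / 2) / Real.cosh (Real.pi * (-t) / 2)) : ℝ) : ℂ)
          * Complex.I := by
      push_cast; rw [neg_mul, neg_div_neg_eq]; ring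
    rw [this, Complex.re_ofReal_mul]; simp
  · rw [cos_pi_mul_two_add, neg_ne_zero]
    exact_mod_cast (Real.cosh_pos _).ne'

/-! ### Numerical bounds on the line `Re s = -1` -/

theorem log_two_pi_bounds : 1.8378 ≤ Real.log (2 * Real.pi) ∧ Real.log (2 * Real.pi) ≤ 1.8379 := by
  have e : Real.log (2 * Real.pi) = 2 * Real.log 5 - 2 * Real.log 2 + Real.log (2 * Real.pi / 6.25) := by
    rw [Real.log_div (by positivity) (by norm_num), show (6.25 : ℝ) = 5 ^ 2 / 2 ^ 2 by norm_num,
      Real.log_div (by norm_num) (by norm_num), Real.log_pow, Real.log_pow]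
    push_cast; ring
  have h1 := Real.log_le_sub_one_of_pos (x := 2 * Real.pi / 6.25) (by positivity)
  have h2 := Real.one_sub_inv_le_log_of_pos (x := 2 * Real.pi / 6.25) (by positivity)
  have p1 := Real.pi_gt_d6
  have p2 := Real.pi_lt_d6
  have a1 := Real.log_two_gt_d9
  have a2 := Real.log_two_lt_d9
  have a3 := Real.log_five_gt_d9
  have a4 := Real.log_five_lt_d9
  have h3 : (2 * Real.pi / 6.25)⁻¹ ≤ 1 - 0.00528 := by
    rw [inv_div, div_le_iff₀ (by positivity)]; linarith
  have h4 : 2 * Real.pi / 6.25 ≤ 1.00531 := by rw [div_le_iff₀ (by norm_num)]; linarith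
  constructor
  · linarith
  · linarith

theorem log_le_add {x y : ℝ} (hx : 0 < x) (hy : 0 < y) : Real.log x ≤ Real.log y + (x / y - 1) := by
  have := Real.log_le_sub_one_of_pos (div_pos hx hy)
  rw [Real.log_div hx.ne' hy.ne'] at this; linarith

theorem le_log_add {x y : ℝ} (hx : 0 < x) (hy : 0 < y) : Real.log y + (1 - y / x) ≤ Real.log x := by
  have := Real.log_le_sub_one_of_pos (div_pos hy hx)
  rw [Real.log_div hy.ne' hx.ne'] at this; linarith

theorem log_two_pow (n : ℕ) : Real.log (2 ^ n) = n * Real.log 2 := Real.log_pow _ _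

theorem re_zeta_logDeriv_pos {t : ℝ} (ht : 0 ≤ t) (ht' : t ≤ 3.4) :
    0 < (deriv riemannZeta (-1 + t * Complex.I) / riemannZeta (-1 + t * Complex.I)).re := by
  rw [re_zeta_logDeriv_neg_one_add]
  have h1 := (abs_le.1 (digamma_bounds (-t))).2
  rw [neg_sq, abs_neg, abs_of_nonneg ht] at h1
  have h2 := neg_zeta_logDeriv_eq (2 + (-t : ℝ) * Complex.I)
  have h3 := neg_le_re_eulerLogDeriv (p := 2) (by norm_num) (-t)
  have h4 := neg_le_re_eulerLogDeriv (p := 3) (by norm_num) (-t)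
  have h5 := (abs_le.1 ((Complex.abs_re_le_norm _).trans
    (norm_logDerivSix_le (re_two_add (-t)).ge))).1
  have h6 := congrArg Complex.re h2
  rw [neg_div, Complex.neg_re, Complex.add_re, Complex.add_re] at h6
  have l2 := Real.log_two_lt_d9
  have l3 := Real.log_three_lt_d9
  have lp := log_two_pi_bounds.1
  push_cast at h3 h4
  norm_num only at h3 h4
  -- The threshold is just below log 2π - log 2 / 5 - log 3 / 10 - 0.2021, the smallest possible
  -- contribution of all the other terms.
  suffices h : (digammaSeries (2 + (-t : ℝ) * Complex.I)).re < 1.387 by push_cast at *; linarith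
  have hn : ‖(2 + (-t : ℝ) * Complex.I : ℂ)‖ ^ 2 = 4 + t ^ 2 := by
    rw [Complex.sq_norm, Complex.normSq_apply]; simp; ring
  have hn0 := norm_nonneg (2 + (-t : ℝ) * Complex.I : ℂ)
  set n := ‖(2 + (-t : ℝ) * Complex.I : ℂ)‖
  rcases le_total t 2 with h7 | h7
  · have g1 : Real.log (4 + t ^ 2) ≤ Real.log (2 ^ 3) := Real.log_le_log (by positivity) (by nlinarith)
    rw [log_two_pow] at g1
    have g2 : 2 ≤ n := by nlinarith
    have g3 : 1 / (3 * (n * (1 + t))) ≤ 1 / (3 * (2 * 1)) := by gcongr; linarith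
    have g4 : 0 ≤ 1 / (4 + t ^ 2) := by positivity
    push_cast at g1
    have g6 : (1 : ℝ) / (3 * (2 * 1)) ≤ 0.17 := by norm_num
    linarith
  · have g1 : Real.log (4 + t ^ 2) ≤ Real.log (2 ^ 4) + (15.56 / 2 ^ 4 - 1) :=
      (Real.log_le_log (by positivity) (by nlinarith)).trans (log_le_add (by norm_num) (by norm_num))
    rw [log_two_pow] at g1
    have g2 : 2.8 ≤ n := by nlinarith
    have g3 : 1 / (3 * (n * (1 + t))) ≤ 1 / (3 * (2.8 * 3)) := by gcongr; linarith
    have g4 : 1 / 15.56 ≤ 1 / (4 + t ^ 2) := by gcongr; nlinarith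
    push_cast at g1
    have g5 : (1 : ℝ) / 15.56 ≥ 0.064 := by norm_num
    have g6 : (1 : ℝ) / (3 * (2.8 * 3)) ≤ 0.04 := by norm_num
    linarith

theorem le_digamma_sub {t₀ t : ℝ} (h0 : 0 < t₀) (h : t₀ ≤ t) :
    Real.log (4 + t₀ ^ 2) / 2 - 1 / (4 + t₀ ^ 2) - 1 / (3 * (t₀ * (1 + t₀))) ≤
      (digammaSeries (2 + (-t : ℝ) * Complex.I)).re := by
  have h1 := (abs_le.1 (digamma_bounds (-t))).1
  rw [neg_sq, abs_neg, abs_of_nonneg (h0.le.trans h)] at h1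
  have hn : t₀ ≤ ‖(2 + (-t : ℝ) * Complex.I : ℂ)‖ := by
    refine h.trans (le_trans ?_ (Complex.abs_im_le_norm _))
    simp; exact le_abs_self t
  have g1 : Real.log (4 + t₀ ^ 2) ≤ Real.log (4 + t ^ 2) := Real.log_le_log (by positivity) (by gcongr)
  have g2 : 1 / (4 + t ^ 2) ≤ 1 / (4 + t₀ ^ 2) := by gcongr
  have g3 : 1 / (3 * (‖(2 + (-t : ℝ) * Complex.I : ℂ)‖ * (1 + t))) ≤ 1 / (3 * (t₀ * (1 + t₀))) := by
    gcongr
  linarith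

theorem cos_le_of_bounds {x b : ℝ} (h1 : 0 ≤ x - 3 * Real.pi) (h2 : x - 3 * Real.pi ≤ b) :
    Real.cos x ≤ -(1 - b ^ 2 / 2) := by
  have e : Real.cos x = -Real.cos (x - 3 * Real.pi) := by
    rw [show x - 3 * Real.pi = x - Real.pi - 2 * Real.pi by ring, Real.cos_sub_two_pi, Real.cos_sub_pi]
    ring
  rw [e]
  have := Real.one_sub_sq_div_two_le_cos (x := x - 3 * Real.pi)
  nlinarith

theorem re_eulerLogDeriv_le_of_le {p : ℕ} (hp : 1 < p) (t : ℝ) : (eulerLogDeriv p (2 + t * Complex.I)).re ≤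
    Real.log p / ((p : ℝ) ^ 2 - 1) := by
  refine (re_eulerLogDeriv_le hp le_rfl (Real.cos_le_one _)).trans (le_of_eq ?_)
  have hp1 : (1 : ℝ) < p := by exact_mod_cast hp
  have hp2 : (1 : ℝ) < (p : ℝ) ^ 2 := one_lt_pow₀ hp1 two_ne_zero
  have : (p : ℝ) ^ 4 + 1 - 2 * (p : ℝ) ^ 2 * 1 = ((p : ℝ) ^ 2 - 1) ^ 2 := by ring
  rw [this, mul_one]
  have : (p : ℝ) ^ 2 - 1 ≠ 0 := by linarith
  field_simp

/-- From 11.4 on the crude bound 0.5704 for ζ'/ζ on Re s = 2 is enough. Below that one Euler factor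
must be shown to be away from its maximum: up to 10.3 the prime 3, since t log 3 has just passed 3π
at t = 8.7 and its cosine is still small later, and from 10.3 to 11.4 the prime 2. -/
theorem re_zeta_logDeriv_neg {t : ℝ} (ht : 8.7 ≤ t) :
    (deriv riemannZeta (-1 + t * Complex.I) / riemannZeta (-1 + t * Complex.I)).re < 0 := by
  rw [re_zeta_logDeriv_neg_one_add]
  have h2 := neg_zeta_logDeriv_eq (2 + (-t : ℝ) * Complex.I)
  have h5 := (abs_le.1 ((Complex.abs_re_le_norm _).trans
    (norm_logDerivSix_le (re_two_add (-t)).ge))).2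
  have h6 := congrArg Complex.re h2
  rw [neg_div, Complex.neg_re, Complex.add_re, Complex.add_re] at h6
  have l2 := Real.log_two_lt_d9
  have l2' := Real.log_two_gt_d9
  have l3 := Real.log_three_lt_d9
  have l3' := Real.log_three_gt_d9
  have l5' := Real.log_five_gt_d9
  have lp := log_two_pi_bounds.2
  have p1 := Real.pi_gt_d6
  have p2 := Real.pi_lt_d6
  have e2 := re_eulerLogDeriv_le_of_le (p := 2) (by norm_num) (-t)
  have e3 := re_eulerLogDeriv_le_of_le (p := 3) (by norm_num) (-t)
  have c3 := fun c h h' => re_eulerLogDeriv_le (p := 3) (by norm_num) (t := -t) (c := c) h h'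
  have c2 := fun c h h' => re_eulerLogDeriv_le (p := 2) (by norm_num) (t := -t) (c := c) h h'
  simp only [Nat.cast_ofNat, neg_mul, Real.cos_neg] at e2 e3 c3 c2
  have hl3 : t * 1.0986122 ≤ t * Real.log 3 ∧ t * Real.log 3 ≤ t * 1.0986124 :=
    ⟨by gcongr; linarith, by gcongr; linarith⟩
  have hl2 : t * 0.6931471 ≤ t * Real.log 2 ∧ t * Real.log 2 ≤ t * 0.6931472 :=
    ⟨by gcongr; linarith, by gcongr; linarith⟩
  have log80 : Real.log 80 = 4 * Real.log 2 + Real.log 5 := by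
    rw [show (80 : ℝ) = 2 ^ 4 * 5 by norm_num, Real.log_mul (by norm_num) (by norm_num), log_two_pow]
    push_cast; ring
  have log90 : Real.log 90 = Real.log 2 + 2 * Real.log 3 + Real.log 5 := by
    rw [show (90 : ℝ) = 2 * 3 ^ 2 * 5 by norm_num, Real.log_mul (by norm_num) (by norm_num),
      Real.log_mul (by norm_num) (by norm_num), Real.log_pow]
    push_cast; ring
  have log96 : Real.log 96 = 5 * Real.log 2 + Real.log 3 := by
    rw [show (96 : ℝ) = 2 ^ 5 * 3 by norm_num, Real.log_mul (by norm_num) (by norm_num), log_two_pow]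
    push_cast; ring
  have log108 : Real.log 108 = 2 * Real.log 2 + 3 * Real.log 3 := by
    rw [show (108 : ℝ) = 2 ^ 2 * 3 ^ 3 by norm_num, Real.log_mul (by norm_num) (by norm_num),
      log_two_pow, Real.log_pow]
    push_cast; ring
  rcases le_total t 8.95 with q1 | q1
  · have d := le_digamma_sub (by norm_num) ht
    have g := le_log_add (x := 4 + 8.7 ^ 2) (y := 80) (by norm_num) (by norm_num)
    have hc := cos_le_of_bounds (x := t * Real.log 3) (b := 0.4080) (by linarith) (by linarith)
    have hE := c3 _ (by norm_num) hc
    norm_num only at d g e2 hE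
    linarith
  rcases le_total t 9.2 with q2 | q2
  · have d := le_digamma_sub (by norm_num) q1
    have g := le_log_add (x := 4 + 8.95 ^ 2) (y := 80) (by norm_num) (by norm_num)
    have hc := cos_le_of_bounds (x := t * Real.log 3) (b := 0.6826) (by linarith) (by linarith)
    have hE := c3 _ (by norm_num) hc
    norm_num only at d g e2 hE
    linarith
  rcases le_total t 9.5 with q3 | q3
  · have d := le_digamma_sub (by norm_num) q2
    have g := le_log_add (x := 4 + 9.2 ^ 2) (y := 90) (by norm_num) (by norm_num)
    have hc := cos_le_of_bounds (x := t * Real.log 3) (b := 1.0123) (by linarith) (by linarith)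
    have hE := c3 _ (by norm_num) hc
    norm_num only at d g e2 hE
    linarith
  rcases le_total t 10 with q4 | q4
  · have d := le_digamma_sub (by norm_num) q3
    have g := le_log_add (x := 4 + 9.5 ^ 2) (y := 96) (by norm_num) (by norm_num)
    have hc : Real.cos (t * Real.log 3) ≤ 0 := by
      rw [← Real.cos_sub_two_pi]
      exact Real.cos_nonpos_of_pi_div_two_le_of_le (by linarith) (by linarith)
    have hE := c3 _ (by norm_num) hc
    norm_num only at d g e2 hE
    linarith
  rcases le_total t 10.3 with q5 | q5
  · have d := le_digamma_sub (by norm_num) q4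
    have g := le_log_add (x := 4 + 10 ^ 2) (y := 96) (by norm_num) (by norm_num)
    have hc : Real.cos (t * Real.log 3) ≤ 0.33 := by
      have : Real.cos (t * Real.log 3) = Real.sin (t * Real.log 3 - 7 * Real.pi / 2) := by
        rw [show t * Real.log 3 - 7 * Real.pi / 2 = (t * Real.log 3 + Real.pi / 2) - 2 * Real.pi - 2 * Real.pi by ring,
          Real.sin_sub_two_pi, Real.sin_sub_two_pi, Real.sin_add_pi_div_two]
      rw [this]
      rcases le_total 0 (t * Real.log 3 - 7 * Real.pi / 2) with h | h
      · exact (Real.sin_le h).trans (by linarith)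
      · refine (Real.sin_nonpos_of_nonpos_of_neg_pi_le h ?_).trans (by norm_num); linarith
    have hE := c3 _ (by norm_num) hc
    norm_num only at d g e2 hE
    linarith
  rcases le_total t 11.4 with q6 | q6
  · have d := le_digamma_sub (by norm_num) q5
    have g := le_log_add (x := 4 + 10.3 ^ 2) (y := 108) (by norm_num) (by norm_num)
    have hc : Real.cos (t * Real.log 2) ≤ 0.797 := by
      rw [← Real.cos_sub_two_pi]
      have h1 : 0.8559 ≤ t * Real.log 2 - 2 * Real.pi := by linarith
      refine (Real.cos_le_cos_of_nonneg_of_le_pi (by norm_num) (by linarith) h1).trans ?_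
      have := (abs_le.1 (Real.cos_bound (x := 0.8559) (by rw [abs_of_pos] <;> norm_num))).2
      rw [abs_of_pos (by norm_num)] at this
      norm_num only at this ⊢
      linarith
    have hE := c2 _ (by norm_num) hc
    norm_num only at d g e3 hE
    linarith
  · have d := le_digamma_sub (by norm_num) q6
    have g := le_log_add (x := 4 + 11.4 ^ 2) (y := 108) (by norm_num) (by norm_num)
    have z := (abs_le.1 ((Complex.abs_re_le_norm _).trans
      (norm_zeta_logDeriv_le (re_two_add (-t)).ge))).1
    norm_num only at d g
    linarith

/-! ### The size of `ζ` on the lines `Re s = -1, -3, …` -/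

/-- This is the reflection formula at it, combined with Γ(1 + it) = it Γ(it) and the fact that Γ(1 -
it) is the conjugate of Γ(1 + it). -/
theorem norm_Gamma_one_add_sq {t : ℝ} (ht : 0 < t) :
    ‖Complex.Gamma (1 + t * Complex.I)‖ ^ 2 * Real.sinh (Real.pi * t) = Real.pi * t := by
  have hz : (t * Complex.I : ℂ) ≠ 0 := by simp [ht.ne']
  have h1 := Complex.Gamma_mul_Gamma_one_sub (t * Complex.I)
  have h2 := Complex.Gamma_add_one (t * Complex.I) hz
  have h3 : Complex.Gamma (1 - t * Complex.I) = starRingEnd ℂ (Complex.Gamma (1 + t * Complex.I)) := by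
    rw [← Complex.Gamma_conj]; congr 1; simp [sub_eq_add_neg]
  have h4 : Complex.sin (Real.pi * (t * Complex.I)) = (Real.sinh (Real.pi * t) : ℝ) * Complex.I := by
    rw [← mul_assoc, Complex.sin_mul_I]; push_cast; rfl
  have hs : Real.sinh (Real.pi * t) ≠ 0 := (Real.sinh_pos_iff.2 (by positivity)).ne'
  have h5 : (((‖Complex.Gamma (1 + t * Complex.I)‖ ^ 2 * Real.sinh (Real.pi * t) : ℝ)) : ℂ) =
      ((Real.pi * t : ℝ) : ℂ) := by
    have hs' : ((Real.sinh (Real.pi * t) : ℝ) : ℂ) ≠ 0 := by exact_mod_cast hs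
    rw [Complex.ofReal_mul, ← Complex.normSq_eq_norm_sq, ← Complex.mul_conj, ← h3, add_comm (1 : ℂ), h2,
      mul_assoc (t * Complex.I : ℂ), h1, h4]
    rw [Complex.ofReal_mul, show (t : ℂ) * Complex.I * (Real.pi / ((Real.sinh (Real.pi * t) : ℝ) * Complex.I)) *
      (Real.sinh (Real.pi * t) : ℝ) = Real.pi * t * ((Real.sinh (Real.pi * t) : ℝ) / (Real.sinh (Real.pi * t) : ℝ))
        * (Complex.I / Complex.I) by ring, div_self hs', div_self Complex.I_ne_zero]
    ring
  exact_mod_cast h5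

/-- By the reflection formula Q = x coth x with x = πt/2. The bound 1/2, uniform in t, serves on
vertical lines far to the left; the others serve on Re s = -1. -/
theorem norm_Gamma_mul_cosh {t : ℝ} (ht : 0 < t) :
    let Q := (‖Complex.Gamma (1 + t * Complex.I)‖ * Real.cosh (Real.pi * t / 2)) ^ 2
    Real.pi * t / 2 ≤ Q ∧ Q ≤ 1 + Real.pi * t / 2 ∧ 1 / 2 ≤ Q := by
  intro Q
  have h := norm_Gamma_one_add_sq ht
  set x := Real.pi * t / 2 with hx
  have hx0 : 0 < x := by positivity
  have e1 : Real.pi * t = 2 * x := by rw [hx]; ring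
  rw [e1, Real.sinh_two_mul] at h
  have hs : 0 < Real.sinh x := Real.sinh_pos_iff.2 hx0
  have hc : 0 < Real.cosh x := Real.cosh_pos x
  set g := ‖Complex.Gamma (1 + t * Complex.I)‖
  have hQ : Q * Real.sinh x = x * Real.cosh x := by
    have : Q * Real.sinh x = Real.cosh x * (g ^ 2 * (2 * Real.sinh x * Real.cosh x)) / 2 := by
      simp only [Q]; ring
    rw [this, h]; ring
  have e2 : Real.cosh x - Real.sinh x = Real.exp (-x) := Real.cosh_sub_sinh x
  have e3 : Real.exp (-x) ≤ 1 := Real.exp_le_one_iff.2 (by linarith)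
  have e4 : x ≤ Real.sinh x := Real.self_le_sinh_iff.2 hx0.le
  have e5 : Real.cosh x + Real.sinh x = Real.exp x := Real.cosh_add_sinh x
  have e6 : 1 - 2 * x ≤ Real.exp (-(2 * x)) := by
    have := Real.add_one_le_exp (-(2 * x)); linarith
  have e7 : Real.exp (-(2 * x)) * Real.exp x = Real.exp (-x) := by rw [← Real.exp_add]; congr 1; ring
  have e8 := Real.exp_pos (-x)
  have e9 := Real.exp_pos x
  refine ⟨?_, ?_, ?_⟩
  · refine le_of_mul_le_mul_right ?_ hs
    rw [hQ]; nlinarith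
  · refine le_of_mul_le_mul_right ?_ hs
    rw [hQ]; nlinarith
  · refine le_of_mul_le_mul_right ?_ hs
    rw [hQ]; nlinarith

theorem norm_two_pi_cpow (w : ℂ) : ‖(2 * Real.pi : ℂ) ^ w‖ = (2 * Real.pi) ^ w.re := by
  have := Complex.norm_cpow_eq_rpow_re_of_pos (x := 2 * Real.pi) (by positivity) w
  push_cast at this; exact this

theorem norm_zeta_neg_one_add {t : ℝ} (ht : 0 < t) : ‖riemannZeta (-1 + t * Complex.I)‖ ^ 2 =
    (‖Complex.Gamma (1 + t * Complex.I)‖ * Real.cosh (Real.pi * t / 2)) ^ 2 * (1 + t ^ 2) *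
      ‖riemannZeta (2 + (-t : ℝ) * Complex.I)‖ ^ 2 / (4 * Real.pi ^ 4) := by
  have hG : ‖Complex.Gamma (2 + (-t : ℝ) * Complex.I)‖ ^ 2 =
      (1 + t ^ 2) * ‖Complex.Gamma (1 + t * Complex.I)‖ ^ 2 := by
    have e : (2 + (-t : ℝ) * Complex.I : ℂ) = starRingEnd ℂ (1 + t * Complex.I + 1) := by
      simp only [map_add, map_mul, map_one, Complex.conj_I, Complex.conj_ofReal]; push_cast; ring
    rw [e, Complex.Gamma_conj, Complex.norm_conj, Complex.Gamma_add_one, norm_mul, mul_pow]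
    · congr 1
      rw [Complex.sq_norm, Complex.normSq_apply]; simp; ring
    · intro h; simpa using congrArg Complex.re h
  rw [neg_one_add_eq, zeta_one_sub (by rw [re_two_add]; norm_num), norm_mul, norm_mul, norm_mul, norm_mul,
    cos_pi_mul_two_add, norm_neg, Complex.norm_real, norm_two_pi_cpow]
  have e2 : (-(2 + (-t : ℝ) * Complex.I) : ℂ).re = -2 := by simp
  rw [e2, Real.rpow_neg (by positivity), Real.rpow_two, mul_neg, neg_div, Real.cosh_neg,
    Real.norm_of_nonneg (Real.cosh_pos _).le, Complex.norm_ofNat]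
  simp only [mul_pow, hG]
  field_simp
  ring

theorem norm_zeta_neg_one_add_lt_one {t : ℝ} (ht : 0 < t) (ht' : t ≤ 3.4) :
    ‖riemannZeta (-1 + t * Complex.I)‖ < 1 := by
  have h := norm_zeta_neg_one_add ht
  have h1 := (norm_Gamma_mul_cosh ht).2.1
  have h2 := norm_zeta_le (re_two_add (-t)).ge
  have p1 := Real.pi_gt_three
  have p2 := Real.pi_lt_d2
  have h3 : ‖riemannZeta (-1 + t * Complex.I)‖ ^ 2 ≤ (1 + 3.15 * 3.4 / 2) * (1 + 3.4 ^ 2) * 1.645 ^ 2 / (4 * 3 ^ 4) := by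
    rw [h]; gcongr
    refine h1.trans ?_; gcongr
  have h4 : ‖riemannZeta (-1 + t * Complex.I)‖ ^ 2 < 1 := by
    refine h3.trans_lt (by norm_num)
  have := norm_nonneg (riemannZeta (-1 + t * Complex.I))
  nlinarith

theorem one_lt_norm_zeta_neg_one_add {t : ℝ} (ht : 8.7 ≤ t) :
    1 < ‖riemannZeta (-1 + t * Complex.I)‖ := by
  have h := norm_zeta_neg_one_add (t := t) (by linarith)
  have h1 := (norm_Gamma_mul_cosh (t := t) (by linarith)).1
  have h2 := norm_zeta_two_add_ge (re_two_add (-t))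
  have p1 := Real.pi_gt_d2
  have p2 := Real.pi_lt_d2
  have h3 : (3.14 * 8.7 / 2) * (1 + 8.7 ^ 2) * 0.65 ^ 2 / (4 * 3.15 ^ 4) ≤ ‖riemannZeta (-1 + t * Complex.I)‖ ^ 2 := by
    rw [h]; gcongr
    refine le_trans ?_ h1; gcongr
  have h4 : 1 < ‖riemannZeta (-1 + t * Complex.I)‖ ^ 2 := by
    refine lt_of_lt_of_le (by norm_num) h3
  have := norm_nonneg (riemannZeta (-1 + t * Complex.I))
  nlinarith

theorem sq_norm_cos (z : ℂ) : ‖Complex.cos z‖ ^ 2 = Real.cos z.re ^ 2 + Real.sinh z.im ^ 2 := by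
  have := Complex.cos_eq z
  rw [← Complex.ofReal_cos, ← Complex.ofReal_sin, ← Complex.ofReal_cosh, ← Complex.ofReal_sinh,
    ← Complex.ofReal_mul, ← Complex.ofReal_mul] at this
  rw [this, Complex.sq_norm, Complex.normSq_apply]
  simp only [Complex.sub_re, Complex.sub_im, Complex.ofReal_re, Complex.ofReal_im, Complex.mul_I_re,
    Complex.mul_I_im]
  have h1 := Real.sin_sq_add_cos_sq z.re
  have h2 := Real.cosh_sq z.im
  linear_combination (Real.cos z.re ^ 2) * h2 + (Real.sinh z.im ^ 2) * h1

theorem sq_norm_sin (z : ℂ) : ‖Complex.sin z‖ ^ 2 = Real.sin z.re ^ 2 + Real.sinh z.im ^ 2 := by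
  have := Complex.sin_eq z
  rw [← Complex.ofReal_cos, ← Complex.ofReal_sin, ← Complex.ofReal_cosh, ← Complex.ofReal_sinh,
    ← Complex.ofReal_mul, ← Complex.ofReal_mul] at this
  rw [this, Complex.sq_norm, Complex.normSq_apply]
  simp only [Complex.add_re, Complex.add_im, Complex.ofReal_re, Complex.ofReal_im, Complex.mul_I_re,
    Complex.mul_I_im]
  have h1 := Real.sin_sq_add_cos_sq z.re
  have h2 := Real.cosh_sq z.im
  linear_combination (Real.sin z.re ^ 2) * h2 + (Real.sinh z.im ^ 2) * h1

theorem factorial_mul_norm_Gamma_le (t : ℝ) (m : ℕ) :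
    (m.factorial : ℝ) * ‖Complex.Gamma (1 + t * Complex.I)‖ ≤
      ‖Complex.Gamma ((m + 1 : ℕ) + t * Complex.I)‖ := by
  induction m with
  | zero => simp
  | succ m ih =>
    have e : (((m + 1 + 1 : ℕ) : ℂ) + t * Complex.I) = ((m + 1 : ℕ) + t * Complex.I) + 1 := by
      push_cast; ring
    have hre : (((m + 1 : ℕ) : ℂ) + t * Complex.I).re = (m + 1 : ℕ) := by simp
    have hne : (((m + 1 : ℕ) : ℂ) + t * Complex.I) ≠ 0 := fun h => by
      rw [h, Complex.zero_re] at hre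
      exact absurd hre.symm (by positivity)
    rw [e, Complex.Gamma_add_one _ hne, norm_mul, Nat.factorial_succ, Nat.cast_mul, mul_assoc]
    refine mul_le_mul ?_ ih (by positivity) (by positivity)
    have := Complex.abs_re_le_norm (((m + 1 : ℕ) : ℂ) + t * Complex.I)
    rw [hre, abs_of_nonneg (by positivity)] at this
    exact this

/-- There is a vertical line far to the left on which `|ζ| > 1`. -/
theorem exists_line_one_lt_norm_zeta :
    ∃ A : ℝ, 1 < A ∧ ∀ t : ℝ, 0 < t → 1 < ‖riemannZeta (-A + t * Complex.I)‖ := by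
  have hlim := FloorSemiring.tendsto_pow_div_factorial_atTop (2 * Real.pi)
  -- In the end (2π)^(2k+2) < 0.49 (2k+1)! is required, with 0.49 = 2 · 0.7 · 0.35; since 2π · 0.07
  -- < 0.49 this threshold suffices.
  have hev : ∀ᶠ n : ℕ in atTop, (2 * Real.pi) ^ n / (n.factorial : ℝ) < 0.07 :=
    hlim.eventually (gt_mem_nhds (by norm_num))
  obtain ⟨N, hN⟩ := eventually_atTop.1 hev
  set k := N + 1
  have hk := hN (2 * k + 1) (by omega)
  refine ⟨2 * k + 1, ?_, fun t ht => ?_⟩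
  · have : (0 : ℝ) < k := by positivity
    linarith
  set w : ℂ := ((2 * k + 1 + 1 : ℕ) : ℂ) + (-t : ℝ) * Complex.I with hw
  have hs : (-(2 * k + 1 : ℝ) + t * Complex.I : ℂ) = 1 - w := by rw [hw]; push_cast; ring
  have hwre : w.re = (2 * k + 1 + 1 : ℕ) := by simp [hw]
  have hwim : w.im = -t := by simp [hw]
  have h2 : 2 ≤ w.re := by rw [hwre]; push_cast; linarith [(Nat.cast_nonneg k : (0:ℝ) ≤ k)]
  -- The abscissa is an odd negative integer, so Re w = 2k + 2 and the cosine has modulus exactly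
  -- cosh, bounded away from 0 even for small t.
  have hcos : ‖Complex.cos (Real.pi * w / 2)‖ = Real.cosh (Real.pi * t / 2) := by
    have hre : (Real.pi * w / 2 : ℂ).re = (k + 1 : ℕ) * Real.pi := by
      rw [Complex.div_ofNat_re, Complex.re_ofReal_mul, hwre]; push_cast; ring
    have him : (Real.pi * w / 2 : ℂ).im = -(Real.pi * t / 2) := by
      rw [Complex.div_ofNat_im, Complex.im_ofReal_mul, hwim]; ring
    rw [← sq_eq_sq₀ (norm_nonneg _) (Real.cosh_pos _).le, sq_norm_cos, hre, him, Real.sinh_neg, neg_sq,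
      Real.cosh_sq, Real.cos_sq', Real.sin_nat_mul_pi]
    ring
  have hG := factorial_mul_norm_Gamma_le t (2 * k + 1)
  have hG' : ‖Complex.Gamma w‖ = ‖Complex.Gamma ((2 * k + 1 + 1 : ℕ) + t * Complex.I)‖ := by
    rw [← Complex.norm_conj, ← Complex.Gamma_conj]
    congr 2
    simp only [hw, map_add, map_mul, Complex.conj_I, Complex.conj_ofReal, Complex.conj_natCast]
    push_cast; ring
  have hQ := (norm_Gamma_mul_cosh ht).2.2
  have hc := Real.cosh_pos (Real.pi * t / 2)
  have hg := norm_nonneg (Complex.Gamma (1 + t * Complex.I))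
  have hz := norm_zeta_ge h2
  set gc := ‖Complex.Gamma (1 + t * Complex.I)‖ * Real.cosh (Real.pi * t / 2) with hgc
  have hgc0 : 0 ≤ gc := by positivity
  have hgc1 : 0.7 ≤ gc := by nlinarith
  rw [show (-((2 * k + 1 : ℝ) : ℂ) + t * Complex.I : ℂ) = 1 - w from hs,
    zeta_one_sub (by linarith), norm_mul, norm_mul, norm_mul, norm_mul, hcos, norm_two_pi_cpow,
    Complex.norm_ofNat, hG']
  have e3 : (2 * Real.pi) ^ ((-w).re) = ((2 * Real.pi) ^ (2 * k + 1 + 1))⁻¹ := by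
    rw [Complex.neg_re, hwre, Real.rpow_neg (by positivity), Real.rpow_natCast]
  rw [e3]
  have hf : (0 : ℝ) < (2 * k + 1).factorial := by positivity
  rw [div_lt_iff₀ hf] at hk
  have hp : 0 < (2 * Real.pi) ^ (2 * k + 1) := by positivity
  have p2 := Real.pi_lt_d2
  have hp2 : (2 * Real.pi) ^ (2 * k + 1 + 1) < 0.49 * (2 * k + 1).factorial := by
    rw [pow_succ]; nlinarith [Real.pi_pos]
  have hlow : 0.7 * ((2 * k + 1).factorial : ℝ) ≤
      ‖Complex.Gamma ((2 * k + 1 + 1 : ℕ) + t * Complex.I)‖ * Real.cosh (Real.pi * t / 2) := by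
    calc 0.7 * ((2 * k + 1).factorial : ℝ) ≤ gc * ((2 * k + 1).factorial : ℝ) := by gcongr
      _ = ((2 * k + 1).factorial * ‖Complex.Gamma (1 + t * Complex.I)‖) * Real.cosh (Real.pi * t / 2) := by
        rw [hgc]; ring
      _ ≤ _ := by gcongr
  have hpos : 0 < (2 * Real.pi) ^ (2 * k + 1 + 1) := by positivity
  calc (1 : ℝ) < 2 * ((2 * Real.pi) ^ (2 * k + 1 + 1))⁻¹ * (0.7 * ((2 * k + 1).factorial : ℝ)) * 0.35 := by
        rw [mul_comm 2, mul_assoc, mul_assoc, mul_comm, ← div_eq_mul_inv, lt_div_iff₀ hpos]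
        linarith
    _ ≤ 2 * ((2 * Real.pi) ^ (2 * k + 1 + 1))⁻¹ * (‖Complex.Gamma ((2 * k + 1 + 1 : ℕ) + t * Complex.I)‖ *
        Real.cosh (Real.pi * t / 2)) * ‖riemannZeta w‖ := by gcongr
    _ = _ := by ring

/-- Far up in the half-plane `Re s ≤ -1` the modulus of `ζ` decreases to the right. -/
theorem exists_re_zeta_logDeriv_le : ∃ t₁ : ℝ, 0 < t₁ ∧ ∀ s : ℂ, s.re ≤ -1 → t₁ ≤ s.im →
    riemannZeta s ≠ 0 ∧ (deriv riemannZeta s / riemannZeta s).re ≤ -1 ∧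
      |(deriv riemannZeta s / riemannZeta s).im| < 9 := by
  -- At this height log|w| ≥ 9 outweighs log 2π, the tangent term (at most 3.15), 1/|w| and 0.5704.
  -- In the imaginary part log w contributes only its argument, and π + 3.15 + 1 + 0.5704 < 9.
  refine ⟨Real.exp 9, Real.exp_pos _, fun s hs ht => ?_⟩
  have ht1 : 1 ≤ s.im := by
    have := Real.add_one_le_exp 9; linarith
  set w : ℂ := 1 - s with hw
  have hwre : 2 ≤ w.re := by simp [hw]; linarith
  have hwim : w.im = -s.im := by simp [hw]
  have hsw : s = 1 - w := by rw [hw]; ring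
  have him : (Real.pi * w / 2 : ℂ).im = -(Real.pi * s.im / 2) := by
    rw [Complex.div_ofNat_im, Complex.im_ofReal_mul, hwim]; ring
  have hc2 := sq_norm_cos (Real.pi * w / 2)
  have hs2 := sq_norm_sin (Real.pi * w / 2)
  rw [him, Real.sinh_neg, neg_sq] at hc2 hs2
  have hy : 1 ≤ Real.sinh (Real.pi * s.im / 2) := by
    have : 1 ≤ Real.pi * s.im / 2 := by nlinarith [Real.pi_gt_three]
    exact this.trans (Real.self_le_sinh_iff.2 (by linarith))
  set y := Real.sinh (Real.pi * s.im / 2)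
  have hcn := norm_nonneg (Complex.cos (Real.pi * w / 2))
  have hsn := norm_nonneg (Complex.sin (Real.pi * w / 2))
  have hc1 : y ≤ ‖Complex.cos (Real.pi * w / 2)‖ := by
    refine abs_le_of_sq_le_sq' ?_ hcn |>.2
    rw [hc2]; nlinarith [sq_nonneg (Real.cos (Real.pi * w / 2 : ℂ).re)]
  have hs1 : ‖Complex.sin (Real.pi * w / 2)‖ ≤ 2 * y := by
    refine abs_le_of_sq_le_sq' ?_ (by linarith) |>.2
    rw [hs2]; nlinarith [Real.sin_sq_le_one (Real.pi * w / 2 : ℂ).re]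
  have hc0 : Complex.cos (Real.pi * w / 2) ≠ 0 := norm_pos_iff.1 (by linarith)
  have htan : ‖(Real.pi / 2 * (Complex.sin (Real.pi * w / 2) / Complex.cos (Real.pi * w / 2)) : ℂ)‖ ≤ 3.15 := by
    rw [norm_mul, norm_div (Complex.sin _)]
    have e : ‖(Real.pi / 2 : ℂ)‖ = Real.pi / 2 := by
      rw [norm_div, Complex.norm_real, Real.norm_of_nonneg Real.pi_pos.le, Complex.norm_ofNat]
    rw [e]
    have : ‖Complex.sin (Real.pi * w / 2)‖ / ‖Complex.cos (Real.pi * w / 2)‖ ≤ 2 := by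
      rw [div_le_iff₀ (by linarith)]; linarith
    have p := Real.pi_lt_d2
    nlinarith [Real.pi_pos]
  rw [hsw]
  refine ⟨zeta_one_sub_ne_zero (by linarith) hc0, ?_⟩
  rw [zeta_logDeriv_one_sub (by linarith) hc0]
  have hn : Real.exp 9 ≤ ‖w‖ := by
    refine ht.trans (le_trans ?_ (Complex.abs_im_le_norm w))
    rw [hwim, abs_neg]; exact le_abs_self _
  have h6 : 1 / ‖w‖ ≤ 1 := by
    rw [div_le_one (lt_of_lt_of_le (Real.exp_pos _) hn)]
    have := Real.add_one_le_exp 9; linarith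
  have hz := norm_zeta_logDeriv_le hwre
  constructor
  · rw [Complex.sub_re, Complex.add_re, Complex.sub_re, Complex.ofReal_re]
    have h1 := (abs_le.1 ((Complex.abs_re_le_norm _).trans htan)).2
    have h2 := (abs_le.1 ((Complex.abs_re_le_norm _).trans hz)).1
    have h3 := le_digammaSeries_re hwre
    have h4 := log_two_pi_bounds.2
    have h5 : 9 ≤ Real.log ‖w‖ := by
      rw [← Real.log_exp 9]; exact Real.log_le_log (Real.exp_pos _) hn
    linarith
  · rw [Complex.sub_im, Complex.add_im, Complex.sub_im, Complex.ofReal_im]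
    have h1 := abs_le.1 ((Complex.abs_im_le_norm _).trans htan)
    have h2 := abs_le.1 ((Complex.abs_im_le_norm _).trans hz)
    have h3 := abs_le.1 ((Complex.abs_im_le_norm _).trans (norm_digammaSeries_sub_log_le hwre))
    rw [Complex.sub_im, Complex.log_im] at h3
    have h4 := abs_le.1 (Complex.abs_arg_le_pi w)
    have h5 := Real.pi_lt_d2
    rw [abs_lt]
    constructor <;> linarith

/-! ### The argument of `ζ` on the line `Re s = -1` -/

/-- A continuous argument of `-ζ(-1 + it)`. -/
noncomputable def leftArg (t : ℝ) : ℝ :=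
  t * Real.log (2 * Real.pi) - (logGammaSeries (2 + t * Complex.I)).im - argZetaTwo t

/-- A continuous logarithm of `ζ(-1 + it)`. -/
noncomputable def leftLog (t : ℝ) : ℂ :=
  Real.log (2 * Real.pi) * (-2 + t * Complex.I) + starRingEnd ℂ (logGammaSeries (2 + t * Complex.I))
    + starRingEnd ℂ (logZetaTwo (2 + t * Complex.I))
    + ((Real.log (2 * Real.cosh (Real.pi * t / 2)) : ℝ) : ℂ) + Real.pi * Complex.I

theorem leftLog_im (t : ℝ) : (leftLog t).im = leftArg t + Real.pi := by
  simp [leftLog, leftArg, argZetaTwo]; ring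

/-- Functional equation at w = 2 - it, with Γ and ζ there written as conjugates of their values at 2
+ it; the summand πi comes from cos(πw/2) = -cosh(πt/2). -/
theorem exp_leftLog (t : ℝ) : Complex.exp (leftLog t) = riemannZeta (-1 + t * Complex.I) := by
  have e : (2 + (-t : ℝ) * Complex.I : ℂ) = starRingEnd ℂ (2 + t * Complex.I) := by
    simp only [map_add, map_mul, Complex.conj_I, Complex.conj_ofReal, Complex.conj_ofNat]; push_cast; ring
  have hpos : 0 < 2 * Real.cosh (Real.pi * t / 2) := by have := Real.cosh_pos (Real.pi * t / 2); positivity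
  have h2 : (2 * Real.pi : ℂ) ≠ 0 := by simp [Real.pi_ne_zero]
  have elog : (Real.log (2 * Real.pi) : ℂ) = Complex.log (2 * Real.pi) := by
    rw [Complex.ofReal_log (by positivity)]; push_cast; rfl
  have e3 : (2 * Real.pi : ℂ) ^ (-(2 + (-t : ℝ) * Complex.I)) =
      Complex.exp (Real.log (2 * Real.pi) * (-2 + t * Complex.I)) := by
    rw [Complex.cpow_def_of_ne_zero h2, elog]; congr 1; push_cast; ring
  rw [neg_one_add_eq, zeta_one_sub (by rw [re_two_add]; norm_num), cos_pi_mul_two_add, e3, e,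
    Complex.Gamma_conj, riemannZeta_conj, ← exp_logGammaSeries (by rw [re_two_add]; norm_num),
    ← exp_logZetaTwo (re_two_add t), ← Complex.exp_conj, ← Complex.exp_conj, leftLog, Complex.exp_add,
    Complex.exp_add, Complex.exp_add, Complex.exp_add, Complex.exp_pi_mul_I, ← Complex.ofReal_exp,
    Real.exp_log hpos, show Real.pi * -t / 2 = -(Real.pi * t / 2) by ring, Real.cosh_neg]
  push_cast; ring

/-- The explicit formula is used only for the existence of a derivative; its value follows by
differentiating exp(`leftLog`) = ζ, which avoids a second computation with the digamma function. -/
theorem hasDerivAt_leftLog (t : ℝ) : HasDerivAt leftLog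
    (Complex.I * (deriv riemannZeta (-1 + t * Complex.I) / riemannZeta (-1 + t * Complex.I))) t := by
  have hl : ∀ c : ℂ, HasDerivAt (fun t : ℝ => c + t * Complex.I) Complex.I t := fun c => by
    simpa using ((Complex.ofRealCLM.hasDerivAt (x := t)).mul_const Complex.I).const_add c
  have h2 : (0 : ℝ) < (2 + t * Complex.I : ℂ).re := by rw [re_two_add]; norm_num
  have hd : ∃ d, HasDerivAt leftLog d t := by
    have h1 := (hl (-2)).const_mul (Real.log (2 * Real.pi) : ℂ)
    have h3 := ((hasDerivAt_logGammaSeries h2).comp t (hl 2)).star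
    have h4 := ((differentiableAt_logZetaTwo (re_two_add t)).hasDerivAt.comp t (hl 2)).star
    have hpos : 2 * Real.cosh (Real.pi * t / 2) ≠ 0 := by
      have := Real.cosh_pos (Real.pi * t / 2); positivity
    have h5 := (((((hasDerivAt_id t).const_mul Real.pi).div_const 2).cosh.const_mul 2).log hpos).ofReal_comp
    exact ⟨_, (((h1.add h3).add h4).add h5).add_const (Real.pi * Complex.I)⟩
  obtain ⟨d, hd⟩ := hd
  have h6 := hd.cexp
  have h7 : HasDerivAt (fun t : ℝ => riemannZeta (-1 + t * Complex.I))
      (deriv riemannZeta (-1 + t * Complex.I) * Complex.I) t := by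
    have hne : (-1 + t * Complex.I : ℂ) ≠ 1 := fun h => by
      have := congrArg Complex.re h; simp at this; norm_num at this
    exact (differentiableAt_riemannZeta hne).hasDerivAt.comp t (hl (-1))
  have h8 : (fun t => Complex.exp (leftLog t)) = fun t : ℝ => riemannZeta (-1 + t * Complex.I) :=
    funext exp_leftLog
  rw [h8, exp_leftLog] at h6
  have h9 := h6.unique h7
  have h0 := zeta_neg_one_add_ne_zero t
  have : d = Complex.I * (deriv riemannZeta (-1 + t * Complex.I) / riemannZeta (-1 + t * Complex.I)) := by
    rw [mul_div_assoc', eq_div_iff h0]; linear_combination h9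
  rwa [this] at hd

theorem hasDerivAt_leftArg (t : ℝ) : HasDerivAt leftArg
    (deriv riemannZeta (-1 + t * Complex.I) / riemannZeta (-1 + t * Complex.I)).re t := by
  have h := (Complex.imCLM.hasFDerivAt.comp_hasDerivAt t (hasDerivAt_leftLog t)).sub_const Real.pi
  have e : (fun t => (Complex.imCLM ∘ leftLog) t - Real.pi) = leftArg := by
    ext t; simp [leftLog_im]
  rw [e] at h
  refine h.congr_deriv ?_
  simp

theorem logGammaSeries_two_im : (logGammaSeries 2).im = 0 := by
  have : logGammaSeries 2 = ((∑' k : ℕ, (2 * Real.log ((k + 2) / (k + 1)) - Real.log (1 + 2 / (k + 1)))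
      - Real.log 2 : ℝ) : ℂ) := by
    rw [logGammaSeries, Complex.ofReal_sub, Complex.ofReal_tsum, Complex.ofReal_log (by norm_num)]
    congr 1
    congr 1
    ext k
    rw [Complex.ofReal_sub, Complex.ofReal_log (x := 1 + 2 / ((k : ℝ) + 1)) (by positivity)]
    push_cast; rfl
  rw [this, Complex.ofReal_im]

theorem argZetaTwo_zero : argZetaTwo 0 = 0 := by
  rw [argZetaTwo_eq]
  simp only [Complex.ofReal_zero, zero_mul, add_zero]
  rw [zetaSix_two, two_cpow_neg_two, three_cpow_neg_two, Complex.arg_ofReal_of_nonneg (by positivity),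
    show (1 - 1 / 4 : ℂ) = ((3 / 4 : ℝ) : ℂ) by push_cast; norm_num,
    show (1 - 1 / 9 : ℂ) = ((8 / 9 : ℝ) : ℂ) by push_cast; norm_num,
    Complex.arg_ofReal_of_nonneg (by norm_num), Complex.arg_ofReal_of_nonneg (by norm_num)]
  norm_num

theorem leftArg_zero : leftArg 0 = 0 := by
  rw [leftArg, argZetaTwo_zero]; simp [logGammaSeries_two_im]

theorem leftArg_pos {t : ℝ} (ht : 0 < t) (ht' : t ≤ 3.4) : 0 < leftArg t := by
  have hm : StrictMonoOn leftArg (Icc 0 3.4) := by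
    refine strictMonoOn_of_deriv_pos (convex_Icc _ _)
      (fun x _ => (hasDerivAt_leftArg x).continuousAt.continuousWithinAt) fun x hx => ?_
    rw [interior_Icc] at hx
    rw [(hasDerivAt_leftArg x).deriv]
    exact re_zeta_logDeriv_pos hx.1.le hx.2.le
  have := hm ⟨le_rfl, by norm_num⟩ ⟨ht.le, ht'⟩ ht
  rwa [leftArg_zero] at this

theorem sub_cube_le_arctan {x : ℝ} (hx : 0 ≤ x) : x - x ^ 3 / 3 ≤ Real.arctan x := by
  have hm : MonotoneOn (fun x => Real.arctan x - (x - x ^ 3 / 3)) (Ici 0) := by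
    have hd : ∀ x : ℝ, HasDerivAt (fun x => Real.arctan x - (x - x ^ 3 / 3))
        (1 / (1 + x ^ 2) - (1 - (3 : ℕ) * x ^ 2 * 1 / 3)) x := fun x =>
      (Real.hasDerivAt_arctan x).sub ((hasDerivAt_id x).sub (((hasDerivAt_id x).pow 3).div_const 3))
    refine monotoneOn_of_deriv_nonneg (convex_Ici _) (fun x _ => (hd x).continuousAt.continuousWithinAt)
      (fun x _ => (hd x).differentiableAt.differentiableWithinAt) fun x _ => ?_
    rw [(hd x).deriv, sub_nonneg, le_div_iff₀ (by positivity)]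
    push_cast
    nlinarith [sq_nonneg (x ^ 2)]
  have := hm (mem_Ici.2 le_rfl) (mem_Ici.2 hx) hx
  simp at this; linarith

/-- The main term t log(2π/t) + t has maximum 2π, at t = 2π. For t ≥ 2 the term arctan(t/2) ≥ π/4
pays for the 0.4609 of arg ζ(2 + it); for t ≤ 2 there is ample room. -/
theorem leftArg_lt {t : ℝ} (ht : 0 < t) : leftArg t < 2 * Real.pi := by
  have h1 := le_logGammaSeries_im ht
  have h2 := (abs_le.1 (abs_argZetaTwo_le t)).1
  have hp := Real.pi_gt_d2
  have hl := log_two_pi_bounds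
  rw [leftArg]
  rcases le_total t 2 with h | h
  · have h3 : Real.log (2 ^ 2) ≤ Real.log (4 + t ^ 2) := Real.log_le_log (by norm_num) (by nlinarith)
    rw [log_two_pow] at h3
    have h4 : 0 ≤ Real.arctan (t / 2) := Real.arctan_nonneg.2 (by positivity)
    have := Real.log_two_gt_d9
    push_cast at h3
    nlinarith
  · have h3 : Real.log (t ^ 2) ≤ Real.log (4 + t ^ 2) := Real.log_le_log (by positivity) (by linarith)
    rw [Real.log_pow] at h3
    have h4 : Real.arctan 1 ≤ Real.arctan (t / 2) := Real.arctan_mono (by linarith)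
    rw [Real.arctan_one] at h4
    have h5 := log_le_add (x := 2 * Real.pi) (y := t) (by positivity) ht
    have h6 : t * Real.log (2 * Real.pi) ≤ t * Real.log t + (2 * Real.pi - t) := by
      calc _ ≤ t * (Real.log t + (2 * Real.pi / t - 1)) := by gcongr
        _ = _ := by field_simp
    push_cast at h3
    nlinarith

theorem arctan_le_of_inv {x b : ℝ} (hx : 0 < x) (h : b ≤ 1 / x - (1 / x) ^ 3 / 3) :
    Real.arctan x ≤ Real.pi / 2 - b := by
  have h1 := Real.arctan_inv_of_pos (x := x) hx
  have h2 := sub_cube_le_arctan (x := 1 / x) (by positivity)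
  rw [one_div] at h2 h
  linarith

/-- A concave lower bound for `leftArg`, up to the argument of `ζ(2 + it)`. -/
noncomputable def leftArgBound (t : ℝ) : ℝ :=
  t * Real.log (2 * Real.pi) + t - 3 / 2 * Real.arctan (t / 2) - t / 2 * Real.log (4 + t ^ 2)

theorem leftArgBound_le {t : ℝ} (ht : 0 < t) : leftArgBound t - argZetaTwo t ≤ leftArg t := by
  have h1 := logGammaSeries_im_le ht
  rw [leftArg, leftArgBound]; linarith

theorem concaveOn_leftArgBound : ConcaveOn ℝ (Ici 0) leftArgBound := by
  have hd : ∀ t : ℝ, HasDerivAt leftArgBound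
      (Real.log (2 * Real.pi) - Real.log (4 + t ^ 2) / 2 + 1 / (4 + t ^ 2)) t := by
    intro t
    have h0 : 4 + t ^ 2 ≠ 0 := by positivity
    have h1 := (hasDerivAt_id t).mul_const (Real.log (2 * Real.pi))
    have h2 := ((hasDerivAt_id t).div_const 2).arctan.const_mul (3 / 2)
    have h3 := ((hasDerivAt_id t).div_const 2).mul ((((hasDerivAt_id t).pow 2).const_add 4).log h0)
    refine (((h1.add (hasDerivAt_id t)).sub h2).sub h3).congr_deriv ?_
    have h5 : 1 + (t / 2) ^ 2 = (4 + t ^ 2) / 4 := by ring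
    have h6 : 1 / (4 + t ^ 2) * (4 + t ^ 2) = 1 := div_mul_cancel₀ _ h0
    have h7 : 1 / ((4 + t ^ 2) / 4) = 4 * (1 / (4 + t ^ 2)) := by field_simp
    have h8 : ∀ a : ℝ, a / (4 + t ^ 2) = a * (1 / (4 + t ^ 2)) := fun a => by ring
    simp only [id, h5, Pi.pow_apply, h7]
    push_cast
    rw [pow_one, h8 (2 * t * 1)]
    linear_combination (-1 : ℝ) * h6
  refine AntitoneOn.concaveOn_of_deriv (convex_Ici _)
    (fun x _ => (hd x).continuousAt.continuousWithinAt)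
    (fun x _ => (hd x).differentiableAt.differentiableWithinAt) ?_
  rw [interior_Ici]
  intro x hx y hy hxy
  simp only [(hd _).deriv]
  have hx' : (0 : ℝ) < x := hx
  have h1 : Real.log (4 + x ^ 2) ≤ Real.log (4 + y ^ 2) := Real.log_le_log (by positivity) (by gcongr)
  have h2 : 1 / (4 + y ^ 2) ≤ 1 / (4 + x ^ 2) := by gcongr
  linarith

/-- The excesses over π are just above the two available bounds 0.2082 and 0.4609 for arg ζ(2 + it).
The knot 4.53 lies just below π / log 2, up to which the smaller bound applies. -/
theorem leftArgBound_values : Real.pi + 0.2083 ≤ leftArgBound 3.4 ∧ Real.pi + 0.461 ≤ leftArgBound 4.53 ∧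
    Real.pi + 0.461 ≤ leftArgBound 8.7 := by
  have hl := log_two_pi_bounds.1
  have p2 := Real.pi_lt_d6
  have l2 := Real.log_two_lt_d9
  have l3 := Real.log_three_lt_d9
  have l5 := Real.log_five_lt_d9
  refine ⟨?_, ?_, ?_⟩
  · have a := arctan_le_of_inv (x := 3.4 / 2) (b := 0.52) (by norm_num) (by norm_num)
    have g := log_le_add (x := 4 + 3.4 ^ 2) (y := 2 ^ 4) (by norm_num) (by norm_num)
    rw [log_two_pow] at g
    rw [leftArgBound]
    norm_num only at a g ⊢
    linarith
  · have a := arctan_le_of_inv (x := 4.53 / 2) (b := 0.41) (by norm_num) (by norm_num)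
    have g := log_le_add (x := 4 + 4.53 ^ 2) (y := 5 ^ 2) (by norm_num) (by norm_num)
    rw [Real.log_pow] at g
    rw [leftArgBound]
    norm_num only at a g ⊢
    linarith
  · have a := arctan_le_of_inv (x := 8.7 / 2) (b := 0.2258) (by norm_num) (by norm_num)
    have g := log_le_add (x := 4 + 8.7 ^ 2) (y := 2 ^ 4 * 5) (by norm_num) (by norm_num)
    rw [Real.log_mul (by norm_num) (by norm_num), log_two_pow] at g
    rw [leftArgBound]
    norm_num only at a g ⊢
    linarith

/-- By concavity the lower bound need only be checked at the ends of [3.4, 4.53] and [4.53, 8.7]. On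
the first interval sin(t log 2) ≥ 0, which makes the weaker value at 3.4 sufficient. -/
theorem pi_lt_leftArg {t : ℝ} (ht : 3.4 ≤ t) (ht' : t ≤ 8.7) : Real.pi < leftArg t := by
  obtain ⟨h1, h2, h3⟩ := leftArgBound_values
  have h4 := leftArgBound_le (t := t) (by linarith)
  have hmin : ∀ a b : ℝ, 0 ≤ a → a ≤ t → t ≤ b → ∀ c, c ≤ leftArgBound a → c ≤ leftArgBound b →
      c ≤ leftArgBound t := fun a b ha hat htb c hca hcb =>
    (le_min hca hcb).trans (concaveOn_leftArgBound.ge_on_segment (mem_Ici.2 ha)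
      (mem_Ici.2 (ha.trans (hat.trans htb))) (by
        rw [segment_eq_Icc (hat.trans htb)]; exact ⟨hat, htb⟩))
  rcases le_total t 4.53 with h | h
  · have h5 := hmin 3.4 4.53 (by norm_num) ht h (Real.pi + 0.2083) h1 (by linarith)
    have hs : 0 ≤ Real.sin (t * Real.log 2) := by
      have := Real.log_two_lt_d9
      have := Real.log_two_gt_d9
      have := Real.pi_gt_d6
      exact Real.sin_nonneg_of_nonneg_of_le_pi (by positivity) (by nlinarith)
    have := argZetaTwo_le_of_sin hs
    linarith
  · have h5 := hmin 4.53 8.7 (by norm_num) h ht' (Real.pi + 0.461) h2 h3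
    have := (abs_le.1 (abs_argZetaTwo_le t)).2
    linarith

theorem zeta_neg_one_add_eq (t : ℝ) : riemannZeta (-1 + t * Complex.I) =
    -((‖riemannZeta (-1 + t * Complex.I)‖ : ℝ) : ℂ) * Complex.exp (leftArg t * Complex.I) := by
  have h := exp_leftLog t
  have h1 : ‖riemannZeta (-1 + t * Complex.I)‖ = Real.exp (leftLog t).re := by
    rw [← h, Complex.norm_exp]
  rw [h1, ← h, Complex.exp_eq_exp_re_mul_sin_add_cos, leftLog_im, Complex.exp_mul_I]
  push_cast
  rw [Complex.cos_add_pi, Complex.sin_add_pi]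
  ring

theorem zeta_neg_one_add_re_im (t : ℝ) :
    (riemannZeta (-1 + t * Complex.I)).re = -(‖riemannZeta (-1 + t * Complex.I)‖ * Real.cos (leftArg t)) ∧
    (riemannZeta (-1 + t * Complex.I)).im = -(‖riemannZeta (-1 + t * Complex.I)‖ * Real.sin (leftArg t)) := by
  have h := zeta_neg_one_add_eq t
  constructor
  · conv_lhs => rw [h]
    rw [neg_mul, Complex.neg_re, Complex.re_ofReal_mul, Complex.exp_ofReal_mul_I_re]
  · conv_lhs => rw [h]
    rw [neg_mul, Complex.neg_im, Complex.im_ofReal_mul, Complex.exp_ofReal_mul_I_im]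

/-- The two kinds of points on `Re s = -1` at which `ζ` is real. -/
theorem zeta_neg_one_add_real {t : ℝ} (ht : 0 < t) (h : (riemannZeta (-1 + t * Complex.I)).im = 0) :
    (t < 3.4 ∧ 0 < (riemannZeta (-1 + t * Complex.I)).re ∧ (riemannZeta (-1 + t * Complex.I)).re < 1) ∨
    (8.7 < t ∧ 1 < |(riemannZeta (-1 + t * Complex.I)).re|) := by
  obtain ⟨h1, h2⟩ := zeta_neg_one_add_re_im t
  have hn : 0 < ‖riemannZeta (-1 + t * Complex.I)‖ := norm_pos_iff.2 (zeta_neg_one_add_ne_zero t)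
  have hs : Real.sin (leftArg t) = 0 := by
    rw [h2, neg_eq_zero, mul_eq_zero] at h
    exact h.resolve_left hn.ne'
  have hlt := leftArg_lt ht
  rcases le_or_gt t 8.7 with h8 | h8
  · rcases lt_or_ge t 3.4 with h3 | h3
    · left
      have hpos := leftArg_pos ht h3.le
      have hF : leftArg t = Real.pi := by
        by_contra hne
        rcases lt_or_gt_of_ne hne with h4 | h4
        · exact (Real.sin_pos_of_pos_of_lt_pi hpos h4).ne' hs
        · have : 0 < Real.sin (leftArg t - Real.pi) :=
            Real.sin_pos_of_pos_of_lt_pi (by linarith) (by linarith)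
          rw [Real.sin_sub_pi, hs] at this
          simp at this
      rw [h1, hF, Real.cos_pi]
      have := norm_zeta_neg_one_add_lt_one ht h3.le
      exact ⟨h3, by linarith, by linarith⟩
    · exfalso
      have h4 := pi_lt_leftArg h3 h8
      have : 0 < Real.sin (leftArg t - Real.pi) :=
        Real.sin_pos_of_pos_of_lt_pi (by linarith) (by linarith)
      rw [Real.sin_sub_pi, hs] at this
      simp at this
  · right
    refine ⟨h8, ?_⟩
    have h3 := one_lt_norm_zeta_neg_one_add h8.le
    have e : ‖riemannZeta (-1 + t * Complex.I)‖ = |(riemannZeta (-1 + t * Complex.I)).re| := by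
      rw [Complex.abs_re_eq_norm.2 h]
    rwa [← e]

/-! ### Real zeros and zeros to the left -/

theorem zeta_ne_zero_of_re_nonpos {s : ℂ} (hs : s.re ≤ 0) (him : s.im ≠ 0) : riemannZeta s ≠ 0 := by
  set w : ℂ := 1 - s with hw
  have hwre : 1 ≤ w.re := by simp [hw]; linarith
  have hwim : w.im ≠ 0 := by simpa [hw] using him
  have hw1 : w ≠ 1 := fun h => hwim (by simp [h])
  rw [show s = 1 - w by rw [hw]; ring, riemannZeta_one_sub (fun n h => hwim (by simp [h])) hw1]
  have h2 : (2 * Real.pi : ℂ) ≠ 0 := by simp [Real.pi_ne_zero]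
  have h3 : Complex.Gamma w ≠ 0 := Complex.Gamma_ne_zero_of_re_pos (by linarith)
  have h4 := riemannZeta_ne_zero_of_one_le_re hwre
  have h5 : (2 * Real.pi : ℂ) ^ (-w) ≠ 0 := by simp [Complex.cpow_eq_zero_iff, Real.pi_ne_zero]
  have hc : Complex.cos (Real.pi * w / 2) ≠ 0 := by
    have him : (Real.pi * w / 2 : ℂ).im ≠ 0 := by
      rw [Complex.div_ofNat_im, Complex.im_ofReal_mul]
      simp [hwim, Real.pi_ne_zero]
    have := sq_norm_cos (Real.pi * w / 2)
    intro h
    rw [h, norm_zero] at this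
    have h6 : 0 < Real.sinh (Real.pi * w / 2 : ℂ).im ^ 2 := by
      have := Real.sinh_ne_zero.2 him
      positivity
    nlinarith [sq_nonneg (Real.cos (Real.pi * w / 2 : ℂ).re)]
  simp [h3, h4, h5, hc]

theorem zeta_ne_zero_of_neg_two_lt {x : ℝ} (h1 : -2 < x) (h2 : x ≤ 0) : riemannZeta x ≠ 0 := by
  rcases eq_or_lt_of_le h2 with rfl | h2
  · simp [riemannZeta_zero]
  rw [show (x : ℂ) = 1 - ((1 - x : ℝ) : ℂ) by push_cast; ring]
  refine zeta_one_sub_ne_zero (by simp; linarith) ?_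
  rw [show (Real.pi * ((1 - x : ℝ) : ℂ) / 2 : ℂ) = ((Real.pi * (1 - x) / 2 : ℝ) : ℂ) by push_cast; ring,
    ← Complex.ofReal_cos]
  have hp := Real.pi_pos
  have : Real.cos (Real.pi * (1 - x) / 2) < 0 :=
    Real.cos_neg_of_pi_div_two_lt_of_lt (by nlinarith) (by nlinarith)
  exact_mod_cast this.ne

/-! ### The Dirichlet eta function and the real zeros of ζ -/

/-- The mean value inequality for x^(-s) on [2n + 1, 2n + 2]: pairing consecutive terms gains one
power of n, so the series converges absolutely, locally uniformly in Re s > 0. -/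
theorem etaTerm_bound {s : ℂ} {δ R : ℝ} (hδ : 0 < δ) (hs : δ < s.re) (hR : ‖s‖ < R) (n : ℕ) :
    ‖((2 * n + 1 : ℝ) : ℂ) ^ (-s) - ((2 * n + 2 : ℝ) : ℂ) ^ (-s)‖ ≤ R * ((n : ℝ) + 1) ^ (-(1 + δ)) := by
  have hpos : ∀ x ∈ Icc (2 * n + 1 : ℝ) (2 * n + 2), (n : ℝ) + 1 ≤ x := fun x hx => by
    have : (0 : ℝ) ≤ n := n.cast_nonneg
    linarith [hx.1]
  have hd : ∀ x ∈ Icc (2 * n + 1 : ℝ) (2 * n + 2),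
      HasDerivWithinAt (fun x : ℝ => (x : ℂ) ^ (-s)) (-s * (x : ℂ) ^ (-s - 1))
        (Icc (2 * n + 1 : ℝ) (2 * n + 2)) x := fun x hx => by
    have hx0 : x ≠ 0 := by have := hpos x hx; have : (0:ℝ) ≤ n := n.cast_nonneg; linarith
    have hs0 : -s ≠ 0 := neg_ne_zero.2 fun h => by simp [h] at hs; linarith
    exact (hasDerivAt_ofReal_cpow_const hx0 hs0).hasDerivWithinAt
  have hn : (0 : ℝ) ≤ n := n.cast_nonneg
  have hb : ∀ x ∈ Icc (2 * n + 1 : ℝ) (2 * n + 2), ‖-s * (x : ℂ) ^ (-s - 1)‖ ≤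
      R * ((n : ℝ) + 1) ^ (-(1 + δ)) := fun x hx => by
    have hx1 := hpos x hx
    have hx0 : 0 < x := by linarith
    rw [norm_mul, norm_neg, Complex.norm_cpow_eq_rpow_re_of_pos hx0]
    have hR0 : 0 ≤ R := (norm_nonneg _).trans hR.le
    refine mul_le_mul hR.le ?_ (by positivity) hR0
    have e : (-s - 1).re ≤ -(1 + δ) := by simp; linarith
    calc x ^ (-s - 1).re ≤ x ^ (-(1 + δ)) := Real.rpow_le_rpow_of_exponent_le (by linarith) e
      _ ≤ _ := Real.rpow_le_rpow_of_nonpos (by linarith) hx1 (by linarith)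
  have := (convex_Icc (2 * n + 1 : ℝ) (2 * n + 2)).norm_image_sub_le_of_norm_hasDerivWithin_le hd hb
    (right_mem_Icc.2 (by linarith)) (left_mem_Icc.2 (by linarith))
  refine this.trans (le_of_eq ?_)
  rw [show (2 * n + 1 - (2 * n + 2) : ℝ) = -1 by ring]; simp

/-- The alternating series of the Dirichlet eta function, summed in pairs. -/
noncomputable def etaSeries (s : ℂ) : ℂ :=
  ∑' n : ℕ, (((2 * n + 1 : ℝ) : ℂ) ^ (-s) - ((2 * n + 2 : ℝ) : ℂ) ^ (-s))

theorem summable_eta_bound {δ : ℝ} (hδ : 0 < δ) (R : ℝ) :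
    Summable fun n : ℕ => R * ((n : ℝ) + 1) ^ (-(1 + δ)) := by
  refine Summable.mul_left _ ?_
  have := (summable_nat_add_iff 1).2 (Real.summable_nat_rpow.2 (show -(1 + δ) < -1 by linarith))
  simpa using this

theorem differentiableOn_etaSeries : DifferentiableOn ℂ etaSeries {s | 0 < s.re} := by
  intro s hs
  have hs : 0 < s.re := hs
  have hU : IsOpen {z : ℂ | s.re / 2 < z.re ∧ ‖z‖ < ‖s‖ + 1} :=
    (isOpen_lt continuous_const Complex.continuous_re).inter (isOpen_lt continuous_norm continuous_const)
  have h := Complex.differentiableOn_tsum_of_summable_norm (summable_eta_bound (half_pos hs) (‖s‖ + 1))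
    (F := fun n : ℕ => fun s : ℂ => (((2 * n + 1 : ℝ) : ℂ) ^ (-s) - ((2 * n + 2 : ℝ) : ℂ) ^ (-s)))
    (fun n => by
      have h1 : ((2 * n + 1 : ℝ) : ℂ) ≠ 0 := by exact_mod_cast (by positivity : (2 * n + 1 : ℝ) ≠ 0)
      have h2 : ((2 * n + 2 : ℝ) : ℂ) ≠ 0 := by exact_mod_cast (by positivity : (2 * n + 2 : ℝ) ≠ 0)
      exact ((differentiable_neg.const_cpow (Or.inl h1)).sub
        (differentiable_neg.const_cpow (Or.inl h2))).differentiableOn) hU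
    (fun n z hz => etaTerm_bound (half_pos hs) hz.1 hz.2 n)
  exact (h.differentiableAt (hU.mem_nhds ⟨by linarith, by linarith⟩)).differentiableWithinAt

theorem etaSeries_eq {s : ℂ} (hs : 1 < s.re) : etaSeries s = (1 - 2 * 2 ^ (-s)) * riemannZeta s := by
  set f : ℕ → ℂ := fun n => 1 / ((n : ℂ) + 1) ^ s with hf
  have hz := zeta_eq_tsum_one_div_nat_add_one_cpow hs
  have hsum : Summable f := by
    have := (summable_nat_add_iff 1).2 (Complex.summable_one_div_nat_cpow.2 hs)
    simpa [hf] using this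
  have he : Summable fun k => f (2 * k) := hsum.comp_injective fun a b h => by simpa using h
  have ho : Summable fun k => f (2 * k + 1) := hsum.comp_injective fun a b h => by simpa using h
  have h1 := tsum_even_add_odd he ho
  have h2 : ∑' k, f (2 * k + 1) = 2 ^ (-s) * riemannZeta s := by
    rw [hz, ← tsum_mul_left]
    refine tsum_congr fun k => ?_
    simp only [hf]
    rw [show (((2 * k + 1 : ℕ) : ℂ) + 1) = ((2 : ℕ) : ℂ) * ((k + 1 : ℕ) : ℂ) by push_cast; ring,
      Complex.natCast_mul_natCast_cpow, Complex.cpow_neg]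
    push_cast
    rw [one_div, one_div, mul_inv]
  have h3 : etaSeries s = ∑' k, f (2 * k) - ∑' k, f (2 * k + 1) := by
    rw [← he.tsum_sub ho, etaSeries]
    refine tsum_congr fun k => ?_
    simp only [hf, Complex.cpow_neg, one_div]
    push_cast
    congr 3; ring
  have h4 : riemannZeta s = ∑' k, f (2 * k) + 2 ^ (-s) * riemannZeta s := by
    rw [← h2, h1]; exact hz
  rw [h3, h2]
  linear_combination -h4

/-- Identity theorem from Re s > 1; the factor s - 1 removes the pole so that both sides are
analytic in the whole half-plane. -/
theorem sub_one_mul_etaSeries {s : ℂ} (hs : 0 < s.re) :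
    (s - 1) * etaSeries s = (1 - 2 * 2 ^ (-s)) * riemannZeta₁ s := by
  have hU : IsOpen {s : ℂ | 0 < s.re} := isOpen_lt continuous_const Complex.continuous_re
  have hpre : IsPreconnected {s : ℂ | 0 < s.re} := (convex_halfSpace_re_gt 0).isPreconnected
  have h1 : AnalyticOnNhd ℂ (fun s => (s - 1) * etaSeries s) {s : ℂ | 0 < s.re} :=
    (((differentiable_id.sub_const 1).differentiableOn).mul differentiableOn_etaSeries).analyticOnNhd hU
  have h2 : AnalyticOnNhd ℂ (fun s : ℂ => (1 - 2 * 2 ^ (-s)) * riemannZeta₁ s) {s : ℂ | 0 < s.re} :=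
    ((((differentiable_neg.const_cpow (Or.inl two_ne_zero)).const_mul 2).const_sub 1).mul
      differentiable_riemannZeta₁).differentiableOn.analyticOnNhd hU
  refine h1.eqOn_of_preconnected_of_eventuallyEq h2 hpre (z₀ := 2) (by simp) ?_ hs
  have : {z : ℂ | 1 < z.re} ∈ 𝓝 (2 : ℂ) :=
    (isOpen_lt continuous_const Complex.continuous_re).mem_nhds (by simp)
  filter_upwards [this] with z hz
  have hz1 : z ≠ 1 := fun h => by rw [h] at hz; simp at hz
  have hz2 : z - 1 ≠ 0 := sub_ne_zero.2 hz1
  rw [etaSeries_eq hz, riemannZeta_eq_inv_sub_mul hz1]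
  field_simp

theorem etaSeries_re_pos {x : ℝ} (hx : 0 < x) : 0 < (etaSeries x).re := by
  have hterm : ∀ n : ℕ, (((2 * n + 1 : ℝ) : ℂ) ^ (-(x : ℂ)) - ((2 * n + 2 : ℝ) : ℂ) ^ (-(x : ℂ))) =
      (((2 * n + 1 : ℝ) ^ (-x) - (2 * n + 2 : ℝ) ^ (-x) : ℝ) : ℂ) := fun n => by
    rw [Complex.ofReal_sub, Complex.ofReal_cpow (by positivity), Complex.ofReal_cpow (by positivity)]
    push_cast; rfl
  have hpos : ∀ n : ℕ, 0 < ((2 * n + 1 : ℝ) ^ (-x) - (2 * n + 2 : ℝ) ^ (-x) : ℝ) := fun n => by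
    rw [sub_pos]
    exact Real.rpow_lt_rpow_of_neg (by positivity) (by linarith) (by linarith)
  have hsum : Summable fun n : ℕ => ((2 * n + 1 : ℝ) ^ (-x) - (2 * n + 2 : ℝ) ^ (-x) : ℝ) := by
    refine Summable.of_norm_bounded (summable_eta_bound (half_pos hx) (‖(x : ℂ)‖ + 1)) fun n => ?_
    rw [← Complex.norm_real, ← hterm]
    exact etaTerm_bound (half_pos hx) (by simp; linarith) (by linarith) n
  rw [etaSeries]
  simp_rw [hterm]
  rw [← Complex.ofReal_tsum, Complex.ofReal_re]
  exact hsum.tsum_pos (fun n => (hpos n).le) 0 (hpos 0)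

/-- `ζ` has no real zero to the right of `-2`. -/
theorem zeta_ne_zero_of_real {x : ℝ} (h : -2 < x) : riemannZeta x ≠ 0 := by
  rcases le_or_gt x 0 with h0 | h0
  · exact zeta_ne_zero_of_neg_two_lt h h0
  rcases le_or_gt 1 x with h1 | h1
  · exact riemannZeta_ne_zero_of_one_le_re (by simpa using h1)
  -- On (0, 1) a zero of ζ would be a zero of the eta function, which is a sum of positive terms
  -- there.
  intro hz
  have hx1 : (x : ℂ) ≠ 1 := by exact_mod_cast h1.ne
  have hx2 : (x : ℂ) - 1 ≠ 0 := sub_ne_zero.2 hx1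
  have e := sub_one_mul_etaSeries (s := x) (by simpa using h0)
  rw [riemannZeta_eq_inv_sub_mul hx1] at hz
  have : riemannZeta₁ x = 0 := by simpa [hx2] using hz
  rw [this, mul_zero] at e
  have h3 : etaSeries x = 0 := by simpa [hx2] using e
  have h4 := etaSeries_re_pos h0
  rw [h3] at h4; simp at h4

/-! ### `ζ` far to the right -/

/-- For n ≥ 3 and σ ≥ 2 one has n^(-σ) ≤ 9 · 3^(-σ) n^(-2), so the tail is at most 9 · 3^(-σ) times
the sum at 2. -/
theorem norm_LSeries_sub_range_three_le {a : ℕ → ℝ} (ha : ∀ n, 0 ≤ a n)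
    (hs2 : LSeriesSummable (fun n => (a n : ℂ)) 2) {s : ℂ} (hs : 2 ≤ s.re) :
    ‖LSeries (fun n => (a n : ℂ)) s - ∑ n ∈ Finset.range 3, LSeries.term (fun n => (a n : ℂ)) s n‖ ≤
      (LSeries (fun n => (a n : ℂ)) 2).re * 9 * (1 / 3) ^ s.re := by
  set f : ℕ → ℂ := fun n => (a n : ℂ)
  have hle : ∀ n, ‖LSeries.term f s n‖ ≤ ‖LSeries.term f 2 n‖ :=
    LSeries.norm_term_le_of_re_le_re f (by simpa using hs)
  have hsum2 : Summable fun n => ‖LSeries.term f 2 n‖ := hs2.norm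
  have hsum : Summable fun n => ‖LSeries.term f s n‖ :=
    hsum2.of_nonneg_of_le (fun _ => norm_nonneg _) hle
  have hre : ∀ n, ‖LSeries.term f 2 n‖ = (LSeries.term f 2 n).re := fun n => by
    rw [LSeries_term_two_eq, Complex.norm_real, Complex.ofReal_re, Real.norm_of_nonneg]
    split_ifs
    · exact le_rfl
    · have := ha n; positivity
  have htot : ∑' n, ‖LSeries.term f 2 n‖ = (LSeries f 2).re := by
    rw [LSeries, Complex.re_tsum hs2]; exact tsum_congr hre
  have hshift := (summable_nat_add_iff 3).2 hsum
  have hshift2 := (summable_nat_add_iff 3).2 hsum2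
  have h1 : LSeries f s - ∑ n ∈ Finset.range 3, LSeries.term f s n = ∑' n, LSeries.term f s (n + 3) := by
    rw [LSeries, ← hsum.of_norm.sum_add_tsum_nat_add 3]; ring
  have hterm : ∀ n, ‖LSeries.term f s (n + 3)‖ ≤ ‖LSeries.term f 2 (n + 3)‖ * (9 * (1 / 3) ^ s.re) := by
    intro n
    rw [LSeries.norm_term_eq, LSeries.norm_term_eq, if_neg (by omega), if_neg (by omega), Complex.re_ofNat,
      Real.rpow_two, div_mul_eq_mul_div, div_le_div_iff₀ (by positivity) (by positivity), mul_assoc]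
    refine mul_le_mul_of_nonneg_left ?_ (norm_nonneg _)
    have hn3 : (3 : ℝ) ≤ ((n + 3 : ℕ) : ℝ) := by push_cast; linarith [(Nat.cast_nonneg n : (0:ℝ) ≤ n)]
    set x : ℝ := ((n + 3 : ℕ) : ℝ)
    have hx : 0 < x := by linarith
    have e1 : x ^ s.re = x ^ 2 * x ^ (s.re - 2) := by
      rw [← Real.rpow_two, ← Real.rpow_add hx]; congr 1; ring
    have e2 : (9 : ℝ) * (1 / 3) ^ s.re = ((3 : ℝ) ^ (s.re - 2))⁻¹ := by
      rw [Real.rpow_sub (by norm_num), one_div, Real.inv_rpow (by norm_num), Real.rpow_two]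
      field_simp; norm_num
    rw [e1, e2, mul_comm, mul_assoc]
    have h3 : (3 : ℝ) ^ (s.re - 2) ≤ x ^ (s.re - 2) := Real.rpow_le_rpow (by norm_num) hn3 (by linarith)
    have h4 : 0 < (3 : ℝ) ^ (s.re - 2) := by positivity
    have h5 : 1 ≤ ((3 : ℝ) ^ (s.re - 2))⁻¹ * x ^ (s.re - 2) := by
      rw [inv_mul_eq_div, le_div_iff₀ h4]; linarith
    nlinarith [sq_pos_of_pos hx]
  rw [h1]
  calc _ ≤ ∑' n, ‖LSeries.term f s (n + 3)‖ := norm_tsum_le_tsum_norm hshift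
    _ ≤ ∑' n, ‖LSeries.term f 2 (n + 3)‖ * (9 * (1 / 3) ^ s.re) :=
      hshift.tsum_le_tsum hterm (hshift2.mul_right _)
    _ = (∑' n, ‖LSeries.term f 2 (n + 3)‖) * (9 * (1 / 3) ^ s.re) := tsum_mul_right
    _ ≤ (LSeries f 2).re * (9 * (1 / 3) ^ s.re) := by
      rw [← htot, ← hsum2.sum_add_tsum_nat_add 3]
      gcongr
      have : 0 ≤ ∑ n ∈ Finset.range 3, ‖LSeries.term f 2 n‖ := by positivity
      linarith
    _ = _ := by ring

theorem exists_zeta_right_bound : ∃ C : ℝ, 0 ≤ C ∧ ∀ s : ℂ, 2 ≤ s.re →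
    ‖riemannZeta s - 1 - 2 ^ (-s)‖ ≤ C * (1 / 3) ^ s.re ∧
    ‖deriv riemannZeta s + Real.log 2 * 2 ^ (-s)‖ ≤ C * (1 / 3) ^ s.re := by
  have habs : ∀ s : ℂ, 2 ≤ s.re → LSeries.abscissaOfAbsConv (1 : ℕ → ℂ) < (s.re : EReal) := fun s hs => by
    rw [LSeries.abscissaOfAbsConv_one]; exact_mod_cast (by linarith : (1 : ℝ) < s.re)
  have elog : LSeries.logMul 1 = fun n : ℕ => ((Real.log n : ℝ) : ℂ) := by
    ext m; simp [LSeries.logMul, Complex.natCast_log]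
  have e1 : (1 : ℕ → ℂ) = fun _ => ((1 : ℝ) : ℂ) := by ext; simp
  have s1 : LSeriesSummable (fun _ : ℕ => ((1 : ℝ) : ℂ)) 2 := by
    rw [← e1]; exact (LSeriesSummable_one_iff (s := 2)).2 (by norm_num)
  have s2 : LSeriesSummable (fun n : ℕ => ((Real.log n : ℝ) : ℂ)) 2 := by
    rw [← elog]; exact LSeriesSummable_logMul_of_lt_re (habs 2 (by simp))
  set C1 := (LSeries (fun _ : ℕ => ((1 : ℝ) : ℂ)) 2).re * 9
  set C2 := (LSeries (fun n : ℕ => ((Real.log n : ℝ) : ℂ)) 2).re * 9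
  refine ⟨max 0 (max C1 C2), le_max_left _ _, fun s hs => ⟨?_, ?_⟩⟩
  · have h := norm_LSeries_sub_range_three_le (fun _ => zero_le_one) s1 hs
    rw [← e1, LSeries_one_eq_riemannZeta (by linarith), Finset.sum_range_succ, Finset.sum_range_succ,
      Finset.sum_range_succ, Finset.sum_range_zero] at h
    have e : riemannZeta s - 1 - 2 ^ (-s) = riemannZeta s - (0 + LSeries.term 1 s 0 + LSeries.term 1 s 1
        + LSeries.term 1 s 2) := by
      rw [LSeries.term_def, LSeries.term_def, LSeries.term_def]; simp [Complex.cpow_neg]; ring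
    rw [e]
    refine h.trans ?_
    gcongr
    exact (le_max_left C1 C2).trans (le_max_right _ _)
  · have h := norm_LSeries_sub_range_three_le (a := fun n => Real.log n)
      (fun n => Real.log_natCast_nonneg n) s2 hs
    have hd : deriv riemannZeta s = -LSeries (fun n : ℕ => ((Real.log n : ℝ) : ℂ)) s := by
      have hev : riemannZeta =ᶠ[𝓝 s] LSeries 1 := by
        have : {s : ℂ | 1 < s.re} ∈ 𝓝 s :=
          (isOpen_lt continuous_const Complex.continuous_re).mem_nhds (by simp; linarith)
        filter_upwards [this] with s hs using (LSeries_one_eq_riemannZeta hs).symm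
      rw [hev.deriv_eq, LSeries_deriv (habs s hs), elog]
    rw [Finset.sum_range_succ, Finset.sum_range_succ,
      Finset.sum_range_succ, Finset.sum_range_zero] at h
    set f := fun n : ℕ => ((Real.log n : ℝ) : ℂ)
    have e : deriv riemannZeta s + Real.log 2 * 2 ^ (-s) =
        -(LSeries f s - (0 + LSeries.term f s 0 + LSeries.term f s 1 + LSeries.term f s 2)) := by
      rw [hd, LSeries.term_def, LSeries.term_def, LSeries.term_def]
      simp [f, Complex.cpow_neg, div_eq_mul_inv]; ring
    rw [e, norm_neg]
    refine h.trans ?_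
    gcongr
    exact (le_max_right C1 C2).trans (le_max_right _ _)

/-- The error 3^(-σ) relative to the term 2^(-s) is (2/3)^σ, hence eventually below any η. -/
theorem exists_zeta_right_asymp {η : ℝ} (hη : 0 < η) : ∃ M : ℝ, 2 ≤ M ∧ ∀ s : ℂ, M ≤ s.re →
    ∃ a b : ℂ, ‖a‖ ≤ η ∧ ‖b‖ ≤ η ∧ riemannZeta s = 1 + 2 ^ (-s) * (1 + a) ∧
      deriv riemannZeta s = -(2 ^ (-s) * (Real.log 2 + b)) := by
  obtain ⟨C, hC, h⟩ := exists_zeta_right_bound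
  have hlim := (tendsto_rpow_atTop_of_base_lt_one (2 / 3) (by norm_num) (by norm_num)).const_mul C
  rw [mul_zero] at hlim
  obtain ⟨M, hM⟩ := eventually_atTop.1 (hlim.eventually (gt_mem_nhds hη))
  refine ⟨max 2 M, le_max_left _ _, fun s hs => ?_⟩
  have hs2 : 2 ≤ s.re := (le_max_left _ _).trans hs
  have hsM := (hM s.re ((le_max_right _ _).trans hs)).le
  obtain ⟨h1, h2⟩ := h s hs2
  have h0 : (2 : ℂ) ^ (-s) ≠ 0 := by simp [Complex.cpow_eq_zero_iff]
  have hn : ‖(2 : ℂ) ^ (-s)‖ = (1 / 2) ^ s.re := by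
    have := Complex.norm_cpow_eq_rpow_re_of_pos (x := 2) (by norm_num) (-s)
    push_cast at this
    rw [this, Complex.neg_re, Real.rpow_neg (by norm_num), one_div, Real.inv_rpow (by norm_num)]
  have key : ∀ z : ℂ, ‖z‖ ≤ C * (1 / 3) ^ s.re → ‖z / 2 ^ (-s)‖ ≤ η := fun z hz => by
    rw [norm_div, hn, div_le_iff₀ (by positivity)]
    refine hz.trans ?_
    have e : (1 / 3 : ℝ) ^ s.re = (2 / 3) ^ s.re * (1 / 2) ^ s.re := by
      rw [← Real.mul_rpow (by norm_num) (by norm_num)]; norm_num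
    rw [e, ← mul_assoc]
    gcongr
  refine ⟨_, _, key _ h1, key _ ((norm_neg _).trans_le h2), ?_, ?_⟩
  · field_simp; ring
  · field_simp; ring

/-- The quotient tends to -1/log 2. Along a curve with ζ = 1 + εy it equals y times the velocity, so
its sign says that the curve moves to the left. -/
theorem exists_zeta_right_monotone : ∃ M : ℝ, 2 ≤ M ∧ ∀ s : ℂ, M ≤ s.re →
    ((riemannZeta s - 1) / deriv riemannZeta s).re < 0 := by
  obtain ⟨M, hM2, hM⟩ := exists_zeta_right_asymp (η := 1 / 10) (by norm_num)
  refine ⟨M, hM2, fun s hs => ?_⟩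
  obtain ⟨a, b, ha, hb, e1, e2⟩ := hM s hs
  have h0 : (2 : ℂ) ^ (-s) ≠ 0 := by simp [Complex.cpow_eq_zero_iff]
  have l1 := Real.log_two_gt_d9
  have l2 := Real.log_two_lt_d9
  have a1 := abs_le.1 ((Complex.abs_re_le_norm a).trans ha)
  have a2 := abs_le.1 ((Complex.abs_im_le_norm a).trans ha)
  have b1 := abs_le.1 ((Complex.abs_re_le_norm b).trans hb)
  have b2 := abs_le.1 ((Complex.abs_im_le_norm b).trans hb)
  have e : (riemannZeta s - 1) / deriv riemannZeta s = -((1 + a) / (Real.log 2 + b)) := by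
    rw [e1, e2, add_sub_cancel_left, div_neg, mul_div_mul_left _ _ h0]
  rw [e, Complex.neg_re, neg_lt_zero, Complex.div_re, ← add_div]
  refine div_pos ?_ (Complex.normSq_pos.2 fun h => ?_)
  · simp only [Complex.add_re, Complex.add_im, Complex.one_re, Complex.one_im, Complex.ofReal_re,
      Complex.ofReal_im, zero_add]
    nlinarith
  · have := congrArg Complex.re h
    simp only [Complex.add_re, Complex.ofReal_re, Complex.zero_re] at this
    linarith

theorem exists_norm_zeta_sub_one_lt {η : ℝ} (hη : 0 < η) : ∃ M : ℝ, ∀ s : ℂ, M ≤ s.re →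
    ‖riemannZeta s - 1‖ < η := by
  obtain ⟨M, hM2, hM⟩ := exists_zeta_right_asymp (η := 1) (by norm_num)
  have hlim := (tendsto_rpow_atTop_of_base_lt_one (1 / 2) (by norm_num) (by norm_num)).const_mul 2
  rw [mul_zero] at hlim
  obtain ⟨M', hM'⟩ := eventually_atTop.1 (hlim.eventually (gt_mem_nhds hη))
  refine ⟨max M M', fun s hs => ?_⟩
  obtain ⟨a, b, ha, -, e1, -⟩ := hM s ((le_max_left _ _).trans hs)
  have hn : ‖(2 : ℂ) ^ (-s)‖ = (1 / 2) ^ s.re := by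
    have := Complex.norm_cpow_eq_rpow_re_of_pos (x := 2) (by norm_num) (-s)
    push_cast at this
    rw [this, Complex.neg_re, Real.rpow_neg (by norm_num), one_div, Real.inv_rpow (by norm_num)]
  rw [e1, add_sub_cancel_left, norm_mul, hn]
  have h1 : ‖1 + a‖ ≤ 2 := (norm_add_le _ _).trans (by rw [norm_one]; linarith)
  have h2 := hM' s.re ((le_max_right _ _).trans hs)
  have : 0 < (1 / 2 : ℝ) ^ s.re := by positivity
  nlinarith

/-! ### Local inverses -/

theorem exists_local_inverse {f : ℂ → ℂ} {f' p : ℂ} (hf : HasStrictDerivAt f f' p) (hf' : f' ≠ 0)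
    {V : Set ℂ} (hV : V ∈ 𝓝 p) : ∃ r > 0, ∃ U : Set ℂ, IsOpen U ∧ p ∈ U ∧ U ⊆ V ∧ ∃ μ : ℂ → ℂ,
      MapsTo f U (Metric.ball (f p) r) ∧ MapsTo μ (Metric.ball (f p) r) U ∧ (∀ s ∈ U, μ (f s) = s) ∧
      (∀ w ∈ Metric.ball (f p) r, f (μ w) = w) ∧ ContinuousOn μ (Metric.ball (f p) r) ∧
      HasDerivAt μ f'⁻¹ (f p) := by
  set e := (hf.hasStrictFDerivAt_equiv hf').toOpenPartialHomeomorph f with he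
  have hco : ⇑e = f := HasStrictFDerivAt.toOpenPartialHomeomorph_coe _
  have hps : p ∈ e.source := HasStrictFDerivAt.mem_toOpenPartialHomeomorph_source _
  have hW : IsOpen (e '' (e.source ∩ interior V)) :=
    e.isOpen_image_of_subset_source (e.open_source.inter isOpen_interior) inter_subset_left
  have hpW : f p ∈ e '' (e.source ∩ interior V) := by
    rw [← hco]; exact mem_image_of_mem _ ⟨hps, mem_interior_iff_mem_nhds.2 hV⟩
  obtain ⟨r, hr, hrW⟩ := Metric.isOpen_iff.1 hW _ hpW
  have htar : Metric.ball (f p) r ⊆ e.target := fun w hw => by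
    obtain ⟨s, hs, rfl⟩ := hrW hw
    exact e.map_source hs.1
  refine ⟨r, hr, e.source ∩ e ⁻¹' Metric.ball (f p) r, e.isOpen_inter_preimage Metric.isOpen_ball,
    ⟨hps, by rw [mem_preimage, hco]; exact Metric.mem_ball_self hr⟩, ?_, e.symm, ?_, ?_, ?_, ?_, ?_, ?_⟩
  · rintro s ⟨hs, hsb⟩
    obtain ⟨s', hs', h⟩ := hrW hsb
    rw [← e.injOn hs'.1 hs h]
    exact interior_subset hs'.2
  · rintro s ⟨hs, hsb⟩; rw [mem_preimage, hco] at hsb; exact hsb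
  · intro w hw
    refine ⟨e.map_target (htar hw), ?_⟩
    rw [mem_preimage, e.right_inv (htar hw)]; exact hw
  · intro s hs; rw [← hco]; exact e.left_inv hs.1
  · intro w hw; rw [← hco]; exact e.right_inv (htar hw)
  · exact e.continuousOn_symm.mono htar
  · exact (hf.to_localInverse hf').hasDerivAt

theorem hasStrictDerivAt_riemannZeta {s : ℂ} (hs : s ≠ 1) :
    HasStrictDerivAt riemannZeta (deriv riemannZeta s) s := by
  have h : DifferentiableOn ℂ riemannZeta {1}ᶜ := fun z hz =>
    (differentiableAt_riemannZeta hz).differentiableWithinAt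
  exact (h.analyticAt (isOpen_compl_singleton.mem_nhds hs)).hasStrictDerivAt

/-! ### The structure of a parallel line -/

theorem IsParallelLine.subset {L : Set ℂ} (hL : IsParallelLine L) : L ⊆ zetaRealSet := by
  obtain ⟨s, -, rfl⟩ := hL.isComponent
  exact connectedComponentIn_subset _ _

theorem IsParallelLine.isPreconnected {L : Set ℂ} (hL : IsParallelLine L) : IsPreconnected L := by
  obtain ⟨s, -, rfl⟩ := hL.isComponent
  exact isPreconnected_connectedComponentIn

theorem IsParallelLine.subset_of_isPreconnected {L : Set ℂ} (hL : IsParallelLine L) {S : Set ℂ}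
    (hS : IsPreconnected S) (hsub : S ⊆ zetaRealSet) {p : ℂ} (hp : p ∈ S) (hpL : p ∈ L) : S ⊆ L := by
  obtain ⟨s, -, rfl⟩ := hL.isComponent
  rw [connectedComponentIn_eq hpL]
  exact hS.subset_connectedComponentIn hp hsub

theorem isPreconnected_real_ball (c : ℂ) (r : ℝ) : IsPreconnected (Metric.ball c r ∩ {w : ℂ | w.im = 0}) :=
  ((convex_ball c r).inter (convex_hyperplane (Complex.imLm.isLinear) 0)).isPreconnected

/-- Near a point of the line, `ζ` is a homeomorphism under which the line corresponds to the
real axis. -/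
theorem IsParallelLine.exists_chart {L : Set ℂ} (hL : IsParallelLine L) {p : ℂ} (hp : p ∈ L)
    {V : Set ℂ} (hV : V ∈ 𝓝 p) : ∃ r > 0, ∃ U : Set ℂ, IsOpen U ∧ p ∈ U ∧ U ⊆ V ∧ ∃ μ : ℂ → ℂ,
      MapsTo riemannZeta U (Metric.ball (riemannZeta p) r) ∧
      MapsTo μ (Metric.ball (riemannZeta p) r) U ∧ (∀ s ∈ U, μ (riemannZeta s) = s) ∧
      (∀ w ∈ Metric.ball (riemannZeta p) r, riemannZeta (μ w) = w) ∧
      ContinuousOn μ (Metric.ball (riemannZeta p) r) ∧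
      HasDerivAt μ (deriv riemannZeta p)⁻¹ (riemannZeta p) ∧
      (∀ s ∈ U, s ∈ L ↔ (riemannZeta s).im = 0) ∧ (1 : ℂ) ∉ U := by
  have hp1 := hL.subset hp
  obtain ⟨r, hr, U, hU, hpU, hUV, μ, h1, h2, h3, h4, h5, h6⟩ :=
    exists_local_inverse (hasStrictDerivAt_riemannZeta hp1.1) (hL.deriv_ne_zero p hp)
      (inter_mem hV (isOpen_compl_singleton.mem_nhds hp1.1))
  have hsub : μ '' (Metric.ball (riemannZeta p) r ∩ {w : ℂ | w.im = 0}) ⊆ L := by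
    refine hL.subset_of_isPreconnected ((isPreconnected_real_ball _ _).image _ (h5.mono inter_subset_left))
      ?_ ⟨riemannZeta p, ⟨Metric.mem_ball_self hr, hp1.2⟩, h3 p hpU⟩ hp
    rintro _ ⟨w, ⟨hw, hw0⟩, rfl⟩
    exact ⟨(hUV (h2 hw)).2, by rw [h4 w hw]; exact hw0⟩
  refine ⟨r, hr, U, hU, hpU, fun s hs => (hUV hs).1, μ, h1, h2, h3, h4, h5, h6, fun s hs => ⟨fun h =>
    (hL.subset h).2, fun h => ?_⟩, fun h => (hUV h).2 rfl⟩
  rw [← h3 s hs]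
  exact hsub (mem_image_of_mem _ ⟨h1 hs, h⟩)

/-- The charts show that ζ, as a real function on the line, is open and injective on connected open
neighbourhoods; the topological lemma on open maps to ℝ then makes it injective. -/
theorem IsParallelLine.injOn {L : Set ℂ} (hL : IsParallelLine L) :
    InjOn (fun s => (riemannZeta s).re) L ∧ IsOpen ((fun s => (riemannZeta s).re) '' L) := by
  obtain ⟨s₀, hs₀, -⟩ := hL.comesFromRight 0
  have : ConnectedSpace L := isConnected_iff_connectedSpace.1 ⟨⟨s₀, hs₀⟩, hL.isPreconnected⟩
  set g : L → ℝ := fun s => (riemannZeta s).re with hg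
  have hc : Continuous g := by
    refine Complex.continuous_re.comp (continuous_iff_continuousAt.2 fun s => ?_)
    exact ((differentiableAt_riemannZeta (hL.subset s.2).1).continuousAt).comp continuous_subtype_val.continuousAt
  have hball : ∀ (p : ℂ) (r y : ℝ), (riemannZeta p).im = 0 → y ∈ Metric.ball (riemannZeta p).re r →
      (y : ℂ) ∈ Metric.ball (riemannZeta p) r := fun p r y hp hy => by
    have e : riemannZeta p = ((riemannZeta p).re : ℂ) := Complex.ext (by simp) (by simp [hp])
    rw [e, Metric.mem_ball, Complex.dist_of_im_eq (by simp)]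
    simpa using hy
  have ho : IsOpenMap g := by
    rw [isOpenMap_iff_nhds_le]
    rintro x S hS
    obtain ⟨V, hV, hVS⟩ := (mem_nhds_subtype _ _ _).1 (mem_map.1 hS)
    obtain ⟨r, hr, U, hU, hpU, hUV, μ, h1, h2, h3, h4, h5, h6, h7, -⟩ := hL.exists_chart x.2 hV
    filter_upwards [Metric.ball_mem_nhds (g x) hr] with y hy
    have hy' := hball x r y (hL.subset x.2).2 hy
    have hyL : μ y ∈ L := (h7 _ (h2 hy')).2 (by rw [h4 _ hy']; simp)
    have : (⟨μ y, hyL⟩ : L) ∈ g ⁻¹' S := hVS (hUV (h2 hy'))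
    simpa [g, h4 _ hy'] using this
  have hinj : Function.Injective g := by
    refine injective_of_isOpenMap_of_locally hc ho fun x => ?_
    obtain ⟨r, hr, U, hU, hpU, hUV, μ, h1, h2, h3, h4, h5, h6, h7, -⟩ := hL.exists_chart x.2 univ_mem
    refine ⟨Subtype.val ⁻¹' U, hU.preimage continuous_subtype_val, ?_, hpU, ?_⟩
    · rw [← Topology.IsInducing.subtypeVal.isPreconnected_image]
      have : Subtype.val '' (Subtype.val ⁻¹' U : Set L) =
          μ '' (Metric.ball (riemannZeta x) r ∩ {w : ℂ | w.im = 0}) := by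
        ext s
        simp only [Subtype.image_preimage_coe]
        constructor
        · rintro ⟨hsL, hsU⟩
          exact ⟨riemannZeta s, ⟨h1 hsU, (h7 s hsU).1 hsL⟩, h3 s hsU⟩
        · rintro ⟨w, ⟨hw, hw0⟩, rfl⟩
          exact ⟨(h7 _ (h2 hw)).2 (by rw [h4 w hw]; exact hw0), h2 hw⟩
      rw [this]
      exact (isPreconnected_real_ball _ _).image _ (h5.mono inter_subset_left)
    · intro a ha b hb hab
      have : riemannZeta a = riemannZeta b :=
        Complex.ext hab (by rw [(hL.subset a.2).2, (hL.subset b.2).2])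
      refine Subtype.ext ?_
      rw [← h3 a ha, ← h3 b hb, this]
  refine ⟨injOn_iff_injective.2 hinj, ?_⟩
  have := ho.isOpen_range
  convert this using 1
  ext y; simp [g]

theorem IsParallelLine.eq_of_zeta_eq {L : Set ℂ} (hL : IsParallelLine L) {a b : ℂ} (ha : a ∈ L)
    (hb : b ∈ L) (h : riemannZeta a = riemannZeta b) : a = b :=
  hL.injOn.1 ha hb (by simp only [h])

/-- Along the right end of the line ζ tends to 1. If 1 were the value at p, the values far to the
right would also be taken on the line near p, against injectivity. -/
theorem IsParallelLine.zeta_ne_one {L : Set ℂ} (hL : IsParallelLine L) {p : ℂ} (hp : p ∈ L) :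
    riemannZeta p ≠ 1 := by
  intro h1p
  have hV : {s : ℂ | s.re < p.re + 1} ∈ 𝓝 p :=
    (isOpen_lt Complex.continuous_re continuous_const).mem_nhds (by simp)
  obtain ⟨r, hr, U, hU, hpU, hUV, μ, h1, h2, h3, h4, h5, h6, h7, -⟩ := hL.exists_chart hp hV
  obtain ⟨M, hM⟩ := exists_norm_zeta_sub_one_lt hr
  obtain ⟨s, hs, hsM⟩ := hL.comesFromRight (max M (p.re + 1))
  have hsb : riemannZeta s ∈ Metric.ball (riemannZeta p) r := by
    rw [h1p, Metric.mem_ball, dist_eq_norm]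
    exact hM s ((le_max_left _ _).trans hsM.le)
  have hL' : μ (riemannZeta s) ∈ L := (h7 _ (h2 hsb)).2 (by rw [h4 _ hsb]; exact (hL.subset hs).2)
  have := hL.eq_of_zeta_eq hs hL' (h4 _ hsb).symm
  have h8 : s.re < p.re + 1 := this ▸ hUV (h2 hsb)
  linarith [(le_max_right M (p.re + 1)).trans_lt hsM]

theorem zeta_ofReal_im (x : ℝ) : (riemannZeta x).im = 0 := by
  have := riemannZeta_conj x
  rw [Complex.conj_ofReal] at this
  exact Complex.conj_eq_iff_im.1 this.symm

theorem IsParallelLine.continuousOn_re {L : Set ℂ} (hL : IsParallelLine L) :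
    ContinuousOn (fun s => (riemannZeta s).re) L := fun _ hs =>
  (Complex.continuous_re.continuousAt.comp
    (differentiableAt_riemannZeta (hL.subset hs).1).continuousAt).continuousWithinAt

/-- A line meeting the real axis contains (-∞, 1) or (1, ∞). The first holds the two zeros -2 and
-4, against injectivity. On the second ζ runs from +∞ down to 1: if ζ(p) > 1, that value is taken
again on the axis, and if ζ(p) < 1, connectedness forces the omitted value 1. -/
theorem IsParallelLine.im_ne_zero {L : Set ℂ} (hL : IsParallelLine L) {p : ℂ} (hp : p ∈ L)
    (hpim : p.im ≠ 0) {s : ℂ} (hs : s ∈ L) : s.im ≠ 0 := by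
  intro him
  obtain ⟨x, rfl⟩ : ∃ x : ℝ, s = x := ⟨s.re, Complex.ext rfl (by simpa using him)⟩
  have hx1 : x ≠ 1 := fun h => (hL.subset hs).1 (by simp [h])
  have hsub : ∀ I : Set ℝ, IsPreconnected I → (1 : ℝ) ∉ I → x ∈ I → ∀ y ∈ I, (y : ℂ) ∈ L := by
    intro I hI h1 hx y hy
    refine hL.subset_of_isPreconnected (hI.image _ Complex.continuous_ofReal.continuousOn) ?_
      (mem_image_of_mem _ hx) hs (mem_image_of_mem _ hy)
    rintro _ ⟨z, hz, rfl⟩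
    exact ⟨fun h => h1 (by rwa [← (by exact_mod_cast h : z = 1)]), zeta_ofReal_im z⟩
  rcases lt_or_gt_of_ne hx1 with hx | hx
  · have h := hsub (Iio 1) isPreconnected_Iio (by simp) hx
    have h2 := h (-2) (by norm_num [mem_Iio])
    have h4 := h (-4) (by norm_num [mem_Iio])
    have z2 : riemannZeta ((-2 : ℝ) : ℂ) = 0 := by
      have := riemannZeta_neg_two_mul_nat_add_one 0
      push_cast at this ⊢; convert this using 2; norm_num
    have z4 : riemannZeta ((-4 : ℝ) : ℂ) = 0 := by
      have := riemannZeta_neg_two_mul_nat_add_one 1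
      push_cast at this ⊢; convert this using 2; norm_num
    have := hL.eq_of_zeta_eq h2 h4 (by rw [z2, z4])
    norm_num [Complex.ext_iff] at this
  · have h := hsub (Ioi 1) isPreconnected_Ioi (by simp) hx
    have hcont : ContinuousOn (fun y : ℝ => (riemannZeta y).re) (Ioi 1) :=
      hL.continuousOn_re.comp Complex.continuous_ofReal.continuousOn h
    set v := (riemannZeta p).re with hv
    have hv1 : v ≠ 1 := fun h1 => hL.zeta_ne_one hp (Complex.ext h1 (by simp [(hL.subset hp).2]))
    have hbig : ∃ y > 1, v < (riemannZeta (y : ℝ)).re ∧ 1 < (riemannZeta (y : ℝ)).re := by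
      have hlim : Tendsto (fun y : ℝ => (((y : ℂ) - 1) * riemannZeta y).re) (𝓝[>] 1) (𝓝 1) := by
        have h1 : Tendsto (fun y : ℝ => (y : ℂ)) (𝓝[>] 1) (𝓝[≠] 1) := by
          refine tendsto_nhdsWithin_iff.2 ⟨?_, ?_⟩
          · have : Tendsto (fun y : ℝ => (y : ℂ)) (𝓝 1) (𝓝 ((1 : ℝ) : ℂ)) :=
              Complex.continuous_ofReal.tendsto 1
            rw [Complex.ofReal_one] at this
            exact this.mono_left nhdsWithin_le_nhds
          · filter_upwards [self_mem_nhdsWithin] with y hy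
            have : (1 : ℝ) < y := hy
            simp only [mem_compl_iff, mem_singleton_iff]
            exact_mod_cast this.ne'
        have := (Complex.continuous_re.tendsto 1).comp (riemannZeta_residue_one.comp h1)
        rw [Complex.one_re] at this
        exact this
      have h2 : Tendsto (fun y : ℝ => (y - 1) * (|v| + 1)) (𝓝[>] 1) (𝓝 0) := by
        have : Continuous fun y : ℝ => (y - 1) * (|v| + 1) := by fun_prop
        have h3 := this.tendsto 1
        simp only [sub_self, zero_mul] at h3
        exact h3.mono_left nhdsWithin_le_nhds
      obtain ⟨y, hy1, hy2, hy3⟩ := ((hlim.eventually (lt_mem_nhds (show (1 / 2 : ℝ) < 1 by norm_num))).and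
        ((h2.eventually (gt_mem_nhds (show (0 : ℝ) < 1 / 2 by norm_num))).and self_mem_nhdsWithin)).exists
      have hy3 : (1 : ℝ) < y := hy3
      have e : (((y : ℂ) - 1) * riemannZeta y).re = (y - 1) * (riemannZeta y).re := by
        rw [← Complex.ofReal_one, ← Complex.ofReal_sub, Complex.re_ofReal_mul]
      rw [e] at hy1
      have h4 : |v| + 1 < (riemannZeta y).re := by
        refine lt_of_mul_lt_mul_left (hy2.trans hy1) (by linarith)
      exact ⟨y, hy3, by linarith [le_abs_self v], by linarith [abs_nonneg v]⟩
    obtain ⟨y, hy, hvy, h1y⟩ := hbig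
    rcases lt_or_gt_of_ne hv1 with hlt | hgt
    · obtain ⟨s, hsL, hs1⟩ := (hL.isPreconnected.image _ hL.continuousOn_re).ordConnected.out
        (mem_image_of_mem _ hp) (mem_image_of_mem _ (h y hy)) ⟨hlt.le, h1y.le⟩
      exact hL.zeta_ne_one hsL (Complex.ext hs1 (by simp [(hL.subset hsL).2]))
    · obtain ⟨M, hM⟩ := exists_norm_zeta_sub_one_lt (sub_pos.2 hgt)
      set y' := max M 2
      have hy' : y' ∈ Ioi (1 : ℝ) := mem_Ioi.2 (lt_of_lt_of_le one_lt_two (le_max_right M 2))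
      have h5 : (riemannZeta y').re < v := by
        have := (Complex.re_le_norm _).trans_lt (hM y' (by simp [y']))
        simp at this; linarith
      obtain ⟨z, hz, hzv⟩ := (isPreconnected_Ioi.image _ hcont).ordConnected.out
        (mem_image_of_mem _ hy') (mem_image_of_mem _ (show y ∈ Ioi (1 : ℝ) from hy)) ⟨h5.le, hvy.le⟩
      have := hL.injOn.1 (h z hz) hp hzv
      exact hpim (by rw [← this]; simp)

theorem IsParallelLine.im_pos {L : Set ℂ} (hL : IsParallelLine L) {p : ℂ} (hp : p ∈ L)
    (hpim : 0 < p.im) {s : ℂ} (hs : s ∈ L) : 0 < s.im := by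
  by_contra! h
  obtain ⟨z, hz, hz0⟩ := (hL.isPreconnected.image _ Complex.continuous_im.continuousOn).ordConnected.out
    (mem_image_of_mem _ hs) (mem_image_of_mem _ hp) ⟨h, hpim.le⟩
  exact hL.im_ne_zero hp hpim.ne' hz hz0

/-- Near the pole `ζ` is real only on the real axis. -/
theorem zeta_real_near_one : ∀ᶠ s in 𝓝 (1 : ℂ), (riemannZeta s).im = 0 → s ≠ 1 → s.im = 0 := by
  -- This is 1/ζ continued to the pole, with derivative 1 there, hence injective near 1. It commutes
  -- with conjugation, so where its value is real s equals its own conjugate.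
  set F : ℂ → ℂ := fun s => (s - 1) / riemannZeta₁ s with hF
  have hz1 : riemannZeta₁ 1 ≠ 0 := by rw [riemannZeta₁_one]; exact one_ne_zero
  have hFa : AnalyticAt ℂ F 1 :=
    (analyticAt_id.sub analyticAt_const).div (differentiable_riemannZeta₁.analyticAt 1) hz1
  have hd : HasDerivAt F 1 1 := by
    have := ((hasDerivAt_id (1 : ℂ)).sub_const 1).div (differentiable_riemannZeta₁ 1).hasDerivAt hz1
    refine this.congr_deriv ?_
    simp [riemannZeta₁_one]
  have hstrict : HasStrictDerivAt F 1 1 := by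
    have := hFa.hasStrictDerivAt; rwa [hd.deriv] at this
  obtain ⟨r, hr, U, hU, h1U, -, μ, -, -, h3, -⟩ := exists_local_inverse hstrict one_ne_zero univ_mem
  have hUc : ∀ᶠ s in 𝓝 (1 : ℂ), starRingEnd ℂ s ∈ U := by
    have : Tendsto (starRingEnd ℂ) (𝓝 1) (𝓝 1) := by
      have := Complex.continuous_conj.tendsto 1; rwa [map_one] at this
    exact this.eventually (hU.mem_nhds h1U)
  filter_upwards [hU.mem_nhds h1U, hUc] with s hs hsc him hs1
  have e : ∀ z : ℂ, z ≠ 1 → F z = (riemannZeta z)⁻¹ := fun z hz => by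
    have : z - 1 ≠ 0 := sub_ne_zero.2 hz
    rw [hF, riemannZeta_eq_inv_sub_mul hz]; simp [div_eq_mul_inv, mul_comm]
  have hsc1 : starRingEnd ℂ s ≠ 1 := fun h => hs1 (by
    have := congrArg (starRingEnd ℂ) h; simpa using this)
  have h4 : F (starRingEnd ℂ s) = F s := by
    rw [e _ hs1, e _ hsc1, riemannZeta_conj, Complex.conj_eq_iff_im.2 him]
  have := h3 _ hsc
  rw [h4, h3 _ hs] at this
  exact Complex.conj_eq_iff_im.1 this.symm

/-- The pole is not a limit point, because near it ζ is real only on the real axis. At any other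
limit point ζ is real by continuity, and adding the point keeps the component connected. -/
theorem IsParallelLine.isClosed {L : Set ℂ} (hL : IsParallelLine L) {p : ℂ} (hp : p ∈ L)
    (hpim : p.im ≠ 0) : IsClosed L := by
  refine isClosed_of_closure_subset fun q hq => ?_
  have hq1 : q ≠ 1 := by
    rintro rfl
    obtain ⟨s, hs, hsL⟩ := mem_closure_iff_nhds.1 hq _ zeta_real_near_one
    exact hL.im_ne_zero hp hpim hsL (hs (hL.subset hsL).2 (hL.subset hsL).1)
  have hqim : (riemannZeta q).im = 0 := by
    have hc : ContinuousAt (fun s => (riemannZeta s).im) q :=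
      Complex.continuous_im.continuousAt.comp (differentiableAt_riemannZeta hq1).continuousAt
    have := hc.continuousWithinAt (s := L) |>.mem_closure_image hq
    have h2 : (fun s => (riemannZeta s).im) '' L ⊆ {0} := by
      rintro _ ⟨s, hs, rfl⟩; exact (hL.subset hs).2
    simpa using closure_mono h2 this
  refine hL.subset_of_isPreconnected (hL.isPreconnected.subset_closure (subset_insert q L)
    (insert_subset hq subset_closure)) (insert_subset ⟨hq1, hqim⟩ hL.subset) (mem_insert_of_mem _ hp) hp
    (mem_insert _ _)

/-- A parametrization of a parallel line by the values of `ζ`: at the parameter `y` the value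
is `1 + ε y`. -/
structure LineParam (L : Set ℂ) where
  ε : ℝ
  J : Set ℝ
  curve : ℝ → ℂ
  sign : ε = 1 ∨ ε = -1
  isOpen : IsOpen J
  pos : ∀ y ∈ J, 0 < y
  down : ∀ y ∈ J, ∀ x, 0 < x → x ≤ y → x ∈ J
  mem : ∀ y ∈ J, curve y ∈ L
  zeta : ∀ y ∈ J, riemannZeta (curve y) = 1 + ε * y
  surj : ∀ s ∈ L, ∃ y ∈ J, curve y = s
  hasDeriv : ∀ y ∈ J, HasDerivAt curve (ε / deriv riemannZeta (curve y)) y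

/-- Since 1 is omitted, ζ - 1 has constant sign ε on the line and y = ε(ζ - 1) is an injective
positive coordinate. Its range is an open interval reaching down to 0, because ζ tends to 1 at the
right end. -/
theorem IsParallelLine.nonempty_lineParam {L : Set ℂ} (hL : IsParallelLine L) :
    Nonempty (LineParam L) := by
  obtain ⟨s₀, hs₀, -⟩ := hL.comesFromRight 0
  have hval : ∀ s ∈ L, riemannZeta s = ((riemannZeta s).re : ℂ) := fun s hs =>
    Complex.ext (by simp) (by simp [(hL.subset hs).2])
  have hord := (hL.isPreconnected.image _ hL.continuousOn_re).ordConnected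
  have hne : ∀ s ∈ L, (riemannZeta s).re ≠ 1 := fun s hs h =>
    hL.zeta_ne_one hs (by rw [hval s hs, h]; simp)
  have hsign : ∃ ε : ℝ, (ε = 1 ∨ ε = -1) ∧ ∀ s ∈ L, 0 < ε * ((riemannZeta s).re - 1) := by
    have hno : ∀ a ∈ L, ∀ b ∈ L, (riemannZeta a).re < 1 → 1 < (riemannZeta b).re → False := by
      intro a ha b hb h1 h2
      obtain ⟨s, hs, hs1⟩ := hord.out (mem_image_of_mem _ ha) (mem_image_of_mem _ hb) ⟨h1.le, h2.le⟩
      exact hne s hs hs1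
    rcases lt_or_gt_of_ne (hne s₀ hs₀) with h | h
    · refine ⟨-1, Or.inr rfl, fun s hs => ?_⟩
      rcases lt_or_gt_of_ne (hne s hs) with h' | h'
      · linarith
      · exact (hno _ hs₀ _ hs h h').elim
    · refine ⟨1, Or.inl rfl, fun s hs => ?_⟩
      rcases lt_or_gt_of_ne (hne s hs) with h' | h'
      · exact (hno _ hs _ hs₀ h' h).elim
      · linarith
  obtain ⟨ε, hε, hpos⟩ := hsign
  have hεε : ε * ε = 1 := by rcases hε with rfl | rfl <;> norm_num
  set h : ℂ → ℝ := fun s => ε * ((riemannZeta s).re - 1) with hh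
  have hinj : InjOn h L := fun a ha b hb hab => hL.injOn.1 ha hb (by
    have : ε * (ε * ((riemannZeta a).re - 1)) = ε * (ε * ((riemannZeta b).re - 1)) := congrArg (ε * ·) hab
    simp only [← mul_assoc, hεε, one_mul] at this
    simpa using this)
  have hcont : ContinuousOn h L := continuousOn_const.mul (hL.continuousOn_re.sub continuousOn_const)
  have hval2 : ∀ s ∈ L, riemannZeta s = 1 + ε * (h s : ℝ) := fun s hs => by
    rw [hval s hs, hh]
    have : ((ε : ℝ) : ℂ) * ε = 1 := by exact_mod_cast hεε
    push_cast
    linear_combination (1 - (((riemannZeta s).re : ℝ) : ℂ)) * this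
  set c := Function.invFunOn h L with hc
  have hmem : ∀ y ∈ h '' L, c y ∈ L := fun y hy => Function.invFunOn_mem hy
  have heq : ∀ y ∈ h '' L, h (c y) = y := fun y hy => Function.invFunOn_eq hy
  have hJo : IsOpen (h '' L) := by
    have h1 := hL.injOn.2
    have : h '' L = (fun y => ε * y + 1) ⁻¹' ((fun s => (riemannZeta s).re) '' L) := by
      ext y
      constructor
      · rintro ⟨s, hs, rfl⟩
        refine ⟨s, hs, ?_⟩
        simp only [hh]; linear_combination (1 - (riemannZeta s).re) * hεε
      · rintro ⟨s, hs, hsy⟩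
        refine ⟨s, hs, ?_⟩
        simp only [hh] at hsy ⊢; rw [hsy]; linear_combination y * hεε
    rw [this]
    exact h1.preimage (by fun_prop)
  refine ⟨⟨ε, h '' L, c, hε, hJo, ?_, ?_, hmem, ?_, ?_, ?_⟩⟩
  · rintro _ ⟨s, hs, rfl⟩; exact hpos s hs
  · rintro y hy x hx hxy
    obtain ⟨M, hM⟩ := exists_norm_zeta_sub_one_lt hx
    obtain ⟨s, hs, hsM⟩ := hL.comesFromRight M
    have h1 := hM s hsM.le
    rw [hval2 s hs, add_sub_cancel_left, norm_mul, Complex.norm_real, Complex.norm_real] at h1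
    have h2 : ‖ε‖ = 1 := by rcases hε with rfl | rfl <;> simp
    rw [h2, one_mul] at h1
    exact (hL.isPreconnected.image _ hcont).ordConnected.out (mem_image_of_mem _ hs) hy
      ⟨(le_abs_self _).trans h1.le, hxy⟩
  · intro y hy
    rw [hval2 _ (hmem y hy), heq y hy]
  · intro s hs
    exact ⟨h s, mem_image_of_mem _ hs, hinj (hmem _ (mem_image_of_mem _ hs)) hs
      (heq _ (mem_image_of_mem _ hs))⟩
  · intro y hy
    obtain ⟨r, hr, U, hU, hpU, hUV, μ, h1, h2, h3, h4, h5, h6, h7, -⟩ :=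
      hL.exists_chart (hmem y hy) univ_mem
    have hζ : riemannZeta (c y) = 1 + ε * (y : ℂ) := by rw [hval2 _ (hmem y hy), heq y hy]
    have hd : HasDerivAt (fun y : ℝ => (1 + ε * (y : ℂ) : ℂ)) ε y := by
      simpa using ((Complex.ofRealCLM.hasDerivAt (x := y)).const_mul (ε : ℂ)).const_add 1
    have hd2 : HasDerivAt (fun y : ℝ => μ (1 + ε * (y : ℂ)))
        ((deriv riemannZeta (c y))⁻¹ * ε) y := by
      rw [hζ] at h6
      exact h6.comp y hd
    refine (hd2.congr_of_eventuallyEq ?_).congr_deriv (by rw [div_eq_mul_inv, mul_comm])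
    have hev : ∀ᶠ x : ℝ in 𝓝 y, (1 + ε * (x : ℂ) : ℂ) ∈ Metric.ball (riemannZeta (c y)) r := by
      refine hd.continuousAt.eventually_mem ?_
      rw [hζ]; exact Metric.ball_mem_nhds _ hr
    filter_upwards [hev, hJo.mem_nhds hy] with x hx hxJ
    have hm : μ (1 + ε * (x : ℂ)) ∈ L := (h7 _ (h2 hx)).2 (by
      rw [h4 _ hx]; simp)
    refine hL.eq_of_zeta_eq (hmem x hxJ) hm ?_
    rw [h4 _ hx, hval2 _ (hmem x hxJ), heq x hxJ]

/-- A function whose derivative is negative wherever it takes the value `c` crosses that level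
at most once, downwards. -/
theorem lt_of_deriv_neg_of_eq {J : Set ℝ} (hJ : J.OrdConnected) {φ φ' : ℝ → ℝ} {c : ℝ}
    (hd : ∀ y ∈ J, HasDerivAt φ (φ' y) y) (hc : ∀ y ∈ J, φ y = c → φ' y < 0) {a b : ℝ} (ha : a ∈ J)
    (hb : b ∈ J) (hab : a < b) (hac : φ a ≤ c) : φ b < c := by
  have hsub : Icc a b ⊆ J := hJ.out ha hb
  have hle : ∀ x ∈ Icc a b, φ x ≤ c := fun x hx =>
    image_le_of_deriv_right_lt_deriv_boundary' (B := fun _ => c) (B' := fun _ => 0)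
      (fun z hz => (hd z (hsub hz)).continuousAt.continuousWithinAt)
      (fun z hz => (hd z (hsub (Ico_subset_Icc_self hz))).hasDerivWithinAt) hac continuousOn_const
      (fun z _ => hasDerivWithinAt_const _ _ _) (fun z hz h => hc z (hsub (Ico_subset_Icc_self hz)) h) hx
  refine lt_of_le_of_ne (hle b (right_mem_Icc.2 hab.le)) fun hbc => ?_
  have h1 := (hasDerivAt_iff_tendsto_slope.1 (hd b hb)).eventually (gt_mem_nhds (hc b hb hbc))
  have h2 : ∀ᶠ x in 𝓝[<] b, slope φ b x < 0 := h1.filter_mono (nhdsWithin_mono _ fun x hx => ne_of_lt hx)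
  obtain ⟨x, hx1, hx2, hx3⟩ := (h2.and (Ioo_mem_nhdsLT hab)).exists
  rw [slope_def_field] at hx1
  have h3 := hle x ⟨hx2.le, hx3.le⟩
  rw [← hbc] at h3
  exact absurd hx1 (not_lt.2 (div_nonneg_of_nonpos (by linarith) (by linarith)))

namespace LineParam

variable {L : Set ℂ} (Λ : LineParam L)

theorem ordConnected : Λ.J.OrdConnected :=
  ⟨fun a ha b hb x hx => Λ.down b hb x ((Λ.pos a ha).trans_le hx.1) hx.2⟩

theorem hasDerivAt_re {y : ℝ} (hy : y ∈ Λ.J) : HasDerivAt (fun y => (Λ.curve y).re)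
    (Λ.ε / deriv riemannZeta (Λ.curve y)).re y :=
  Complex.reCLM.hasFDerivAt.comp_hasDerivAt y (Λ.hasDeriv y hy)

theorem hasDerivAt_im {y : ℝ} (hy : y ∈ Λ.J) : HasDerivAt (fun y => (Λ.curve y).im)
    (Λ.ε / deriv riemannZeta (Λ.curve y)).im y :=
  Complex.imCLM.hasFDerivAt.comp_hasDerivAt y (Λ.hasDeriv y hy)

theorem continuousAt {y : ℝ} (hy : y ∈ Λ.J) : ContinuousAt Λ.curve y :=
  (Λ.hasDeriv y hy).continuousAt

theorem zeta_re {y : ℝ} (hy : y ∈ Λ.J) : (riemannZeta (Λ.curve y)).re = 1 + Λ.ε * y := by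
  rw [Λ.zeta y hy]; simp

theorem zeta_eq_ofReal {y : ℝ} (hy : y ∈ Λ.J) : riemannZeta (Λ.curve y) = ((1 + Λ.ε * y : ℝ) : ℂ) := by
  rw [Λ.zeta y hy]; simp

theorem deriv_formula {y : ℝ} (hy : y ∈ Λ.J) (hx : 1 + Λ.ε * y ≠ 0) :
    (Λ.ε / deriv riemannZeta (Λ.curve y) : ℂ) = ((Λ.ε / (1 + Λ.ε * y) : ℝ) : ℂ) *
      (deriv riemannZeta (Λ.curve y) / riemannZeta (Λ.curve y))⁻¹ := by
  rw [Λ.zeta_eq_ofReal hy, inv_div, Complex.ofReal_div]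
  have : ((1 + Λ.ε * y : ℝ) : ℂ) ≠ 0 := by exact_mod_cast hx
  field_simp

/-- The line leaves every compact set at its left end. -/
theorem exists_notMem_of_isCompact (hL : IsParallelLine L) (hcl : IsClosed L) {K : Set ℂ}
    (hK : IsCompact K) {a : ℝ} (ha : a ∈ Λ.J) : ∃ y ∈ Λ.J, a < y ∧ Λ.curve y ∉ K := by
  by_contra! h
  have hεε : Λ.ε * Λ.ε = 1 := by rcases Λ.sign with h | h <;> rw [h] <;> norm_num
  set K' := insert (Λ.curve a) K
  have hK' : IsCompact (K' ∩ L) := (hK.insert _).inter_right hcl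
  -- If the curve stayed in K after a, all parameters from a on would lie in this compact subset of
  -- J; its greatest element contradicts the openness of J.
  set C := (fun s => Λ.ε * ((riemannZeta s).re - 1)) '' (K' ∩ L) with hC
  have hCc : IsCompact C :=
    hK'.image_of_continuousOn (continuousOn_const.mul ((hL.continuousOn_re.mono inter_subset_right).sub
      continuousOn_const))
  have hval : ∀ y ∈ Λ.J, Λ.ε * ((riemannZeta (Λ.curve y)).re - 1) = y := fun y hy => by
    rw [Λ.zeta_re hy]; linear_combination y * hεε
  have hCJ : C ⊆ Λ.J := by
    rintro _ ⟨s, hs, rfl⟩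
    obtain ⟨y, hy, rfl⟩ := Λ.surj s hs.2
    simp only [hval y hy]; exact hy
  have hJC : ∀ y ∈ Λ.J, a ≤ y → y ∈ C := fun y hy hay => by
    refine ⟨Λ.curve y, ⟨?_, Λ.mem y hy⟩, hval y hy⟩
    rcases hay.eq_or_lt with rfl | h'
    · exact mem_insert _ _
    · exact mem_insert_of_mem _ (h y hy h')
  obtain ⟨m, hm, hmax⟩ := hCc.exists_isGreatest ⟨a, hJC a ha le_rfl⟩
  have hmJ := hCJ hm
  obtain ⟨δ, hδ, hball⟩ := Metric.isOpen_iff.1 Λ.isOpen m hmJ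
  have h1 : m + δ / 2 ∈ Λ.J := hball (by simp [abs_of_pos hδ]; exact hδ)
  have := hmax (hJC _ h1 ((hmax (hJC a ha le_rfl)).trans (by linarith)))
  linarith

/-- Wherever the line meets `Re s = -1` it moves to the left. -/
theorem re_deriv_neg_of_re_eq (hpos : ∀ s ∈ L, 0 < s.im) {y : ℝ} (hy : y ∈ Λ.J)
    (h : (Λ.curve y).re = -1) : (Λ.ε / deriv riemannZeta (Λ.curve y)).re < 0 := by
  set t := (Λ.curve y).im with ht
  have ht0 : 0 < t := hpos _ (Λ.mem y hy)
  have hp : Λ.curve y = -1 + t * Complex.I := Complex.ext (by simp [h]) (by simp [ht])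
  have hx := Λ.zeta_re hy
  have hy0 := Λ.pos y hy
  have him : (riemannZeta (-1 + t * Complex.I)).im = 0 := by
    rw [← hp, Λ.zeta_eq_ofReal hy, Complex.ofReal_im]
  have hcl := zeta_neg_one_add_real ht0 him
  have hk0 : deriv riemannZeta (Λ.curve y) / riemannZeta (Λ.curve y) ≠ 0 := by
    intro h0
    rcases hcl with h1 | h1
    · have := re_zeta_logDeriv_pos ht0.le h1.1.le
      rw [← hp, h0] at this; simp at this
    · have := re_zeta_logDeriv_neg h1.1.le
      rw [← hp, h0] at this; simp at this
  rw [← hp, hx] at hcl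
  have hne : 1 + Λ.ε * y ≠ 0 := by
    rcases hcl with h1 | h1
    · exact h1.2.1.ne'
    · intro h0; rw [h0] at h1; simp at h1; linarith [h1.2]
  rw [Λ.deriv_formula hy hne, Complex.re_ofReal_mul, Complex.inv_re]
  have hN := Complex.normSq_pos.2 hk0
  -- The velocity is ε/ζ times the inverse of ζ'/ζ. At a low crossing 0 < ζ < 1 forces ε = -1 while
  -- Re ζ'/ζ > 0; at a high one |ζ| > 1 makes ε/ζ positive while Re ζ'/ζ < 0. The horizontal
  -- velocity is negative both times.
  rcases hcl with ⟨h1, h2, h3⟩ | ⟨h1, h2⟩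
  · have hk := re_zeta_logDeriv_pos ht0.le h1.le
    rw [← hp] at hk
    have hε : Λ.ε = -1 := by
      rcases Λ.sign with h | h
      · rw [h] at h3; linarith
      · exact h
    refine mul_neg_of_neg_of_pos (div_neg_of_neg_of_pos (by rw [hε]; norm_num) h2) (div_pos hk hN)
  · have hk := re_zeta_logDeriv_neg h1.le
    rw [← hp] at hk
    refine mul_neg_of_pos_of_neg ?_ (div_neg_of_neg_of_pos hk hN)
    rcases Λ.sign with h | h
    · rw [h]; positivity
    · rw [h] at h2 ⊢
      refine div_pos_of_neg_of_neg (by norm_num) ?_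
      by_contra! h4
      rw [abs_of_nonneg h4] at h2
      linarith

theorem re_lt_neg_one (hpos : ∀ s ∈ L, 0 < s.im) {a b : ℝ} (ha : a ∈ Λ.J) (hb : b ∈ Λ.J)
    (h : (Λ.curve a).re ≤ -1) (hab : a < b) : (Λ.curve b).re < -1 :=
  lt_of_deriv_neg_of_eq Λ.ordConnected (fun _ hy => Λ.hasDerivAt_re hy)
    (fun _ hy h => Λ.re_deriv_neg_of_re_eq hpos hy h) ha hb hab h

/-- Far to the right the line moves to the left. -/
theorem exists_re_deriv_neg : ∃ M : ℝ, ∀ y ∈ Λ.J, M ≤ (Λ.curve y).re →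
    (Λ.ε / deriv riemannZeta (Λ.curve y)).re < 0 := by
  obtain ⟨M, -, hM⟩ := exists_zeta_right_monotone
  refine ⟨M, fun y hy hMy => ?_⟩
  have h1 := hM (Λ.curve y) hMy
  have e : (riemannZeta (Λ.curve y) - 1) / deriv riemannZeta (Λ.curve y) =
      (y : ℂ) * (Λ.ε / deriv riemannZeta (Λ.curve y)) := by
    rw [Λ.zeta y hy]; ring
  rw [e, Complex.re_ofReal_mul] at h1
  have := Λ.pos y hy
  by_contra! h2
  nlinarith

theorem re_lt_of_deriv_neg {M : ℝ} (hM : ∀ y ∈ Λ.J, M ≤ (Λ.curve y).re →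
    (Λ.ε / deriv riemannZeta (Λ.curve y)).re < 0) {a b : ℝ} (ha : a ∈ Λ.J) (hb : b ∈ Λ.J) (hab : a < b)
    (hMb : M ≤ (Λ.curve b).re) : (Λ.curve b).re < (Λ.curve a).re := by
  by_contra! h
  exact lt_irrefl _ (lt_of_deriv_neg_of_eq Λ.ordConnected (fun _ hy => Λ.hasDerivAt_re hy)
    (c := (Λ.curve b).re) (fun y hy hyc => hM y hy (by rw [hyc]; exact hMb)) ha hb hab h)

/-- A line through `-1 + iT` has `T > 8.7` and runs off to the left beyond that point. -/
theorem left_end (hL : IsParallelLine L) {T : ℝ} (hT : 0 < T) {yP : ℝ} (hyP : yP ∈ Λ.J)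
    (hP : Λ.curve yP = -1 + T * Complex.I) :
    8.7 < T ∧ 0 < Λ.ε / (1 + Λ.ε * yP) ∧ ∀ B : ℝ, ∃ y ∈ Λ.J, yP < y ∧ (Λ.curve y).re < B := by
  have hPL : (-1 + T * Complex.I : ℂ) ∈ L := hP ▸ Λ.mem yP hyP
  have hPim : 0 < (-1 + T * Complex.I : ℂ).im := by simpa using hT
  have hPre : (Λ.curve yP).re = -1 := by rw [hP]; simp
  have hpos : ∀ s ∈ L, 0 < s.im := fun s hs => hL.im_pos hPL hPim hs
  have hcl := hL.isClosed hPL hPim.ne'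
  have hy0 := Λ.pos yP hyP
  have hre : ∀ y ∈ Λ.J, yP ≤ y → (Λ.curve y).re ≤ -1 := fun y hy h => by
    rcases h.eq_or_lt with rfl | h
    · exact hPre.le
    · exact (Λ.re_lt_neg_one hpos hyP hy hPre.le h).le
  obtain ⟨t₁, ht₁, hleft⟩ := exists_re_zeta_logDeriv_le
  have hord : (Λ.J ∩ Ici yP).OrdConnected := Λ.ordConnected.inter ordConnected_Ici
  have hx := Λ.zeta_re hyP
  have hreal : (riemannZeta (-1 + T * Complex.I)).im = 0 := (hL.subset hPL).2
  have hcont : ContinuousOn (fun y => (Λ.curve y).re) Λ.J := fun y hy =>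
    (Λ.hasDerivAt_re hy).continuousAt.continuousWithinAt
  have hNpos : ∀ y ∈ Λ.J, yP ≤ y → t₁ ≤ (Λ.curve y).im →
      0 < Complex.normSq (deriv riemannZeta (Λ.curve y) / riemannZeta (Λ.curve y)) := by
    intro y hy hy' ht
    refine Complex.normSq_pos.2 fun h0 => ?_
    have := (hleft _ (hre y hy hy') ht).2.1
    rw [h0] at this; norm_num at this
  have hcl' := zeta_neg_one_add_real hT hreal
  rw [← hP, hx] at hcl'
  rcases hcl' with ⟨h1, h2, h3⟩ | ⟨h1, h2⟩
  · exfalso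
    have hε : Λ.ε = -1 := by
      rcases Λ.sign with h | h
      · rw [h] at h3; linarith
      · exact h
    rw [hε] at h2
    -- The parameter 1 would give a zero of ζ off the axis with Re s ≤ -1; hence ζ stays in (0, 1)
    -- from the low crossing on.
    have hJ1 : ∀ y ∈ Λ.J, yP ≤ y → y < 1 := by
      intro y hy _
      by_contra! h
      have h1J : (1 : ℝ) ∈ Λ.J := Λ.down y hy 1 one_pos h
      have hz := Λ.zeta 1 h1J
      rw [hε] at hz
      refine zeta_ne_zero_of_re_nonpos (s := Λ.curve 1) ?_ (hpos _ (Λ.mem 1 h1J)).ne' (by rw [hz]; simp)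
      linarith [hre 1 h1J (by linarith)]
    -- The line Re s = -A, where |ζ| > 1, is a barrier for a curve on which 0 < ζ < 1.
    obtain ⟨A, hA, hline⟩ := exists_line_one_lt_norm_zeta
    have hAre : ∀ y ∈ Λ.J, yP ≤ y → -A < (Λ.curve y).re := by
      intro y hy hyy
      by_contra! h
      obtain ⟨z, hz, hzA⟩ := intermediate_value_Icc' hyy (hcont.mono (Λ.ordConnected.out hyP hy))
        (show -A ∈ Icc _ _ from ⟨h, by rw [hPre]; linarith⟩)
      have hzJ := Λ.ordConnected.out hyP hy hz
      have h4 := hline (Λ.curve z).im (hpos _ (Λ.mem z hzJ))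
      have h5 : (-A + (Λ.curve z).im * Complex.I : ℂ) = Λ.curve z :=
        Complex.ext (by simp; exact hzA.symm) (by simp)
      rw [h5, Λ.zeta_eq_ofReal hzJ, Complex.norm_real, hε, Real.norm_eq_abs, lt_abs] at h4
      have := hJ1 z hzJ hz.1
      have := Λ.pos z hzJ
      rcases h4 with h4 | h4 <;> linarith
    -- Where Im - 9 Re equals c, the bound Re > -A puts the point above t₁, and there the estimates
    -- for ζ'/ζ make this quantity decrease. It never exceeds c, so the curve would be confined to a
    -- compact rectangle.
    set c := max t₁ T + 9 * A with hc
    have him : ∀ y ∈ Λ.J, yP < y → (Λ.curve y).im + -9 * (Λ.curve y).re < c := by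
      intro y hy hyy
      refine lt_of_deriv_neg_of_eq hord (φ := fun y => (Λ.curve y).im + -9 * (Λ.curve y).re)
        (fun z hz => (Λ.hasDerivAt_im hz.1).add ((Λ.hasDerivAt_re hz.1).const_mul (-9)))
        (fun z hz hzc => ?_) ⟨hyP, self_mem_Ici⟩ ⟨hy, hyy.le⟩ hyy ?_
      · have h4 := hAre z hz.1 hz.2
        have h5 : t₁ ≤ (Λ.curve z).im := by
          have := le_max_left t₁ T; linarith
        obtain ⟨-, h6, h7⟩ := hleft _ (hre z hz.1 hz.2) h5
        have hN := hNpos z hz.1 hz.2 h5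
        have hz1 := hJ1 z hz.1 hz.2
        have hα : Λ.ε / (1 + Λ.ε * z) < 0 := by
          rw [hε]; exact div_neg_of_neg_of_pos (by norm_num) (by linarith)
        rw [Λ.deriv_formula hz.1 (by rw [hε]; linarith), Complex.re_ofReal_mul, Complex.im_ofReal_mul,
          Complex.inv_re, Complex.inv_im]
        set k := deriv riemannZeta (Λ.curve z) / riemannZeta (Λ.curve z)
        have e : Λ.ε / (1 + Λ.ε * z) * (-k.im / Complex.normSq k) +
            -9 * (Λ.ε / (1 + Λ.ε * z) * (k.re / Complex.normSq k)) =
            -(Λ.ε / (1 + Λ.ε * z)) * ((k.im + 9 * k.re) / Complex.normSq k) := by ring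
        rw [e]
        exact mul_neg_of_pos_of_neg (by linarith)
          (div_neg_of_neg_of_pos (by linarith [(abs_lt.1 h7).2]) hN)
      · simp only [hP]
        have := le_max_right t₁ T
        simp; linarith
    obtain ⟨y, hy, hyy, hyK⟩ := Λ.exists_notMem_of_isCompact hL hcl
      (isCompact_Icc.reProdIm isCompact_Icc : IsCompact (Icc (-A) (-1) ×ℂ Icc 0 c)) hyP
    refine hyK ⟨⟨(hAre y hy hyy.le).le, hre y hy hyy.le⟩, (hpos _ (Λ.mem y hy)).le, ?_⟩
    have h4 := him y hy hyy
    have h5 := hre y hy hyy.le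
    linarith
  · have hα : ∀ y ∈ Λ.J, yP ≤ y → 1 + Λ.ε * y ≠ 0 ∧ 0 < Λ.ε / (1 + Λ.ε * y) := by
      intro y hy hyy
      rcases Λ.sign with h | h
      · rw [h]
        have : 0 < 1 + 1 * y := by linarith
        exact ⟨this.ne', by positivity⟩
      · rw [h] at h2 ⊢
        have : 1 + -1 * yP < 0 := by
          by_contra! h4
          rw [abs_of_nonneg h4] at h2
          linarith
        have h5 : 1 + -1 * y < 0 := by linarith
        exact ⟨h5.ne, div_pos_of_neg_of_neg (by norm_num) h5⟩
    refine ⟨h1, (hα yP hyP le_rfl).2, fun B => ?_⟩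
    by_contra! hB
    -- The same barrier with Im + 9 Re: now ε/ζ > 0, which reverses the vertical direction. If Re
    -- were bounded below by B, the curve would again stay in a compact set.
    set c := max t₁ T with hc
    have him : ∀ y ∈ Λ.J, yP < y → (Λ.curve y).im + 9 * (Λ.curve y).re < c := by
      intro y hy hyy
      refine lt_of_deriv_neg_of_eq hord (φ := fun y => (Λ.curve y).im + 9 * (Λ.curve y).re)
        (fun z hz => (Λ.hasDerivAt_im hz.1).add ((Λ.hasDerivAt_re hz.1).const_mul 9))
        (fun z hz hzc => ?_) ⟨hyP, self_mem_Ici⟩ ⟨hy, hyy.le⟩ hyy ?_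
      · have h4 := hre z hz.1 hz.2
        have h5 : t₁ ≤ (Λ.curve z).im := by
          have := le_max_left t₁ T; linarith
        obtain ⟨-, h6, h7⟩ := hleft _ h4 h5
        have hN := hNpos z hz.1 hz.2 h5
        obtain ⟨h8, h9⟩ := hα z hz.1 hz.2
        rw [Λ.deriv_formula hz.1 h8, Complex.re_ofReal_mul, Complex.im_ofReal_mul,
          Complex.inv_re, Complex.inv_im]
        set k := deriv riemannZeta (Λ.curve z) / riemannZeta (Λ.curve z)
        have e : Λ.ε / (1 + Λ.ε * z) * (-k.im / Complex.normSq k) +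
            9 * (Λ.ε / (1 + Λ.ε * z) * (k.re / Complex.normSq k)) =
            (Λ.ε / (1 + Λ.ε * z)) * ((-k.im + 9 * k.re) / Complex.normSq k) := by ring
        rw [e]
        exact mul_neg_of_pos_of_neg h9
          (div_neg_of_neg_of_pos (by linarith [(abs_lt.1 h7).1]) hN)
      · simp only [hP]
        have := le_max_right t₁ T
        simp; linarith
    obtain ⟨y, hy, hyy, hyK⟩ := Λ.exists_notMem_of_isCompact hL hcl
      (isCompact_Icc.reProdIm isCompact_Icc : IsCompact (Icc B (-1) ×ℂ Icc 0 (c - 9 * B))) hyP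
    have h4 := him y hy hyy
    have h5 := hB y hy hyy
    exact hyK ⟨⟨h5, hre y hy hyy.le⟩, (hpos _ (Λ.mem y hy)).le, by linarith⟩

end LineParam

/-! ### Variation of the argument along a curve closed up by vertical segments -/

/-- The vertical segment from the real axis to `z`. -/
noncomputable def vertPath (z : ℂ) (τ : ℝ) : ℂ := z.re + (τ * z.im : ℝ) * Complex.I

@[simp] theorem vertPath_re (z : ℂ) (τ : ℝ) : (vertPath z τ).re = z.re := by simp [vertPath]

@[simp] theorem vertPath_im (z : ℂ) (τ : ℝ) : (vertPath z τ).im = τ * z.im := by simp [vertPath]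

@[simp] theorem vertPath_one (z : ℂ) : vertPath z 1 = z := Complex.ext (by simp) (by simp)

@[simp] theorem vertPath_zero (z : ℂ) : vertPath z 0 = z.re := Complex.ext (by simp) (by simp)

theorem continuous_vertPath : Continuous fun p : ℂ × ℝ => vertPath p.1 p.2 := by
  unfold vertPath
  exact (Complex.continuous_ofReal.comp (Complex.continuous_re.comp continuous_fst)).add
    ((Complex.continuous_ofReal.comp (continuous_snd.mul (Complex.continuous_im.comp continuous_fst))).mul
      continuous_const)

theorem continuous_vertPath_right (z : ℂ) : Continuous (vertPath z) :=
  continuous_vertPath.comp (by fun_prop : Continuous fun τ : ℝ => (z, τ))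

/-- The variation of the argument of `f` from the real axis up to `κ a`, along `κ`, and from `κ b`
down to the real axis. -/
noncomputable def contourVar (f : ℂ → ℂ) (κ : ℝ → ℂ) (a b : ℝ) : ℝ :=
  argVar (fun τ => f (vertPath (κ a) τ)) 0 1 + argVar (fun y => f (κ y)) a b
    - argVar (fun τ => f (vertPath (κ b) τ)) 0 1

/-- The curve of `contourVar`. -/
def contour (κ : ℝ → ℂ) (a b : ℝ) : Set ℂ :=
  vertPath (κ a) '' Icc 0 1 ∪ κ '' Icc a b ∪ vertPath (κ b) '' Icc 0 1

section

variable {f g : ℂ → ℂ} {κ : ℝ → ℂ} {a b : ℝ}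

theorem vertPath_mem_contour_left {τ : ℝ} (hτ : τ ∈ Icc (0 : ℝ) 1) : vertPath (κ a) τ ∈ contour κ a b :=
  Or.inl (Or.inl (mem_image_of_mem _ hτ))

theorem mem_contour {y : ℝ} (hy : y ∈ Icc a b) : κ y ∈ contour κ a b :=
  Or.inl (Or.inr (mem_image_of_mem _ hy))

theorem vertPath_mem_contour_right {τ : ℝ} (hτ : τ ∈ Icc (0 : ℝ) 1) : vertPath (κ b) τ ∈ contour κ a b :=
  Or.inr (mem_image_of_mem _ hτ)

theorem continuousOn_comp_contour (hκ : ContinuousOn κ (Icc a b)) (hf : ContinuousOn f (contour κ a b)) :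
    ContinuousOn (fun τ => f (vertPath (κ a) τ)) (Icc 0 1) ∧ ContinuousOn (fun y => f (κ y)) (Icc a b) ∧
      ContinuousOn (fun τ => f (vertPath (κ b) τ)) (Icc 0 1) :=
  ⟨hf.comp (continuous_vertPath_right _).continuousOn fun _ h => vertPath_mem_contour_left h,
    hf.comp hκ fun _ h => mem_contour h,
    hf.comp (continuous_vertPath_right _).continuousOn fun _ h => vertPath_mem_contour_right h⟩

theorem contourVar_mul (hab : a ≤ b) (hκ : ContinuousOn κ (Icc a b)) (hf : ContinuousOn f (contour κ a b))
    (hg : ContinuousOn g (contour κ a b)) (hf0 : ∀ z ∈ contour κ a b, f z ≠ 0)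
    (hg0 : ∀ z ∈ contour κ a b, g z ≠ 0) :
    contourVar (fun z => f z * g z) κ a b = contourVar f κ a b + contourVar g κ a b := by
  obtain ⟨f1, f2, f3⟩ := continuousOn_comp_contour hκ hf
  obtain ⟨g1, g2, g3⟩ := continuousOn_comp_contour hκ hg
  rw [contourVar, argVar_mul zero_le_one f1 g1 (fun _ h => hf0 _ (vertPath_mem_contour_left h))
      (fun _ h => hg0 _ (vertPath_mem_contour_left h)),
    argVar_mul hab f2 g2 (fun _ h => hf0 _ (mem_contour h)) (fun _ h => hg0 _ (mem_contour h)),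
    argVar_mul zero_le_one f3 g3 (fun _ h => hf0 _ (vertPath_mem_contour_right h))
      (fun _ h => hg0 _ (vertPath_mem_contour_right h)), contourVar, contourVar]
  ring

theorem contourVar_pow (hab : a ≤ b) (hκ : ContinuousOn κ (Icc a b)) (hf : ContinuousOn f (contour κ a b))
    (hf0 : ∀ z ∈ contour κ a b, f z ≠ 0) (n : ℕ) :
    contourVar (fun z => f z ^ n) κ a b = n * contourVar f κ a b := by
  obtain ⟨f1, f2, f3⟩ := continuousOn_comp_contour hκ hf
  rw [contourVar, argVar_pow zero_le_one f1 (fun _ h => hf0 _ (vertPath_mem_contour_left h)),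
    argVar_pow hab f2 (fun _ h => hf0 _ (mem_contour h)),
    argVar_pow zero_le_one f3 (fun _ h => hf0 _ (vertPath_mem_contour_right h)), contourVar]
  ring

theorem contourVar_prod {ι : Type*} (S : Finset ι) {F : ι → ℂ → ℂ} (hab : a ≤ b)
    (hκ : ContinuousOn κ (Icc a b)) (hf : ∀ i ∈ S, ContinuousOn (F i) (contour κ a b))
    (hf0 : ∀ i ∈ S, ∀ z ∈ contour κ a b, F i z ≠ 0) :
    contourVar (fun z => ∏ i ∈ S, F i z) κ a b = ∑ i ∈ S, contourVar (F i) κ a b := by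
  have h := fun i hi => continuousOn_comp_contour hκ (hf i hi)
  rw [contourVar, argVar_prod S zero_le_one (fun i hi => (h i hi).1)
      (fun i hi _ h => hf0 i hi _ (vertPath_mem_contour_left h)),
    argVar_prod S hab (fun i hi => (h i hi).2.1) (fun i hi _ h => hf0 i hi _ (mem_contour h)),
    argVar_prod S zero_le_one (fun i hi => (h i hi).2.2)
      (fun i hi _ h => hf0 i hi _ (vertPath_mem_contour_right h)), ← Finset.sum_add_distrib,
    ← Finset.sum_sub_distrib]
  rfl

theorem contourVar_congr (hab : a ≤ b) (hκ : ContinuousOn κ (Icc a b))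
    (hf : ContinuousOn f (contour κ a b)) (hf0 : ∀ z ∈ contour κ a b, f z ≠ 0)
    (h : EqOn f g (contour κ a b)) : contourVar f κ a b = contourVar g κ a b := by
  obtain ⟨f1, f2, f3⟩ := continuousOn_comp_contour hκ hf
  rw [contourVar, argVar_congr zero_le_one f1 (fun _ h => hf0 _ (vertPath_mem_contour_left h))
      (fun _ h' => h (vertPath_mem_contour_left h')),
    argVar_congr hab f2 (fun _ h => hf0 _ (mem_contour h)) (fun _ h' => h (mem_contour h')),
    argVar_congr zero_le_one f3 (fun _ h => hf0 _ (vertPath_mem_contour_right h))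
      (fun _ h' => h (vertPath_mem_contour_right h')), contourVar]

theorem contourVar_add_adjacent {c : ℝ} (hab : a ≤ b) (hbc : b ≤ c)
    (hf : ContinuousOn (fun y => f (κ y)) (Icc a c)) (h0 : ∀ y ∈ Icc a c, f (κ y) ≠ 0) :
    contourVar f κ a b + contourVar f κ b c = contourVar f κ a c := by
  rw [contourVar, contourVar, contourVar, ← argVar_add_adjacent hab hbc hf h0]
  ring

/-- Homotopy invariance. -/
theorem contourVar_homotopy {G : ℝ → ℂ → ℂ} {K : ℝ → ℝ → ℂ} {za zb : ℂ} (hab : a ≤ b)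
    (hKa : ∀ s ∈ Icc (0 : ℝ) 1, K s a = za) (hKb : ∀ s ∈ Icc (0 : ℝ) 1, K s b = zb)
    (hc : ContinuousOn (fun p : ℝ × ℝ => G p.1 (K p.1 p.2)) (Icc 0 1 ×ˢ Icc a b))
    (h0 : ∀ s ∈ Icc (0 : ℝ) 1, ∀ y ∈ Icc a b, G s (K s y) ≠ 0)
    (hca : ContinuousOn (fun p : ℝ × ℝ => G p.1 (vertPath za p.2)) (Icc 0 1 ×ˢ Icc 0 1))
    (h0a : ∀ s ∈ Icc (0 : ℝ) 1, ∀ τ ∈ Icc (0 : ℝ) 1, G s (vertPath za τ) ≠ 0)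
    (hra : ∀ s ∈ Icc (0 : ℝ) 1, (G s za.re).im = 0)
    (hcb : ContinuousOn (fun p : ℝ × ℝ => G p.1 (vertPath zb p.2)) (Icc 0 1 ×ˢ Icc 0 1))
    (h0b : ∀ s ∈ Icc (0 : ℝ) 1, ∀ τ ∈ Icc (0 : ℝ) 1, G s (vertPath zb τ) ≠ 0)
    (hrb : ∀ s ∈ Icc (0 : ℝ) 1, (G s zb.re).im = 0) :
    contourVar (G 1) (K 1) a b = contourVar (G 0) (K 0) a b := by
  have i0 : (0 : ℝ) ∈ Icc (0 : ℝ) 1 := ⟨le_rfl, zero_le_one⟩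
  have i1 : (1 : ℝ) ∈ Icc (0 : ℝ) 1 := ⟨zero_le_one, le_rfl⟩
  have r1 := argVar_rect (H := fun s τ => G s (vertPath za τ)) zero_le_one zero_le_one hca h0a
  have r2 := argVar_rect (H := fun s y => G s (K s y)) zero_le_one hab hc h0
  have r3 := argVar_rect (H := fun s τ => G s (vertPath zb τ)) zero_le_one zero_le_one hcb h0b
  -- At the fixed feet of the two verticals the deformed function stays real and nonzero, so nothing
  -- is lost through the open end of the contour on the axis.
  have hcol : ∀ z : ℂ, ContinuousOn (fun p : ℝ × ℝ => G p.1 (vertPath z p.2)) (Icc 0 1 ×ˢ Icc 0 1) →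
      (∀ s ∈ Icc (0 : ℝ) 1, ∀ τ ∈ Icc (0 : ℝ) 1, G s (vertPath z τ) ≠ 0) →
      (∀ s ∈ Icc (0 : ℝ) 1, (G s z.re).im = 0) → argVar (fun s => G s (vertPath z 0)) 0 1 = 0 := by
    intro z h1 h2 h3
    refine argVar_real zero_le_one ?_ (fun s hs => h2 s hs 0 i0) fun s hs => by simpa using h3 s hs
    exact h1.comp (f := fun s : ℝ => (s, (0 : ℝ))) (by fun_prop) fun s hs => ⟨hs, i0⟩
  rw [hcol za hca h0a hra] at r1
  rw [hcol zb hcb h0b hrb] at r3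
  have ha : a ∈ Icc a b := left_mem_Icc.2 hab
  have hb : b ∈ Icc a b := right_mem_Icc.2 hab
  have ea : argVar (fun s => G s (vertPath za 1)) 0 1 = argVar (fun s => G s (K s a)) 0 1 := by
    refine (argVar_congr zero_le_one ?_ (fun s hs => h0 s hs a ha) fun s hs => ?_).symm
    · exact hc.comp (f := fun s : ℝ => (s, a)) (by fun_prop) fun s hs => ⟨hs, ha⟩
    · simp [hKa s hs]
  have eb : argVar (fun s => G s (vertPath zb 1)) 0 1 = argVar (fun s => G s (K s b)) 0 1 := by
    refine (argVar_congr zero_le_one ?_ (fun s hs => h0 s hs b hb) fun s hs => ?_).symm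
    · exact hc.comp (f := fun s : ℝ => (s, b)) (by fun_prop) fun s hs => ⟨hs, hb⟩
    · simp [hKb s hs]
  rw [contourVar, contourVar, hKa 1 i1, hKb 1 i1, hKa 0 i0, hKb 0 i0]
  linarith

/-- Sweep the vertical segments under the curve: this is a map of a rectangle avoiding zeros of f,
three sides of which form the contour, while on the fourth, on the real axis, f is real. -/
theorem contourVar_eq_zero (hab : a ≤ b)
    (hc : ContinuousOn (fun p : ℝ × ℝ => f (vertPath (κ p.1) p.2)) (Icc a b ×ˢ Icc 0 1))
    (h0 : ∀ y ∈ Icc a b, ∀ τ ∈ Icc (0 : ℝ) 1, f (vertPath (κ y) τ) ≠ 0)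
    (hr : ∀ y ∈ Icc a b, (f (κ y).re).im = 0) : contourVar f κ a b = 0 := by
  have r := argVar_rect (H := fun y τ => f (vertPath (κ y) τ)) hab zero_le_one hc h0
  have i0 : (0 : ℝ) ∈ Icc (0 : ℝ) 1 := ⟨le_rfl, zero_le_one⟩
  have e : argVar (fun y => f (vertPath (κ y) 0)) a b = 0 := by
    refine argVar_real hab ?_ (fun y hy => h0 y hy 0 i0) fun y hy => by simpa using hr y hy
    exact hc.comp (f := fun y : ℝ => (y, (0 : ℝ))) (by fun_prop) fun y hy => ⟨hy, i0⟩
  simp only [vertPath_one] at r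
  rw [e] at r
  rw [contourVar]
  linarith

theorem contourVar_of_mem_slitPlane (c : ℂ) (hc : c ≠ 0) (hab : a ≤ b) (hκ : ContinuousOn κ (Icc a b))
    (hf : ContinuousOn f (contour κ a b)) (h : ∀ z ∈ contour κ a b, c * f z ∈ Complex.slitPlane) :
    contourVar f κ a b = (c * f (κ b).re).arg - (c * f (κ a).re).arg := by
  obtain ⟨f1, f2, f3⟩ := continuousOn_comp_contour hκ hf
  rw [contourVar, argVar_of_mem_slitPlane c hc zero_le_one f1 (fun _ h' => h _ (vertPath_mem_contour_left h')),
    argVar_of_mem_slitPlane c hc hab f2 (fun _ h' => h _ (mem_contour h')),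
    argVar_of_mem_slitPlane c hc zero_le_one f3 (fun _ h' => h _ (vertPath_mem_contour_right h'))]
  simp only [vertPath_one, vertPath_zero]
  ring

theorem contour_im (hab : a ≤ b) (him : ∀ y ∈ Icc a b, 0 < (κ y).im) {z : ℂ} (hz : z ∈ contour κ a b) :
    0 < z.im ∨ (0 ≤ z.im ∧ (z.re = (κ a).re ∨ z.re = (κ b).re)) := by
  rcases hz with (⟨τ, hτ, rfl⟩ | ⟨y, hy, rfl⟩) | ⟨τ, hτ, rfl⟩
  · right
    have := him a (left_mem_Icc.2 hab)
    simp only [vertPath_im, vertPath_re, true_or, and_true]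
    exact mul_nonneg hτ.1 this.le
  · exact Or.inl (him y hy)
  · right
    have := him b (right_mem_Icc.2 hab)
    simp only [vertPath_im, vertPath_re, or_true, and_true]
    exact mul_nonneg hτ.1 this.le

/-- Half a turn. Multiplication by -i turns the upper half-plane into the right one, so the
principal argument is continuous along the contour and goes from -π/2 to π/2. -/
theorem contourVar_sub_real (hab : a ≤ b) (hκ : ContinuousOn κ (Icc a b))
    (him : ∀ y ∈ Icc a b, 0 < (κ y).im) {x : ℝ} (hxa : x < (κ a).re) (hxb : (κ b).re < x) :
    contourVar (fun z => z - x) κ a b = Real.pi := by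
  rw [contourVar_of_mem_slitPlane (-Complex.I) (by simp) hab hκ (by fun_prop)]
  · have e1 : -Complex.I * (((κ b).re : ℂ) - x) = ((x - (κ b).re : ℝ) : ℂ) * Complex.I := by
      push_cast; ring
    have e2 : -Complex.I * (((κ a).re : ℂ) - x) = (((κ a).re - x : ℝ) : ℂ) * -Complex.I := by
      push_cast; ring
    rw [e1, e2, Complex.arg_real_mul _ (by linarith), Complex.arg_real_mul _ (by linarith), Complex.arg_I,
      Complex.arg_neg_I]
    ring
  · intro z hz
    rw [Complex.mem_slitPlane_iff]
    rcases contour_im hab him hz with h | ⟨-, h⟩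
    · left; simpa using h
    · right
      simp only [Complex.mul_im, Complex.neg_re, Complex.I_re, Complex.neg_im, Complex.I_im, Complex.sub_re,
        Complex.ofReal_re]
      rcases h with h | h <;> rw [h] <;> simp <;> intro h' <;> linarith

/-- The real quadratic polynomial with zeros `ρ` and its conjugate. -/
noncomputable def conjQuad (ρ z : ℂ) : ℂ := (z - ρ) * (z - starRingEnd ℂ ρ)

theorem conjQuad_ofReal_im (ρ : ℂ) (x : ℝ) : (conjQuad ρ x).im = 0 := by
  simp [conjQuad, Complex.mul_im]; ring

theorem conjQuad_ne_zero {ρ z : ℂ} (h1 : z ≠ ρ) (h2 : z ≠ starRingEnd ℂ ρ) : conjQuad ρ z ≠ 0 :=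
  mul_ne_zero (sub_ne_zero.2 h1) (sub_ne_zero.2 h2)

theorem continuous_conjQuad : Continuous fun p : ℂ × ℂ => conjQuad p.1 p.2 := by
  unfold conjQuad
  exact (continuous_snd.sub continuous_fst).mul
    (continuous_snd.sub (Complex.continuous_conj.comp continuous_fst))

theorem continuous_conjQuad_right (ρ : ℂ) : Continuous (conjQuad ρ) :=
  continuous_conjQuad.comp (by fun_prop : Continuous fun z : ℂ => (ρ, z))

theorem contourVar_conjQuad_ofReal (hab : a ≤ b) (hκ : ContinuousOn κ (Icc a b))
    (him : ∀ y ∈ Icc a b, 0 < (κ y).im) {x : ℝ} (hxa : x < (κ a).re) (hxb : (κ b).re < x) :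
    contourVar (conjQuad x) κ a b = 2 * Real.pi := by
  have h0 : ∀ z ∈ contour κ a b, z - x ≠ 0 := by
    intro z hz h
    have hzx : z = x := sub_eq_zero.1 h
    rcases contour_im hab him hz with h | ⟨-, h⟩
    · rw [hzx] at h; simp at h
    · rw [hzx, Complex.ofReal_re] at h
      rcases h with h | h <;> linarith
  have e : conjQuad x = fun z : ℂ => (z - x) * (z - x) := by ext z; simp [conjQuad]
  rw [e, contourVar_mul hab hκ (by fun_prop) (by fun_prop) h0 h0, contourVar_sub_real hab hκ him hxa hxb]
  ring

/-- The contour lies in the half-plane below ρ and in the one above its conjugate, so both factors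
have principal arguments after a rotation. At the real end points these arguments are opposite and
cancel. -/
theorem contourVar_conjQuad_high (hab : a ≤ b) (hκ : ContinuousOn κ (Icc a b))
    (him : ∀ y ∈ Icc a b, 0 < (κ y).im) {ρ : ℂ} (h : ∀ y ∈ Icc a b, (κ y).im < ρ.im) :
    contourVar (conjQuad ρ) κ a b = 0 := by
  have hlt : ∀ z ∈ contour κ a b, z.im < ρ.im := by
    rintro z ((⟨τ, hτ, rfl⟩ | ⟨y, hy, rfl⟩) | ⟨τ, hτ, rfl⟩)
    · have h1 := h a (left_mem_Icc.2 hab)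
      have h2 := him a (left_mem_Icc.2 hab)
      simp only [vertPath_im]; nlinarith [hτ.2]
    · exact h y hy
    · have h1 := h b (right_mem_Icc.2 hab)
      have h2 := him b (right_mem_Icc.2 hab)
      simp only [vertPath_im]; nlinarith [hτ.2]
  have hge : ∀ z ∈ contour κ a b, 0 ≤ z.im := fun z hz => by
    rcases contour_im hab him hz with h | h
    · exact h.le
    · exact h.1
  have hρ : 0 < ρ.im := (him a (left_mem_Icc.2 hab)).trans (h a (left_mem_Icc.2 hab))
  have h1 : ∀ z ∈ contour κ a b, 0 < (Complex.I * (z - ρ)).re := fun z hz => by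
    have := hlt z hz; simp; linarith
  have h2 : ∀ z ∈ contour κ a b, 0 < (-Complex.I * (z - starRingEnd ℂ ρ)).re := fun z hz => by
    have := hge z hz; simp; linarith
  have n1 : ∀ z ∈ contour κ a b, z - ρ ≠ 0 := fun z hz h0 => by
    have := h1 z hz; rw [h0] at this; simp at this
  have n2 : ∀ z ∈ contour κ a b, z - starRingEnd ℂ ρ ≠ 0 := fun z hz h0 => by
    have := h2 z hz; rw [h0] at this; simp at this
  have e : conjQuad ρ = fun z : ℂ => (z - ρ) * (z - starRingEnd ℂ ρ) := rfl
  rw [e, contourVar_mul hab hκ (by fun_prop) (by fun_prop) n1 n2,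
    contourVar_of_mem_slitPlane Complex.I Complex.I_ne_zero hab hκ (by fun_prop) fun z hz => Or.inl (h1 z hz),
    contourVar_of_mem_slitPlane (-Complex.I) (by simp) hab hκ (by fun_prop) fun z hz => Or.inl (h2 z hz)]
  have key : ∀ x : ℝ, (-Complex.I * ((x : ℂ) - starRingEnd ℂ ρ)).arg = -(Complex.I * ((x : ℂ) - ρ)).arg := by
    intro x
    have : -Complex.I * ((x : ℂ) - starRingEnd ℂ ρ) = starRingEnd ℂ (Complex.I * ((x : ℂ) - ρ)) := by
      simp
    rw [this, Complex.arg_conj, if_neg]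
    intro h'
    have := (Complex.arg_eq_pi_iff.1 h').1
    simp at this; linarith
  rw [key, key]; ring

/-- Moving the zeros off to infinity or to the real axis. -/
theorem contourVar_conjQuad_homotopy (hab : a ≤ b) (hκ : ContinuousOn κ (Icc a b))
    {r : ℝ → ℂ} (hr : ContinuousOn r (Icc 0 1))
    (h0 : ∀ s ∈ Icc (0 : ℝ) 1, ∀ z ∈ contour κ a b, z ≠ r s ∧ z ≠ starRingEnd ℂ (r s)) :
    contourVar (conjQuad (r 1)) κ a b = contourVar (conjQuad (r 0)) κ a b := by
  have hcont : ∀ {X : Set (ℝ × ℝ)} {φ : ℝ × ℝ → ℂ}, ContinuousOn φ X → (∀ p ∈ X, p.1 ∈ Icc (0 : ℝ) 1) →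
      ContinuousOn (fun p => conjQuad (r p.1) (φ p)) X := fun hφ hX =>
    continuous_conjQuad.comp_continuousOn ((hr.comp continuousOn_fst hX).prodMk hφ)
  refine contourVar_homotopy (G := fun s => conjQuad (r s)) (K := fun _ => κ) hab (fun _ _ => rfl)
    (fun _ _ => rfl) (hcont (hκ.comp continuousOn_snd fun p hp => hp.2) fun p hp => hp.1)
    (fun s hs y hy => ?_)
    (hcont ((continuous_vertPath_right _).comp continuous_snd).continuousOn fun p hp => hp.1)
    (fun s hs τ hτ => ?_) (fun s _ => conjQuad_ofReal_im _ _)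
    (hcont ((continuous_vertPath_right _).comp continuous_snd).continuousOn fun p hp => hp.1)
    (fun s hs τ hτ => ?_) (fun s _ => conjQuad_ofReal_im _ _)
  · have := h0 s hs _ (mem_contour hy); exact conjQuad_ne_zero this.1 this.2
  · have := h0 s hs _ (vertPath_mem_contour_left hτ); exact conjQuad_ne_zero this.1 this.2
  · have := h0 s hs _ (vertPath_mem_contour_right hτ); exact conjQuad_ne_zero this.1 this.2

end

/-! ### The two sides of a parallel line -/

section

variable {L : Set ℂ}

/-- Near a point of the line the two sides are path connected. -/
theorem IsParallelLine.exists_joinedIn (hL : IsParallelLine L) {p : ℂ} (hp : p ∈ L) :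
    ∃ U : Set ℂ, IsOpen U ∧ p ∈ U ∧ (∀ s ∈ U, s ∉ L → (riemannZeta s).im ≠ 0) ∧ ∀ c : ℝ, ∀ s ∈ U, ∀ t ∈ U,
      0 < c * (riemannZeta s).im → 0 < c * (riemannZeta t).im → JoinedIn Lᶜ s t := by
  obtain ⟨r, hr, U, hU, hpU, -, μ, h1, h2, h3, h4, h5, -, h7, -⟩ := hL.exists_chart hp univ_mem
  refine ⟨U, hU, hpU, fun s hs hsL h => hsL ((h7 s hs).2 h), fun c s hs t ht hcs hct => ?_⟩
  set B := Metric.ball (riemannZeta p) r ∩ {w : ℂ | 0 < c * w.im} with hB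
  have hlin : IsLinearMap ℝ fun w : ℂ => c * w.im := (c • Complex.imLm).isLinear
  have hconv : Convex ℝ B := (convex_ball _ _).inter (convex_halfSpace_gt hlin 0)
  have hj := (hconv.isPathConnected ⟨_, h1 hs, hcs⟩).joinedIn _ ⟨h1 hs, hcs⟩ _ ⟨h1 ht, hct⟩
  have := hj.map_continuousOn (h5.mono inter_subset_left)
  rw [h3 s hs, h3 t ht] at this
  refine this.mono ?_
  rintro _ ⟨w, ⟨hw, hw0⟩, rfl⟩ hwL
  have := (h7 _ (h2 hw)).1 hwL
  rw [h4 w hw] at this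
  simp [this] at hw0

theorem IsParallelLine.frequently_im_pos (hL : IsParallelLine L) {p : ℂ} (hp : p ∈ L) {c : ℝ} (hc : c ≠ 0) :
    ∃ᶠ s in 𝓝 p, 0 < c * (riemannZeta s).im := by
  rw [frequently_iff]
  intro V hV
  obtain ⟨r, hr, U, hU, hpU, hUV, μ, h1, h2, h3, h4, -⟩ := hL.exists_chart hp hV
  have hw : riemannZeta p + ((r / 2 * SignType.sign c : ℝ) : ℂ) * Complex.I ∈ Metric.ball (riemannZeta p) r := by
    rw [Metric.mem_ball, dist_eq_norm, add_sub_cancel_left, norm_mul, Complex.norm_I, mul_one,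
      Complex.norm_real, Real.norm_eq_abs, abs_mul, abs_of_pos (half_pos hr)]
    rcases lt_or_gt_of_ne hc with h | h <;> simp [h] <;> linarith
  refine ⟨_, hUV (h2 hw), ?_⟩
  rw [h4 _ hw]
  have him := (hL.subset hp).2
  rcases lt_or_gt_of_ne hc with h | h
  · simp [him, h]; nlinarith
  · simp [him, h]; exact hr

/-- A set closed under joining off the line contains one side of the line all along the line, or
nowhere. -/
theorem IsParallelLine.eventually_mem_of_frequently (hL : IsParallelLine L) {V : Set ℂ}
    (hV : ∀ s ∈ V, ∀ t, JoinedIn Lᶜ s t → t ∈ V) {c : ℝ} (hc : c ≠ 0) {p : ℂ} (hp : p ∈ L)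
    (h : ∃ᶠ s in 𝓝 p, 0 < c * (riemannZeta s).im ∧ s ∈ V) {q : ℂ} (hq : q ∈ L) :
    ∀ᶠ s in 𝓝 q, 0 < c * (riemannZeta s).im → s ∈ V := by
  set G : ℂ → Prop := fun q => ∀ᶠ s in 𝓝 q, 0 < c * (riemannZeta s).im → s ∈ V with hG
  -- In a chart the chosen side is path connected off the line, so one of its points in V brings in
  -- all of them; the property is locally constant along the connected line.
  have hloc : ∀ p ∈ L, ∃ U : Set ℂ, IsOpen U ∧ p ∈ U ∧ ∀ q ∈ U, q ∈ L →
      (G q ↔ ∀ s ∈ U, 0 < c * (riemannZeta s).im → s ∈ V) ∧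
      ((∃ᶠ s in 𝓝 q, 0 < c * (riemannZeta s).im ∧ s ∈ V) → G q) := by
    intro p hp
    obtain ⟨U, hU, hpU, -, hj⟩ := hL.exists_joinedIn hp
    refine ⟨U, hU, hpU, fun q hqU hqL => ?_⟩
    have h1 : (∀ s ∈ U, 0 < c * (riemannZeta s).im → s ∈ V) → G q := fun h =>
      Filter.Eventually.mono (hU.mem_nhds hqU) fun s hs hpos => h s hs hpos
    have h2 : (∃ᶠ s in 𝓝 q, 0 < c * (riemannZeta s).im ∧ s ∈ V) →
        ∀ s ∈ U, 0 < c * (riemannZeta s).im → s ∈ V := fun h s hs hpos => by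
      obtain ⟨t, ⟨ht1, ht2⟩, htU⟩ := (h.and_eventually (hU.mem_nhds hqU)).exists
      exact hV t ht2 s (hj c t htU s hs ht1 hpos)
    refine ⟨⟨fun h => h2 ?_, h1⟩, fun h => h1 (h2 h)⟩
    exact ((hL.frequently_im_pos hqL hc).and_eventually h).mono fun s hs => ⟨hs.1, hs.2 hs.1⟩
  have hGp : G p := by
    obtain ⟨U, hU, hpU, hh⟩ := hloc p hp
    exact (hh p hpU hp).2 h
  refine (hL.isPreconnected.induction₂ (fun p q => G p ↔ G q) (fun x hx => ?_)
    (fun x y z _ _ _ h1 h2 => h1.trans h2) (fun x y _ _ h => h.symm) hp hq).1 hGp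
  obtain ⟨U, hU, hpU, hh⟩ := hloc x hx
  filter_upwards [self_mem_nhdsWithin, mem_nhdsWithin_of_mem_nhds (hU.mem_nhds hpU)] with y hyL hyU
  exact (hh x hpU hx).1.trans (hh y hyU hyL).1.symm

/-- A parametrized parallel line through `-1 + iT` with a base point `curve y₀` far to the right. -/
structure LineFrame (L : Set ℂ) (T : ℝ) extends LineParam L where
  y₀ : ℝ
  yP : ℝ
  y₀_mem : y₀ ∈ J
  yP_mem : yP ∈ J
  lt : y₀ < yP
  T_pos : 0 < T
  curve_yP : curve yP = -1 + T * Complex.I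
  re_lt : ∀ y ∈ J, y < y₀ → (curve y₀).re < (curve y).re
  lt_re : ∀ y ∈ J, y₀ < y → (curve y).re < (curve y₀).re
  deriv_neg : (ε / deriv riemannZeta (curve y₀)).re < 0
  one_lt_re : 1 < (curve y₀).re
  norm_lt : ∀ s : ℂ, (curve y₀).re ≤ s.re → ‖riemannZeta s - 1‖ < 1
  im_pos : ∀ s ∈ L, 0 < s.im
  closed : IsClosed L
  isLine : IsParallelLine L

theorem IsParallelLine.nonempty_lineFrame (hL : IsParallelLine L) {T : ℝ} (hT : 0 < T)
    (hTL : (-1 + T * Complex.I : ℂ) ∈ L) : Nonempty (LineFrame L T) := by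
  obtain ⟨Λ⟩ := hL.nonempty_lineParam
  have hPim : 0 < (-1 + T * Complex.I : ℂ).im := by simpa using hT
  have hpos : ∀ s ∈ L, 0 < s.im := fun s hs => hL.im_pos hTL hPim hs
  obtain ⟨M, hM⟩ := Λ.exists_re_deriv_neg
  obtain ⟨M', hM'⟩ := exists_norm_zeta_sub_one_lt one_pos
  obtain ⟨s, hs, hsM⟩ := hL.comesFromRight (max (max M M') 1)
  obtain ⟨y₀, hy₀, rfl⟩ := Λ.surj s hs
  obtain ⟨yP, hyP, hP⟩ := Λ.surj _ hTL
  have h1 : 1 < (Λ.curve y₀).re := (le_max_right _ _).trans_lt hsM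
  have h2 : M < (Λ.curve y₀).re := ((le_max_left _ _).trans (le_max_left _ _)).trans_lt hsM
  have h3 : M' < (Λ.curve y₀).re := ((le_max_right _ _).trans (le_max_left _ _)).trans_lt hsM
  have hPre : (Λ.curve yP).re = -1 := by rw [hP]; simp
  refine ⟨{ Λ with
    y₀ := y₀, yP := yP, y₀_mem := hy₀, yP_mem := hyP, T_pos := hT, curve_yP := hP
    lt := ?_
    re_lt := fun y hy h => Λ.re_lt_of_deriv_neg hM hy hy₀ h h2.le
    lt_re := fun y hy h => ?_
    deriv_neg := hM y₀ hy₀ h2.le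
    one_lt_re := h1
    norm_lt := fun s hs => hM' s (h3.le.trans hs)
    im_pos := hpos
    closed := hL.isClosed hTL hPim.ne'
    isLine := hL }⟩
  · by_contra! h
    rcases h.eq_or_lt with rfl | h
    · linarith
    · linarith [Λ.re_lt_neg_one hpos hyP hy₀ hPre.le h]
  · by_contra! h'
    exact absurd (Λ.re_lt_of_deriv_neg hM hy₀ hy h (h2.le.trans h')) (not_lt.2 h')

namespace LineFrame

variable {T : ℝ} (Φ : LineFrame L T)

theorem ε_ne_zero : Φ.ε ≠ 0 := by rcases Φ.sign with h | h <;> rw [h] <;> norm_num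

theorem eq_of_re_eq {s : ℂ} (hs : s ∈ L) (h : s.re = (Φ.curve Φ.y₀).re) : s = Φ.curve Φ.y₀ := by
  obtain ⟨y, hy, rfl⟩ := Φ.surj s hs
  rcases lt_trichotomy y Φ.y₀ with h' | rfl | h'
  · exact absurd h (Φ.re_lt y hy h').ne'
  · rfl
  · exact absurd h (Φ.lt_re y hy h').ne

theorem mem_belowLine_of_joinedIn {s t : ℂ} (hs : s ∈ belowLine L) (h : JoinedIn Lᶜ s t) :
    t ∈ belowLine L := by
  obtain ⟨x, hx⟩ := hs
  exact ⟨x, h.symm.trans hx⟩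

/-- The points joined off the line to the vertical ray above the base point. -/
def above : Set ℂ :=
  {s | ∃ t : ℂ, JoinedIn Lᶜ s t ∧ t.re = (Φ.curve Φ.y₀).re ∧ (Φ.curve Φ.y₀).im < t.im}

theorem vertical_mem {t : ℝ} (ht : t ≠ (Φ.curve Φ.y₀).im) :
    ((Φ.curve Φ.y₀).re + t * Complex.I : ℂ) ∉ L := fun h => ht (by
  have := Φ.eq_of_re_eq h (by simp)
  simpa using congrArg Complex.im this)

theorem hasDerivAt_vertical : HasDerivAt
    (fun t : ℝ => Φ.ε * (riemannZeta ((Φ.curve Φ.y₀).re + t * Complex.I)).im)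
    (Φ.ε * (deriv riemannZeta (Φ.curve Φ.y₀)).re) (Φ.curve Φ.y₀).im := by
  set p := Φ.curve Φ.y₀ with hp
  have hpL := Φ.mem _ Φ.y₀_mem
  have e : (p.re + p.im * Complex.I : ℂ) = p := Complex.re_add_im p
  have h1 : HasDerivAt riemannZeta (deriv riemannZeta p) (p.re + p.im * Complex.I) := by
    rw [e]; exact (differentiableAt_riemannZeta (Φ.isLine.subset hpL).1).hasDerivAt
  have h2 : HasDerivAt (fun t : ℝ => (p.re + t * Complex.I : ℂ)) Complex.I p.im := by
    simpa using ((Complex.ofRealCLM.hasDerivAt (x := p.im)).mul_const Complex.I).const_add (p.re : ℂ)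
  have h3 := Complex.imCLM.hasFDerivAt.comp_hasDerivAt p.im (h1.comp p.im h2)
  have h4 := h3.const_mul Φ.ε
  refine h4.congr_deriv ?_
  simp

theorem deriv_vertical_neg : Φ.ε * (deriv riemannZeta (Φ.curve Φ.y₀)).re < 0 := by
  have h := Φ.deriv_neg
  rw [div_eq_mul_inv, Complex.re_ofReal_mul, Complex.inv_re, ← mul_div_assoc] at h
  have hN : 0 < Complex.normSq (deriv riemannZeta (Φ.curve Φ.y₀)) :=
    Complex.normSq_pos.2 (Φ.isLine.deriv_ne_zero _ (Φ.mem _ Φ.y₀_mem))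
  by_contra! h'
  exact absurd h (not_lt.2 (div_nonneg h' hN.le))

/-- The upward derivative of Im ζ is Re ζ', and Re(ε/ζ') < 0 at the base point gives ε Re ζ' < 0. So
ε Im ζ is positive just below the base point and negative just above it. -/
theorem vertical_sign : (∀ᶠ t : ℝ in 𝓝[<] (Φ.curve Φ.y₀).im,
      0 < Φ.ε * (riemannZeta ((Φ.curve Φ.y₀).re + t * Complex.I)).im) ∧
    ∀ᶠ t : ℝ in 𝓝[>] (Φ.curve Φ.y₀).im,
      0 < -Φ.ε * (riemannZeta ((Φ.curve Φ.y₀).re + t * Complex.I)).im := by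
  set p := Φ.curve Φ.y₀ with hp
  have h0 : (riemannZeta (p.re + p.im * Complex.I)).im = 0 := by
    rw [Complex.re_add_im]; exact (Φ.isLine.subset (Φ.mem _ Φ.y₀_mem)).2
  have h := (hasDerivAt_iff_tendsto_slope.1 Φ.hasDerivAt_vertical).eventually
    (gt_mem_nhds Φ.deriv_vertical_neg)
  constructor
  · filter_upwards [h.filter_mono (nhdsWithin_mono _ fun x hx => ne_of_lt hx), self_mem_nhdsWithin] with t ht ht'
    rw [slope_def_field, h0] at ht
    have ht' : t < p.im := ht'
    by_contra! h1
    exact absurd ht (not_lt.2 (div_nonneg_of_nonpos (by linarith) (by linarith)))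
  · filter_upwards [h.filter_mono (nhdsWithin_mono _ fun x hx => ne_of_gt hx), self_mem_nhdsWithin] with t ht ht'
    rw [slope_def_field, h0] at ht
    have ht' : p.im < t := ht'
    by_contra! h1
    exact absurd ht (not_lt.2 (div_nonneg (by linarith) (by linarith)))

theorem tendsto_vertical {F : Filter ℝ} (hF : F ≤ 𝓝 (Φ.curve Φ.y₀).im) :
    Tendsto (fun t : ℝ => ((Φ.curve Φ.y₀).re + t * Complex.I : ℂ)) F (𝓝 (Φ.curve Φ.y₀)) := by
  have : Continuous fun t : ℝ => ((Φ.curve Φ.y₀).re + t * Complex.I : ℂ) := by fun_prop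
  have := this.tendsto (Φ.curve Φ.y₀).im
  rw [Complex.re_add_im] at this
  exact this.mono_left hF

/-- Just below the base point the vertical segment to the real axis misses the line, which meets
that vertical only once; the side found there propagates along the whole line. -/
theorem eventually_mem_belowLine {q : ℂ} (hq : q ∈ L) :
    ∀ᶠ s in 𝓝 q, 0 < Φ.ε * (riemannZeta s).im → s ∈ belowLine L := by
  refine Φ.isLine.eventually_mem_of_frequently
    (fun s hs t h => mem_belowLine_of_joinedIn hs h) Φ.ε_ne_zero (Φ.mem _ Φ.y₀_mem) ?_ hq
  refine (Φ.tendsto_vertical (F := 𝓝[<] (Φ.curve Φ.y₀).im) nhdsWithin_le_nhds).frequently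
    (Eventually.frequently ?_)
  have him := Φ.im_pos _ (Φ.mem _ Φ.y₀_mem)
  filter_upwards [Φ.vertical_sign.1, Ioo_mem_nhdsLT him] with t ht ht'
  refine ⟨ht, (Φ.curve Φ.y₀).re, JoinedIn.ofLine (f := fun τ : ℝ => ((Φ.curve Φ.y₀).re + ((1 - τ) * t : ℝ) * Complex.I : ℂ))
    (by fun_prop) (by simp) (by simp) ?_⟩
  rintro _ ⟨τ, hτ, rfl⟩
  refine Φ.vertical_mem (ne_of_lt ?_)
  have := hτ.1; have := ht'.1; have := ht'.2
  nlinarith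

theorem eventually_mem_above {q : ℂ} (hq : q ∈ L) :
    ∀ᶠ s in 𝓝 q, 0 < -Φ.ε * (riemannZeta s).im → s ∈ Φ.above := by
  refine Φ.isLine.eventually_mem_of_frequently
    (V := Φ.above) (fun s ⟨τ, h1, h2⟩ t h => ⟨τ, h.symm.trans h1, h2⟩) (neg_ne_zero.2 Φ.ε_ne_zero) (Φ.mem _ Φ.y₀_mem) ?_ hq
  refine (Φ.tendsto_vertical (F := 𝓝[>] (Φ.curve Φ.y₀).im) nhdsWithin_le_nhds).frequently
    (Eventually.frequently ?_)
  filter_upwards [Φ.vertical_sign.2, self_mem_nhdsWithin] with t ht ht'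
  have ht' : (Φ.curve Φ.y₀).im < t := ht'
  exact ⟨ht, _, JoinedIn.refl (Φ.vertical_mem ht'.ne'), by simp, by simpa using ht'⟩

/-- Every point of the upper half plane off the line lies on one of the two sides. -/
theorem mem_belowLine_or_above {s : ℂ} (hs : s ∉ L) : s ∈ belowLine L ∨ s ∈ Φ.above := by
  by_cases h : ∃ τ ∈ Icc (0 : ℝ) 1, vertPath s τ ∈ L
  · have hK : IsCompact (Icc (0 : ℝ) 1 ∩ vertPath s ⁻¹' L) :=
      isCompact_Icc.inter_right (Φ.closed.preimage (continuous_vertPath_right s))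
    obtain ⟨τ, ⟨hτ, hτL⟩, hmax⟩ := hK.exists_isGreatest (let ⟨τ, h1, h2⟩ := h; ⟨τ, h1, h2⟩)
    have hτ1 : τ < 1 := lt_of_le_of_ne hτ.2 fun h => hs (by
      have : vertPath s τ ∈ L := hτL
      rwa [h, vertPath_one] at this)
    obtain ⟨U, hU, hpU, hne, -⟩ := Φ.isLine.exists_joinedIn hτL
    have hev : ∀ᶠ σ in 𝓝 τ, vertPath s σ ∈ U ∧
        (0 < Φ.ε * (riemannZeta (vertPath s σ)).im → vertPath s σ ∈ belowLine L) ∧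
        (0 < -Φ.ε * (riemannZeta (vertPath s σ)).im → vertPath s σ ∈ Φ.above) :=
      ((continuous_vertPath_right s).tendsto τ).eventually
        (Filter.Eventually.and (hU.mem_nhds hpU) ((Φ.eventually_mem_belowLine hτL).and (Φ.eventually_mem_above hτL)))
    obtain ⟨σ, ⟨h1, h2, h3⟩, h4⟩ :=
      ((hev.filter_mono nhdsWithin_le_nhds).and (Ioo_mem_nhdsGT hτ1)).exists
    have hnot : ∀ x ∈ Icc σ 1, vertPath s x ∉ L := fun x hx hxL =>
      absurd (hmax ⟨⟨hτ.1.trans (h4.1.le.trans hx.1), hx.2⟩, hxL⟩) (not_le.2 (h4.1.trans_le hx.1))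
    have hj : JoinedIn Lᶜ (vertPath s σ) s := by
      refine JoinedIn.ofLine (f := fun x : ℝ => vertPath s (σ + x * (1 - σ)))
        ((continuous_vertPath_right s).comp (by fun_prop)).continuousOn (by simp) (by simp) ?_
      rintro _ ⟨x, hx, rfl⟩
      exact hnot _ ⟨by nlinarith [hx.1, h4.2], by nlinarith [hx.2, h4.2]⟩
    have h0 := mul_ne_zero Φ.ε_ne_zero (hne _ h1 (hnot σ ⟨le_rfl, h4.2.le⟩))
    rcases lt_or_gt_of_ne h0 with h | h
    · obtain ⟨t, ht, ht'⟩ := h3 (by linarith)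
      exact Or.inr ⟨t, hj.symm.trans ht, ht'⟩
    · exact Or.inl (mem_belowLine_of_joinedIn (h2 h) hj)
  · push Not at h
    refine Or.inl ⟨s.re, JoinedIn.ofLine (f := fun τ : ℝ => vertPath s (1 - τ))
      ((continuous_vertPath_right s).comp (by fun_prop)).continuousOn (by simp) (by simp) ?_⟩
    rintro _ ⟨τ, hτ, rfl⟩
    exact h _ ⟨by linarith [hτ.2], by linarith [hτ.1]⟩

end LineFrame

end

/-! ### The variation of the argument about points below and above the line -/

namespace LineFrame

variable {L : Set ℂ} {T : ℝ} (Φ : LineFrame L T)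

theorem re_yP : (Φ.curve Φ.yP).re = -1 := by rw [Φ.curve_yP]; simp

theorem Icc_subset {a b : ℝ} (ha : a ∈ Φ.J) (hb : b ∈ Φ.J) : Icc a b ⊆ Φ.J := Φ.ordConnected.out ha hb

theorem continuousOn_curve : ContinuousOn Φ.curve Φ.J := fun _ hy => (Φ.continuousAt hy).continuousWithinAt

theorem curve_im_pos {y : ℝ} (hy : y ∈ Φ.J) : 0 < (Φ.curve y).im := Φ.im_pos _ (Φ.mem y hy)

theorem re_y₀_le {y : ℝ} (hy : y ∈ Φ.J) (h : y ≤ Φ.y₀) : (Φ.curve Φ.y₀).re ≤ (Φ.curve y).re := by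
  rcases h.eq_or_lt with rfl | h
  · exact le_rfl
  · exact (Φ.re_lt y hy h).le

theorem re_le_neg_one {y : ℝ} (hy : y ∈ Φ.J) (h : Φ.yP ≤ y) : (Φ.curve y).re ≤ -1 := by
  rcases h.eq_or_lt with rfl | h
  · exact Φ.re_yP.le
  · exact (Φ.re_lt_neg_one Φ.im_pos Φ.yP_mem hy Φ.re_yP.le h).le

theorem exists_far (B : ℝ) : ∃ a ∈ Φ.J, ∃ b ∈ Φ.J, a ≤ Φ.y₀ ∧ Φ.yP ≤ b ∧ B < (Φ.curve a).re ∧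
    (Φ.curve b).re < -B := by
  obtain ⟨s, hs, hsB⟩ := Φ.isLine.comesFromRight (max B (Φ.curve Φ.y₀).re)
  obtain ⟨a, ha, rfl⟩ := Φ.surj s hs
  obtain ⟨b, hb, hlt, hbB⟩ := (Φ.left_end Φ.isLine Φ.T_pos Φ.yP_mem Φ.curve_yP).2.2 (-B)
  refine ⟨a, ha, b, hb, ?_, hlt.le, (le_max_left _ _).trans_lt hsB, hbB⟩
  by_contra! h
  linarith [Φ.lt_re a ha h, (le_max_right B (Φ.curve Φ.y₀).re).trans_lt hsB]

theorem vertPath_ne {z ρ : ℂ} (h : z.re ≠ ρ.re) (τ : ℝ) :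
    vertPath z τ ≠ ρ ∧ vertPath z τ ≠ starRingEnd ℂ ρ :=
  ⟨fun e => h (by simpa using congrArg Complex.re e), fun e => h (by simpa using congrArg Complex.re e)⟩

theorem curve_ne {y : ℝ} (hy : y ∈ Φ.J) {ρ : ℂ} (hρ : ρ ∉ L) (him : 0 ≤ ρ.im) :
    Φ.curve y ≠ ρ ∧ Φ.curve y ≠ starRingEnd ℂ ρ := by
  refine ⟨fun e => hρ (e ▸ Φ.mem y hy), fun e => ?_⟩
  have := Φ.curve_im_pos hy
  rw [e, Complex.conj_im] at this
  linarith

theorem contourVar_conjQuad_shift {a b : ℝ} (hab : a ≤ b) (ha : a ∈ Φ.J) (hb : b ∈ Φ.J) {ρ : ℂ}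
    (h : ∀ y ∈ Icc a b, (Φ.curve y).re ≠ ρ.re) : contourVar (conjQuad ρ) Φ.curve a b = 0 := by
  refine contourVar_eq_zero hab ?_ (fun y hy τ _ => ?_) fun y _ => conjQuad_ofReal_im _ _
  · refine (continuous_conjQuad_right ρ).comp_continuousOn (continuous_vertPath.comp_continuousOn
      (f := fun p : ℝ × ℝ => (Φ.curve p.1, p.2)) ?_)
    exact ((Φ.continuousOn_curve.mono (Φ.Icc_subset ha hb)).comp continuousOn_fst fun p hp => hp.1).prodMk
      continuousOn_snd
  · obtain ⟨h1, h2⟩ := vertPath_ne (h y hy) τ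
    exact conjQuad_ne_zero h1 h2

/-- The added pieces of the line stay on Re s ≥ Re of the base point and on Re s ≤ -1, so no
vertical under them meets ρ or its conjugate. With the ends far out, a zero can be moved widely
without meeting the end verticals. -/
theorem contourVar_conjQuad_far {a b : ℝ} (ha : a ∈ Φ.J) (hb : b ∈ Φ.J) (hay : a ≤ Φ.y₀)
    (hby : Φ.yP ≤ b) {ρ : ℂ} (hρ : ρ ∉ L) (him : 0 ≤ ρ.im) (h1 : -1 < ρ.re)
    (h2 : ρ.re < (Φ.curve Φ.y₀).re) :
    contourVar (conjQuad ρ) Φ.curve a b = contourVar (conjQuad ρ) Φ.curve Φ.y₀ Φ.yP := by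
  have hsub := Φ.Icc_subset ha hb
  have hc : ContinuousOn (fun y => conjQuad ρ (Φ.curve y)) (Icc a b) :=
    (continuous_conjQuad_right ρ).comp_continuousOn (Φ.continuousOn_curve.mono hsub)
  have h0 : ∀ y ∈ Icc a b, conjQuad ρ (Φ.curve y) ≠ 0 := fun y hy => by
    obtain ⟨h1, h2⟩ := Φ.curve_ne (hsub hy) hρ him
    exact conjQuad_ne_zero h1 h2
  rw [← contourVar_add_adjacent hay (Φ.lt.le.trans hby) hc h0,
    ← contourVar_add_adjacent Φ.lt.le hby (hc.mono (Icc_subset_Icc_left hay))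
      (fun y hy => h0 y (Icc_subset_Icc_left hay hy)),
    Φ.contourVar_conjQuad_shift hay ha Φ.y₀_mem fun y hy => ?_,
    Φ.contourVar_conjQuad_shift hby Φ.yP_mem hb fun y hy => ?_, zero_add, add_zero]
  · exact ((Φ.re_le_neg_one (Φ.Icc_subset Φ.yP_mem hb hy) hy.1).trans_lt h1).ne
  · exact (h2.trans_le (Φ.re_y₀_le (Φ.Icc_subset ha Φ.y₀_mem hy) hy.2)).ne'

/-- The variation is constant while the zero moves off the line in the closed upper half plane. -/
theorem contourVar_conjQuad_move {r : ℝ → ℂ} (hr : ContinuousOn r (Icc 0 1))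
    (hL : ∀ s ∈ Icc (0 : ℝ) 1, r s ∉ L) (him : ∀ s ∈ Icc (0 : ℝ) 1, 0 ≤ (r s).im)
    {a b : ℝ} (hab : a ≤ b) (ha : a ∈ Φ.J) (hb : b ∈ Φ.J)
    (hra : ∀ s ∈ Icc (0 : ℝ) 1, (r s).re < (Φ.curve a).re)
    (hrb : ∀ s ∈ Icc (0 : ℝ) 1, (Φ.curve b).re < (r s).re) :
    contourVar (conjQuad (r 1)) Φ.curve a b = contourVar (conjQuad (r 0)) Φ.curve a b := by
  refine contourVar_conjQuad_homotopy hab (Φ.continuousOn_curve.mono (Φ.Icc_subset ha hb)) hr ?_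
  rintro s hs z ((⟨τ, -, rfl⟩ | ⟨y, hy, rfl⟩) | ⟨τ, -, rfl⟩)
  · exact vertPath_ne (hra s hs).ne' τ
  · exact Φ.curve_ne (Φ.Icc_subset ha hb hy) (hL s hs) (him s hs)
  · exact vertPath_ne (hrb s hs).ne τ

theorem exists_far_of_path {r : ℝ → ℂ} (hr : ContinuousOn r (Icc 0 1)) : ∃ a ∈ Φ.J, ∃ b ∈ Φ.J,
    a ≤ Φ.y₀ ∧ Φ.yP ≤ b ∧ (∀ s ∈ Icc (0 : ℝ) 1, (r s).re < (Φ.curve a).re) ∧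
    ∀ s ∈ Icc (0 : ℝ) 1, (Φ.curve b).re < (r s).re := by
  obtain ⟨C, hC⟩ := isCompact_Icc.exists_bound_of_continuousOn hr
  obtain ⟨a, ha, b, hb, h1, h2, h3, h4⟩ := Φ.exists_far C
  refine ⟨a, ha, b, hb, h1, h2, fun s hs => ?_, fun s hs => ?_⟩
  · linarith [(abs_le.1 ((Complex.abs_re_le_norm _).trans (hC s hs))).2]
  · linarith [(abs_le.1 ((Complex.abs_re_le_norm _).trans (hC s hs))).1]

theorem _root_.JoinedIn.exists_continuousOn {F : Set ℂ} {s t : ℂ} (h : JoinedIn F s t) :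
    ∃ r : ℝ → ℂ, Continuous r ∧ r 0 = s ∧ r 1 = t ∧ ∀ x ∈ Icc (0 : ℝ) 1, r x ∈ F := by
  obtain ⟨γ, hγ⟩ := h
  refine ⟨γ.extend, γ.continuous_extend, γ.extend_zero, γ.extend_one, fun x hx => ?_⟩
  rw [γ.extend_apply hx]
  exact hγ _

/-- Move ρ along its path to the real axis and stop at the first hit: until then it is in the closed
upper half-plane, so neither it nor its conjugate meets the curve. There it is a double real zero,
contributing two half turns. -/
theorem contourVar_conjQuad_of_mem_belowLine {ρ : ℂ} (hρ : ρ ∈ belowLine L) (him : 0 < ρ.im)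
    (h1 : -1 < ρ.re) (h2 : ρ.re < (Φ.curve Φ.y₀).re) :
    contourVar (conjQuad ρ) Φ.curve Φ.y₀ Φ.yP = 2 * Real.pi := by
  obtain ⟨x, hx⟩ := hρ
  obtain ⟨g, hg, rfl, hg1, hgL⟩ := hx.exists_continuousOn
  have hgi : Continuous fun t => (g t).im := Complex.continuous_im.comp hg
  have hK : IsCompact (Icc (0 : ℝ) 1 ∩ {t | (g t).im = 0}) :=
    isCompact_Icc.inter_right (isClosed_eq hgi continuous_const)
  obtain ⟨t₁, ⟨ht₁, ht₁0⟩, hmin⟩ := hK.exists_isLeast ⟨1, ⟨zero_le_one, le_rfl⟩, by simp [hg1]⟩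
  have ht₁0 : (g t₁).im = 0 := ht₁0
  have hnn : ∀ t ∈ Icc 0 t₁, 0 ≤ (g t).im := by
    intro t ht
    by_contra! h
    obtain ⟨u, hu, hu0⟩ := intermediate_value_Icc' ht.1 hgi.continuousOn
      (show (0 : ℝ) ∈ Icc _ _ from ⟨h.le, him.le⟩)
    have := hmin ⟨⟨hu.1, hu.2.trans (ht.2.trans ht₁.2)⟩, hu0⟩
    have : t = t₁ := le_antisymm ht.2 (this.trans hu.2)
    rw [this, ht₁0] at h
    exact lt_irrefl _ h
  set r : ℝ → ℂ := fun s => g (s * t₁) with hr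
  have hrc : Continuous r := hg.comp (by fun_prop)
  have hmem : ∀ s ∈ Icc (0 : ℝ) 1, s * t₁ ∈ Icc 0 t₁ := fun s hs =>
    ⟨mul_nonneg hs.1 ht₁.1, mul_le_of_le_one_left ht₁.1 hs.2⟩
  have hr0 : r 0 = g 0 := by simp [hr]
  have hr1 : r 1 = ((g t₁).re : ℂ) := Complex.ext (by simp [hr]) (by simp [hr, ht₁0])
  obtain ⟨a, ha, b, hb, hay, hby, hra, hrb⟩ := Φ.exists_far_of_path hrc.continuousOn
  have hab : a ≤ b := hay.trans (Φ.lt.le.trans hby)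
  have hrL : ∀ s ∈ Icc (0 : ℝ) 1, r s ∉ L := fun s hs =>
    hgL _ ⟨(hmem s hs).1, (hmem s hs).2.trans ht₁.2⟩
  have hmove := Φ.contourVar_conjQuad_move hrc.continuousOn hrL (fun s hs => hnn _ (hmem s hs)) hab ha hb hra hrb
  have i1 : (1 : ℝ) ∈ Icc (0 : ℝ) 1 := ⟨zero_le_one, le_rfl⟩
  rw [← Φ.contourVar_conjQuad_far ha hb hay hby (hgL 0 ⟨le_rfl, zero_le_one⟩) him.le h1 h2, ← hr0, ← hmove, hr1]
  refine contourVar_conjQuad_ofReal hab (Φ.continuousOn_curve.mono (Φ.Icc_subset ha hb))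
    (fun y hy => Φ.curve_im_pos (Φ.Icc_subset ha hb hy)) ?_ ?_
  · have := hra 1 i1; simpa [hr] using this
  · have := hrb 1 i1; simpa [hr] using this

/-- A path to the vertical ray above the base point cannot cross the real axis, since ρ would then
be below the line. From the ray, which misses the line, the zero is lifted above the whole curve,
where it contributes nothing. -/
theorem contourVar_conjQuad_of_notMem {ρ : ℂ} (hρ : ρ ∉ belowLine L) (hρL : ρ ∉ L) (him : 0 < ρ.im)
    (h1 : -1 < ρ.re) (h2 : ρ.re < (Φ.curve Φ.y₀).re) :
    contourVar (conjQuad ρ) Φ.curve Φ.y₀ Φ.yP = 0 := by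
  obtain ⟨t, hj, hre, htim⟩ := (Φ.mem_belowLine_or_above hρL).resolve_left hρ
  obtain ⟨r, hr, rfl, rfl, hrL⟩ := hj.exists_continuousOn
  have hri : Continuous fun t => (r t).im := Complex.continuous_im.comp hr
  have hpos : ∀ s ∈ Icc (0 : ℝ) 1, 0 ≤ (r s).im := by
    intro s hs
    by_contra! h
    obtain ⟨u, hu, hu0⟩ := intermediate_value_Icc' hs.1 hri.continuousOn
      (show (0 : ℝ) ∈ Icc _ _ from ⟨h.le, him.le⟩)
    refine hρ ⟨(r u).re, ?_⟩
    have : r u = ((r u).re : ℂ) := Complex.ext (by simp) (by simpa using hu0)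
    rw [← this]
    refine JoinedIn.ofLine (f := fun s => r (s * u)) (hr.comp (by fun_prop)).continuousOn (by simp) (by simp) ?_
    rintro _ ⟨s', hs', rfl⟩
    exact hrL _ ⟨mul_nonneg hs'.1 hu.1, (mul_le_of_le_one_left hu.1 hs'.2).trans (hu.2.trans hs.2)⟩
  obtain ⟨a, ha, b, hb, hay, hby, hra, hrb⟩ := Φ.exists_far_of_path hr.continuousOn
  have hab : a ≤ b := hay.trans (Φ.lt.le.trans hby)
  have hsub := Φ.Icc_subset ha hb
  have i1 : (1 : ℝ) ∈ Icc (0 : ℝ) 1 := ⟨zero_le_one, le_rfl⟩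
  obtain ⟨C, hC⟩ := isCompact_Icc.exists_bound_of_continuousOn (Φ.continuousOn_curve.mono hsub)
  rw [← Φ.contourVar_conjQuad_far ha hb hay hby hρL him.le h1 h2,
    ← Φ.contourVar_conjQuad_move hr.continuousOn hrL hpos hab ha hb hra hrb]
  set r' : ℝ → ℂ := fun s => r 1 + (s * (|C| + 1) : ℝ) * Complex.I with hr'
  have hr're : ∀ s, (r' s).re = (r 1).re := fun s => by simp [hr']
  have hr'im : ∀ s, (r' s).im = (r 1).im + s * (|C| + 1) := fun s => by simp [hr']
  have hnn : ∀ s ∈ Icc (0 : ℝ) 1, 0 ≤ s * (|C| + 1) := fun s hs => mul_nonneg hs.1 (by positivity)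
  have hmove := Φ.contourVar_conjQuad_move (r := r') (by fun_prop) (fun s hs => ?_)
    (fun s hs => ?_) hab ha hb (fun s _ => by rw [hr're]; exact hra 1 i1)
    (fun s _ => by rw [hr're]; exact hrb 1 i1)
  · have e0 : r' 0 = r 1 := by simp [hr']
    rw [← e0, ← hmove]
    refine contourVar_conjQuad_high hab (Φ.continuousOn_curve.mono hsub)
      (fun y hy => Φ.curve_im_pos (hsub hy)) fun y hy => ?_
    rw [hr'im]
    have h3 := (abs_le.1 ((Complex.abs_im_le_norm _).trans (hC y hy))).2
    have h4 := hpos 1 i1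
    linarith [le_abs_self C]
  · intro hm
    have := Φ.eq_of_re_eq hm (by rw [hr're]; exact hre)
    have h3 := hr'im s
    rw [this] at h3
    linarith [hnn s hs]
  · rw [hr'im]
    linarith [hnn s hs, hpos 1 i1]

end LineFrame

/-! ### Pushing the curve off a zero on the line -/

namespace LineFrame

variable {L : Set ℂ} {T : ℝ} (Φ : LineFrame L T)

theorem zero_re_mem {ρ : ℂ} (h : riemannZeta ρ = 0) (him : 0 < ρ.im) : 0 < ρ.re ∧ ρ.re < 1 := by
  constructor
  · by_contra! h'
    exact zeta_ne_zero_of_re_nonpos h' him.ne' h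
  · by_contra! h'
    exact riemannZeta_ne_zero_of_one_le_re h' h

/-- A curve from the base point to `-1 + iT` that passes above all the zeros of `ζ` that lie below or
on the line, and below the other zeros; `θ` is the variation of the argument of `ζ` along it. -/
structure IsSeparating (κ : ℝ → ℂ) (θ : ℝ) : Prop where
  continuousOn : ContinuousOn κ (Icc Φ.y₀ Φ.yP)
  left : κ Φ.y₀ = Φ.curve Φ.y₀
  right : κ Φ.yP = Φ.curve Φ.yP
  im_pos : ∀ y ∈ Icc Φ.y₀ Φ.yP, 0 < (κ y).im
  lt_re : ∀ y ∈ Icc Φ.y₀ Φ.yP, -2 < (κ y).re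
  ne_zero : ∀ y ∈ Icc Φ.y₀ Φ.yP, riemannZeta (κ y) ≠ 0
  argVar_eq : argVar (fun y => riemannZeta (κ y)) Φ.y₀ Φ.yP = θ
  below : ∀ ρ : ℂ, riemannZeta ρ = 0 → 0 < ρ.im → ρ ∈ belowLine L ∪ L →
    contourVar (conjQuad ρ) κ Φ.y₀ Φ.yP = 2 * Real.pi
  above : ∀ ρ : ℂ, riemannZeta ρ = 0 → 0 < ρ.im → ρ ∉ belowLine L ∪ L →
    contourVar (conjQuad ρ) κ Φ.y₀ Φ.yP = 0

theorem Icc_subset_J : Icc Φ.y₀ Φ.yP ⊆ Φ.J := Φ.Icc_subset Φ.y₀_mem Φ.yP_mem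

theorem neg_one_le_re {y : ℝ} (hy : y ∈ Icc Φ.y₀ Φ.yP) : -1 ≤ (Φ.curve y).re := by
  rcases hy.2.eq_or_lt with rfl | h
  · exact Φ.re_yP.ge
  · by_contra! h'
    linarith [Φ.re_lt_neg_one Φ.im_pos (Φ.Icc_subset_J hy) Φ.yP_mem h'.le h, Φ.re_yP]

theorem isSeparating_curve (h : ∀ s ∈ L, riemannZeta s ≠ 0) : Φ.IsSeparating Φ.curve 0 where
  continuousOn := Φ.continuousOn_curve.mono Φ.Icc_subset_J
  left := rfl
  right := rfl
  im_pos y hy := Φ.curve_im_pos (Φ.Icc_subset_J hy)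
  lt_re y hy := by linarith [Φ.neg_one_le_re hy]
  ne_zero y hy := h _ (Φ.mem y (Φ.Icc_subset_J hy))
  argVar_eq := by
    refine argVar_real Φ.lt.le (fun y hy => ?_) (fun y hy => h _ (Φ.mem y (Φ.Icc_subset_J hy))) fun y hy => ?_
    · have hyJ := Φ.Icc_subset_J hy
      exact ((differentiableAt_riemannZeta (Φ.isLine.subset (Φ.mem y hyJ)).1).continuousAt.comp
        (Φ.continuousAt hyJ)).continuousWithinAt
    · exact (Φ.isLine.subset (Φ.mem y (Φ.Icc_subset_J hy))).2
  below ρ h0 him hρ := by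
    obtain ⟨h1, h2⟩ := zero_re_mem h0 him
    exact Φ.contourVar_conjQuad_of_mem_belowLine (hρ.resolve_right fun hL => h ρ hL h0) him (by linarith)
      (h2.trans Φ.one_lt_re)
  above ρ h0 him hρ := by
    obtain ⟨h1, h2⟩ := zero_re_mem h0 him
    exact Φ.contourVar_conjQuad_of_notMem (fun h => hρ (Or.inl h)) (fun h => hρ (Or.inr h)) him (by linarith)
      (h2.trans Φ.one_lt_re)

theorem contourVar_conjQuad_push {K : ℝ → ℝ → ℂ} {a b : ℝ} {za zb ρ : ℂ} (hab : a ≤ b)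
    (hK : ContinuousOn (fun p : ℝ × ℝ => K p.1 p.2) (Icc 0 1 ×ˢ Icc a b))
    (hKa : ∀ s ∈ Icc (0 : ℝ) 1, K s a = za) (hKb : ∀ s ∈ Icc (0 : ℝ) 1, K s b = zb)
    (hne : ∀ s ∈ Icc (0 : ℝ) 1, ∀ y ∈ Icc a b, K s y ≠ ρ)
    (him : ∀ s ∈ Icc (0 : ℝ) 1, ∀ y ∈ Icc a b, 0 < (K s y).im) (hρ : 0 < ρ.im) (ha : za.re ≠ ρ.re)
    (hb : zb.re ≠ ρ.re) : contourVar (conjQuad ρ) (K 1) a b = contourVar (conjQuad ρ) (K 0) a b := by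
  have hv : ∀ z : ℂ, ContinuousOn (fun p : ℝ × ℝ => conjQuad ρ (vertPath z p.2)) (Icc 0 1 ×ˢ Icc 0 1) :=
    fun z => ((continuous_conjQuad_right ρ).comp ((continuous_vertPath_right z).comp continuous_snd)).continuousOn
  refine contourVar_homotopy (G := fun _ => conjQuad ρ) hab hKa hKb
    ((continuous_conjQuad_right ρ).comp_continuousOn hK) (fun s hs y hy => conjQuad_ne_zero (hne s hs y hy)
      fun h => ?_) (hv za) (fun s _ τ _ => ?_) (fun _ _ => conjQuad_ofReal_im _ _) (hv zb)
    (fun s _ τ _ => ?_) (fun _ _ => conjQuad_ofReal_im _ _)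
  · have := him s hs y hy
    rw [h, Complex.conj_im] at this
    linarith
  · obtain ⟨h1, h2⟩ := vertPath_ne ha τ
    exact conjQuad_ne_zero h1 h2
  · obtain ⟨h1, h2⟩ := vertPath_ne hb τ
    exact conjQuad_ne_zero h1 h2

/-- A zero means εy = -1. It comes after the base point because |ζ - 1| < 1 there, and before -1 +
iT because ε/ζ > 0 there. -/
theorem zero_on_line (h : ∃ s ∈ L, riemannZeta s = 0) : Φ.ε = -1 ∧ (1 : ℝ) ∈ Φ.J ∧ Φ.y₀ < 1 ∧ 1 < Φ.yP := by
  obtain ⟨s, hs, h0⟩ := h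
  obtain ⟨y, hy, rfl⟩ := Φ.surj s hs
  have h1 := Φ.zeta_re hy
  have hy0 := Φ.pos y hy
  rw [h0, Complex.zero_re] at h1
  have hε : Φ.ε = -1 := by
    rcases Φ.sign with h | h
    · rw [h] at h1; linarith
    · exact h
  rw [hε] at h1
  obtain rfl : y = 1 := by linarith
  refine ⟨hε, hy, ?_, ?_⟩
  · have := Φ.norm_lt _ le_rfl
    rw [Φ.zeta _ Φ.y₀_mem, add_sub_cancel_left, norm_mul, Complex.norm_real, Complex.norm_real, hε] at this
    simpa [abs_of_pos (Φ.pos _ Φ.y₀_mem)] using this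
  · have := (Φ.left_end Φ.isLine Φ.T_pos Φ.yP_mem Φ.curve_yP).2.1
    rw [hε] at this
    by_contra! h'
    exact absurd this (not_lt.2 (div_nonpos_of_nonpos_of_nonneg (by norm_num) (by linarith)))

/-- In the ζ-plane the segment through 0 is replaced by a tent in the upper half-plane and pulled
back by the local inverse. As ε = -1, positive Im ζ is the side above the line, so the zero on the
line ends up under the curve. Along it ζ goes from a positive to a negative value through the upper
half-plane, whence π. -/
theorem exists_isSeparating (h : ∃ s ∈ L, riemannZeta s = 0) : ∃ κ, Φ.IsSeparating κ Real.pi := by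
  obtain ⟨hε, h1J, h01, h1P⟩ := Φ.zero_on_line h
  set ρ₀ := Φ.curve 1 with hρ₀
  have hρL : ρ₀ ∈ L := Φ.mem 1 h1J
  have hz : ∀ y ∈ Φ.J, riemannZeta (Φ.curve y) = 1 - y := fun y hy => by
    rw [Φ.zeta y hy, hε]; push_cast; ring
  have hζρ : riemannZeta ρ₀ = 0 := by rw [hρ₀, hz 1 h1J]; simp
  have hρim := Φ.im_pos _ hρL
  obtain ⟨hre0, hre1⟩ := zero_re_mem hζρ hρim
  have hV : {s : ℂ | 0 < s.im} ∩ ({s : ℂ | -1 < s.re} ∩ {s : ℂ | s.re < (Φ.curve Φ.y₀).re}) ∈ 𝓝 ρ₀ :=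
    ((isOpen_lt continuous_const Complex.continuous_im).inter
      ((isOpen_lt continuous_const Complex.continuous_re).inter
        (isOpen_lt Complex.continuous_re continuous_const))).mem_nhds
      ⟨hρim, by simp only [mem_ofPred_eq]; linarith, hre1.trans Φ.one_lt_re⟩
  obtain ⟨r, hr, U, hU, hpU, hUV, μ, -, h2, h3, h4, h5, -, h7, -⟩ := Φ.isLine.exists_chart hρL hV
  rw [hζρ] at h2 h4 h5
  obtain ⟨η, hη, hηr, hη0, hηP⟩ : ∃ η > 0, η < r ∧ η ≤ 1 - Φ.y₀ ∧ η ≤ Φ.yP - 1 :=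
    ⟨min (r / 2) (min (1 - Φ.y₀) (Φ.yP - 1)), lt_min (by linarith) (lt_min (by linarith) (by linarith)),
      (min_le_left _ _).trans_lt (by linarith), (min_le_right _ _).trans (min_le_left _ _),
      (min_le_right _ _).trans (min_le_right _ _)⟩
  have hball : ∀ x t : ℝ, |x| + |t| ≤ η → (x + t * Complex.I : ℂ) ∈ Metric.ball (0 : ℂ) r := fun x t hxt => by
    rw [mem_ball_zero_iff]
    refine ((norm_add_le _ _).trans ?_).trans_lt hηr
    rwa [norm_mul, Complex.norm_I, mul_one, Complex.norm_real, Complex.norm_real]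
  -- the pushed curve in terms of the values of `ζ`
  set x : ℝ → ℝ := fun y => max (-η) (min η (1 - y)) with hx
  set d : ℝ → ℝ := fun y => η - |x y| with hd
  have hxη : ∀ y, |x y| ≤ η := fun y => abs_le.2 ⟨le_max_left _ _, max_le (by linarith) (min_le_left _ _)⟩
  have hd0 : ∀ y, 0 ≤ d y := fun y => by have := hxη y; simp only [hd]; linarith
  have hxin : ∀ y, |1 - y| ≤ η → x y = 1 - y := fun y hy => by
    obtain ⟨h1, h2⟩ := abs_le.1 hy
    simp only [hx]; rw [min_eq_right h2, max_eq_right h1]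
  have hdout : ∀ y, η ≤ |1 - y| → d y = 0 := fun y hy => by
    simp only [hd, hx]
    rcases le_abs.1 hy with h | h
    · rw [min_eq_left h, max_eq_right (by linarith), abs_of_pos hη, sub_self]
    · rw [min_eq_right (by linarith), max_eq_left (by linarith), abs_neg, abs_of_pos hη, sub_self]
  have hxc : Continuous x := by simp only [hx]; fun_prop
  have hdc : Continuous d := by simp only [hd]; fun_prop
  have hmem : ∀ s ∈ Icc (0 : ℝ) 1, ∀ y, (x y + (s * d y : ℝ) * Complex.I : ℂ) ∈ Metric.ball (0 : ℂ) r :=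
    fun s hs y => hball _ _ (by
      rw [abs_of_nonneg (mul_nonneg hs.1 (hd0 y))]
      have : s * d y ≤ d y := mul_le_of_le_one_left (hd0 y) hs.2
      have : d y = η - |x y| := rfl
      linarith)
  have hmem0 : ∀ y, (x y : ℂ) ∈ Metric.ball (0 : ℂ) r := fun y => by
    have := hmem 0 ⟨le_rfl, zero_le_one⟩ y; simpa using this
  -- Writing the push as a difference gives one formula for all y: near the zero `μ (x y)` cancels
  -- `Φ.curve y`, and away from it the difference vanishes because d = 0.
  set K : ℝ → ℝ → ℂ := fun s y => Φ.curve y + (μ (x y + (s * d y : ℝ) * Complex.I) - μ (x y)) with hK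
  have hcurve : ∀ y ∈ Φ.J, |1 - y| ≤ η → μ (x y) = Φ.curve y := fun y hy hy' => by
    have hm : μ (x y) ∈ L := (h7 _ (h2 (hmem0 y))).2 (by rw [h4 _ (hmem0 y)]; simp)
    refine Φ.isLine.eq_of_zeta_eq hm (Φ.mem y hy) ?_
    rw [h4 _ (hmem0 y), hz y hy, hxin y hy']; push_cast; rfl
  have hcase : ∀ s ∈ Icc (0 : ℝ) 1, ∀ y ∈ Φ.J, K s y ∈ {s : ℂ | 0 < s.im} ∧
      riemannZeta (K s y) = (1 - y : ℝ) + (s * d y : ℝ) * Complex.I := by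
    intro s hs y hy
    rcases le_total |1 - y| η with h | h
    · have e : K s y = μ (x y + (s * d y : ℝ) * Complex.I) := by
        simp only [hK]; rw [hcurve y hy h]; ring
      rw [e]
      refine ⟨(hUV (h2 (hmem s hs y))).1, ?_⟩
      rw [h4 _ (hmem s hs y), hxin y h]
    · have e : K s y = Φ.curve y := by simp only [hK]; rw [hdout y h]; simp
      rw [e]
      refine ⟨Φ.curve_im_pos hy, ?_⟩
      rw [hz y hy, hdout y h]; simp
  have hK0 : K 0 = Φ.curve := by ext y; simp [hK]
  have hend : ∀ s y, η ≤ |1 - y| → K s y = Φ.curve y := fun s y hy => by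
    simp only [hK]; rw [hdout y hy]; simp
  have hKa : ∀ s ∈ Icc (0 : ℝ) 1, K s Φ.y₀ = Φ.curve Φ.y₀ := fun s _ => hend s _ (le_abs.2 (Or.inl hη0))
  have hKb : ∀ s ∈ Icc (0 : ℝ) 1, K s Φ.yP = Φ.curve Φ.yP := fun s _ => hend s _ (le_abs.2 (Or.inr (by linarith)))
  have hKc : ContinuousOn (fun p : ℝ × ℝ => K p.1 p.2) (Icc 0 1 ×ˢ Icc Φ.y₀ Φ.yP) := by
    simp only [hK]
    refine ((Φ.continuousOn_curve.mono Φ.Icc_subset_J).comp continuousOn_snd fun p hp => hp.2).add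
      (ContinuousOn.sub ?_ ?_)
    · refine h5.comp (f := fun p : ℝ × ℝ => (x p.2 + (p.1 * d p.2 : ℝ) * Complex.I : ℂ)) (by fun_prop) fun p hp => hmem _ hp.1 _
    · exact h5.comp (f := fun p : ℝ × ℝ => (x p.2 : ℂ)) (by fun_prop) fun p hp => hmem0 _
  have i1 : (1 : ℝ) ∈ Icc (0 : ℝ) 1 := ⟨zero_le_one, le_rfl⟩
  have hre : ∀ y ∈ Icc Φ.y₀ Φ.yP, -2 < (K 1 y).re := by
    intro y hy
    rcases le_total |1 - y| η with h | h
    · have e : K 1 y = μ (x y + (1 * d y : ℝ) * Complex.I) := by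
        simp only [hK]; rw [hcurve y (Φ.Icc_subset_J hy) h]; ring
      have : -1 < (K 1 y).re := e ▸ (hUV (h2 (hmem 1 i1 y))).2.1
      linarith
    · rw [hend 1 y h]
      linarith [Φ.neg_one_le_re hy]
  have hzero : ∀ s ∈ Icc (0 : ℝ) 1, ∀ y ∈ Φ.J, riemannZeta (K s y) = 0 → y = 1 ∧ s = 0 := by
    intro s hs y hy h0
    rw [(hcase s hs y hy).2] at h0
    have e1 := congrArg Complex.re h0
    have e2 := congrArg Complex.im h0
    simp at e1 e2
    have hy1 : y = 1 := by linarith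
    have : d y = η := by simp only [hd]; rw [hxin y (by rw [hy1]; simpa using hη.le), hy1]; simp
    refine ⟨hy1, e2.resolve_right (by rw [this]; exact hη.ne')⟩
  have himge : ∀ s ∈ Icc (0 : ℝ) 1, ∀ y ∈ Φ.J, 0 ≤ (riemannZeta (K s y)).im := fun s hs y hy => by
    rw [(hcase s hs y hy).2]; simpa using mul_nonneg hs.1 (hd0 y)
  have hpush : ∀ ρ : ℂ, 0 < ρ.im → -1 < ρ.re → ρ.re < (Φ.curve Φ.y₀).re →
      (∀ s ∈ Icc (0 : ℝ) 1, ∀ y ∈ Icc Φ.y₀ Φ.yP, K s y ≠ ρ) →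
      contourVar (conjQuad ρ) (K 1) Φ.y₀ Φ.yP = contourVar (conjQuad ρ) Φ.curve Φ.y₀ Φ.yP := by
    intro ρ h1 h2 h3 h4
    rw [contourVar_conjQuad_push Φ.lt.le hKc hKa hKb h4
      (fun s hs y hy => (hcase s hs y (Φ.Icc_subset_J hy)).1) h1 h3.ne' (by rw [Φ.re_yP]; exact h2.ne), hK0]
  have hK1c : ContinuousOn (K 1) (Icc Φ.y₀ Φ.yP) :=
    hKc.comp (f := fun y : ℝ => ((1 : ℝ), y)) (by fun_prop) fun y hy => ⟨i1, hy⟩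
  refine ⟨K 1, hK1c, hKa 1 i1, hKb 1 i1, fun y hy => (hcase 1 i1 y (Φ.Icc_subset_J hy)).1, hre,
    fun y hy h0 => ?_, ?_, fun ρ h0 him hρ => ?_, fun ρ h0 him hρ => ?_⟩
  · exact one_ne_zero (hzero 1 i1 y (Φ.Icc_subset_J hy) h0).2
  · have hcont : ContinuousOn (fun y => riemannZeta (K 1 y)) (Icc Φ.y₀ Φ.yP) := by
      have : ContinuousOn (fun y : ℝ => ((1 - y : ℝ) + (1 * d y : ℝ) * Complex.I : ℂ)) (Icc Φ.y₀ Φ.yP) := by fun_prop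
      exact this.congr fun y hy => (hcase 1 i1 y (Φ.Icc_subset_J hy)).2
    rw [argVar_of_mem_slitPlane (-Complex.I) (by simp) Φ.lt.le hcont fun y hy => ?_]
    · rw [hKa 1 i1, hKb 1 i1, hz _ Φ.y₀_mem, hz _ Φ.yP_mem]
      have e1 : -Complex.I * (1 - (Φ.yP : ℂ)) = ((Φ.yP - 1 : ℝ) : ℂ) * Complex.I := by push_cast; ring
      have e2 : -Complex.I * (1 - (Φ.y₀ : ℂ)) = ((1 - Φ.y₀ : ℝ) : ℂ) * -Complex.I := by push_cast; ring
      rw [e1, e2, Complex.arg_real_mul _ (by linarith), Complex.arg_real_mul _ (by linarith), Complex.arg_I,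
        Complex.arg_neg_I]
      ring
    · have hyJ := Φ.Icc_subset_J hy
      rw [(hcase 1 i1 y hyJ).2, Complex.mem_slitPlane_iff]
      rcases (hd0 y).eq_or_lt with h | h
      · right
        have : y ≠ 1 := by
          rintro rfl
          have : d 1 = η := by simp only [hd]; rw [hxin 1 (by simpa using hη.le)]; simp
          linarith
        rw [← h]
        simpa [sub_eq_zero] using this
      · left; simpa using h
  · obtain ⟨hr1, hr2⟩ := zero_re_mem h0 him
    by_cases hρL' : ρ ∈ L
    · obtain rfl : ρ = ρ₀ := Φ.isLine.eq_of_zeta_eq hρL' hρL (by rw [h0, hζρ])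
      -- The zero on the line is slid slightly to the side Im ζ < 0, which is below the line. The
      -- pushed curves have Im ζ ≥ 0 and are not met, so the case of a point strictly below applies.
      set q : ℝ → ℂ := fun s => μ ((-(s * η) : ℝ) * Complex.I) with hq
      have hqm : ∀ s ∈ Icc (0 : ℝ) 1, ((-(s * η) : ℝ) * Complex.I : ℂ) ∈ Metric.ball (0 : ℂ) r := fun s hs => by
        have := hball 0 (-(s * η)) (by
          rw [abs_neg, abs_of_nonneg (mul_nonneg hs.1 hη.le), abs_zero, zero_add]
          exact mul_le_of_le_one_left hη.le hs.2)
        simpa using this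
      have hqc : ContinuousOn q (Icc 0 1) :=
        h5.comp (f := fun s : ℝ => ((-(s * η) : ℝ) * Complex.I : ℂ)) (by fun_prop) hqm
      have hq0 : q 0 = ρ₀ := by
        have := h3 ρ₀ hpU; rw [hζρ] at this; simpa [hq] using this
      have hqζ : ∀ s ∈ Icc (0 : ℝ) 1, riemannZeta (q s) = (-(s * η) : ℝ) * Complex.I := fun s hs => h4 _ (hqm s hs)
      have hqU : ∀ s ∈ Icc (0 : ℝ) 1, q s ∈ U := fun s hs => h2 (hqm s hs)
      have hev : ∀ᶠ s in 𝓝[>] (0 : ℝ), 0 < Φ.ε * (riemannZeta (q s)).im → q s ∈ belowLine L := by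
        have h8 : Tendsto q (𝓝[Icc 0 1] 0) (𝓝 ρ₀) := by
          have := hqc 0 ⟨le_rfl, zero_le_one⟩
          rw [ContinuousWithinAt, hq0] at this
          exact this
        have h9 : 𝓝[>] (0 : ℝ) ≤ 𝓝[Icc 0 1] 0 := by
          rw [← nhdsWithin_Ioo_eq_nhdsGT zero_lt_one]
          exact nhdsWithin_mono _ Ioo_subset_Icc_self
        exact (h8.mono_left h9).eventually (Φ.eventually_mem_belowLine hρL)
      obtain ⟨σ, hσ1, hσ2⟩ := (hev.and (Ioo_mem_nhdsGT zero_lt_one)).exists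
      have hσI : σ ∈ Icc (0 : ℝ) 1 := Ioo_subset_Icc_self hσ2
      have hbelow : q σ ∈ belowLine L := hσ1 (by
        rw [hqζ σ hσI, hε]; simpa using mul_pos hσ2.1 hη)
      have hqV := fun s hs => hUV (hqU s hs)
      have hmove := contourVar_conjQuad_homotopy (r := fun s => q (s * σ)) Φ.lt.le hK1c
        (hqc.comp (by fun_prop) fun s hs =>
          ⟨mul_nonneg hs.1 hσI.1, (mul_le_of_le_one_left hσI.1 hs.2).trans hσI.2⟩) ?_
      · simp only [one_mul, zero_mul, hq0] at hmove
        rw [← hmove, hpush (q σ) (hqV σ hσI).1 (hqV σ hσI).2.1 (hqV σ hσI).2.2 fun s hs y hy h => ?_]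
        · exact Φ.contourVar_conjQuad_of_mem_belowLine hbelow (hqV σ hσI).1 (hqV σ hσI).2.1 (hqV σ hσI).2.2
        · have := himge s hs y (Φ.Icc_subset_J hy)
          rw [h, hqζ σ hσI] at this
          simp at this
          nlinarith [mul_pos hσ2.1 hη]
      · intro s hs z hz'
        have hsσ : s * σ ∈ Icc (0 : ℝ) 1 :=
          ⟨mul_nonneg hs.1 hσI.1, (mul_le_of_le_one_left hσI.1 hs.2).trans hσI.2⟩
        obtain ⟨v1, v2, v3⟩ := hqV _ hsσ
        rcases hz' with (⟨τ, -, rfl⟩ | ⟨y, hy, rfl⟩) | ⟨τ, -, rfl⟩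
        · rw [hKa 1 i1]; exact vertPath_ne (ne_of_gt v3) τ
        · have hyJ := Φ.Icc_subset_J hy
          refine ⟨fun h => ?_, fun h => ?_⟩
          · have h8 := himge 1 i1 y hyJ
            have h9 : riemannZeta (K 1 y) ≠ 0 := fun h0 => one_ne_zero (hzero 1 i1 y hyJ h0).2
            rw [h, hqζ _ hsσ] at h8 h9
            simp at h8 h9
            have := mul_nonneg hs.1 hσI.1
            rcases this.eq_or_lt with h | h
            · rcases mul_eq_zero.1 h.symm with h | h
              · exact h9.1.1 h
              · exact h9.1.2 h
            · nlinarith [mul_pos h hη]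
          · have h8 := (hcase 1 i1 y hyJ).1
            rw [h] at h8
            simp only [mem_ofPred_eq, Complex.conj_im] at h8
            have : 0 < (q (s * σ)).im := v1
            linarith
        · rw [hKb 1 i1]; exact vertPath_ne (by rw [Φ.re_yP]; exact ne_of_lt v2) τ
    · rw [hpush ρ him (by linarith) (hr2.trans Φ.one_lt_re) fun s hs y hy h => ?_]
      · exact Φ.contourVar_conjQuad_of_mem_belowLine (hρ.resolve_right hρL') him (by linarith)
          (hr2.trans Φ.one_lt_re)
      · obtain ⟨rfl, rfl⟩ := hzero s hs y (Φ.Icc_subset_J hy) (by rw [h, h0])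
        rw [hK0] at h
        exact hρL' (h ▸ hρL)
  · obtain ⟨hr1, hr2⟩ := zero_re_mem h0 him
    have hρL' : ρ ∉ L := fun h => hρ (Or.inr h)
    rw [hpush ρ him (by linarith) (hr2.trans Φ.one_lt_re) fun s hs y hy h => ?_]
    · exact Φ.contourVar_conjQuad_of_notMem (fun h => hρ (Or.inl h)) hρL' him (by linarith)
        (hr2.trans Φ.one_lt_re)
    · obtain ⟨rfl, rfl⟩ := hzero s hs y (Φ.Icc_subset_J hy) (by rw [h, h0])
      rw [hK0] at h
      exact hρL' (h ▸ hρL)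

end LineFrame

/-! ### Factorization and the number of zeros -/

/-- An entire function that commutes with complex conjugation. -/
structure IsRealEntire (f : ℂ → ℂ) : Prop where
  differentiable : Differentiable ℂ f
  conj : ∀ z, f (starRingEnd ℂ z) = starRingEnd ℂ (f z)

theorem IsRealEntire.im_ofReal {f : ℂ → ℂ} (hf : IsRealEntire f) (x : ℝ) : (f x).im = 0 := by
  have := hf.conj x
  rw [Complex.conj_ofReal] at this
  exact Complex.conj_eq_iff_im.1 this.symm

theorem Differentiable.dslope_complex {f : ℂ → ℂ} (hf : Differentiable ℂ f) (c : ℂ) :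
    Differentiable ℂ (dslope f c) := by
  rw [← differentiableOn_univ, Complex.differentiableOn_dslope univ_mem]
  exact hf.differentiableOn

theorem eq_mul_dslope {f : ℂ → ℂ} {c : ℂ} (h : f c = 0) (z : ℂ) : f z = (z - c) * dslope f c z := by
  have := sub_smul_dslope f c z
  rw [h, sub_zero, smul_eq_mul] at this
  exact this.symm

theorem conjQuad_conj (ρ z : ℂ) : conjQuad ρ (starRingEnd ℂ z) = starRingEnd ℂ (conjQuad ρ z) := by
  simp [conjQuad, mul_comm]

/-- The conjugate of ρ is also a zero, so two successive divided differences give the quotient. It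
commutes with conjugation off the two zeros, hence everywhere by density. -/
theorem IsRealEntire.exists_div {f : ℂ → ℂ} (hf : IsRealEntire f) {ρ : ℂ} (him : ρ.im ≠ 0)
    (h0 : f ρ = 0) : ∃ g, IsRealEntire g ∧ ∀ z, f z = conjQuad ρ z * g z := by
  have hne : starRingEnd ℂ ρ - ρ ≠ 0 := fun h => him (Complex.conj_eq_iff_im.1 (sub_eq_zero.1 h))
  have h1 := eq_mul_dslope h0
  have h2 : dslope f ρ (starRingEnd ℂ ρ) = 0 := by
    have := h1 (starRingEnd ℂ ρ)
    rw [hf.conj, h0, map_zero] at this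
    exact (mul_eq_zero.1 this.symm).resolve_left hne
  set g := dslope (dslope f ρ) (starRingEnd ℂ ρ) with hg
  have hgd : Differentiable ℂ g := (hf.differentiable.dslope_complex ρ).dslope_complex _
  have h3 : ∀ z, f z = conjQuad ρ z * g z := fun z => by
    rw [h1 z, eq_mul_dslope h2 z, conjQuad, mul_assoc]
  refine ⟨g, ⟨hgd, fun z => ?_⟩, h3⟩
  have hden : Dense ({ρ, starRingEnd ℂ ρ} : Set ℂ)ᶜ := (Set.toFinite _).countable.dense_compl ℂ
  refine congrFun (Continuous.ext_on hden (hgd.continuous.comp Complex.continuous_conj)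
    (Complex.continuous_conj.comp hgd.continuous) fun z hz => ?_) z
  simp only [mem_compl_iff, mem_insert_iff, mem_singleton_iff, not_or] at hz
  have hq := conjQuad_ne_zero hz.1 hz.2
  have h4 := hf.conj z
  rw [h3, h3 z, conjQuad_conj, map_mul] at h4
  exact mul_left_cancel₀ ((map_ne_zero _).2 hq) h4

theorem Differentiable.analyticOrderAt_ne_top {f : ℂ → ℂ} (hf : Differentiable ℂ f) (h : ∃ z, f z ≠ 0)
    (ρ : ℂ) : analyticOrderAt f ρ ≠ ⊤ := by
  intro htop
  obtain ⟨z, hz⟩ := h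
  have h1 := analyticOrderAt_eq_top.1 htop
  have ha : AnalyticOnNhd ℂ f univ := fun z _ => hf.analyticAt z
  exact hz (ha.eqOn_zero_of_preconnected_of_eventuallyEq_zero isPreconnected_univ (mem_univ ρ) h1 (mem_univ z))

theorem differentiable_conjQuad (ρ : ℂ) : Differentiable ℂ (conjQuad ρ) := by
  unfold conjQuad; fun_prop

theorem analyticOrderNatAt_conjQuad {ρ : ℂ} (him : ρ.im ≠ 0) : analyticOrderNatAt (conjQuad ρ) ρ = 1 := by
  rw [((differentiable_conjQuad ρ).analyticAt ρ).analyticOrderNatAt_eq_iff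
    ((differentiable_conjQuad ρ).analyticOrderAt_ne_top ⟨ρ + 1, ?_⟩ ρ)]
  · refine ⟨fun z => z - starRingEnd ℂ ρ, by fun_prop, fun h => ?_, Eventually.of_forall fun z => ?_⟩
    · exact him (Complex.conj_eq_iff_im.1 (sub_eq_zero.1 h).symm)
    · simp [conjQuad]
  · refine conjQuad_ne_zero (by simp) fun h => him ?_
    have := congrArg Complex.im h
    simp at this; linarith

theorem IsRealEntire.exists_div_pow {f : ℂ → ℂ} (hf : IsRealEntire f) (hne : ∃ z, f z ≠ 0) {ρ : ℂ}
    (him : ρ.im ≠ 0) : ∃ g, IsRealEntire g ∧ g ρ ≠ 0 ∧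
      ∀ z, f z = conjQuad ρ z ^ analyticOrderNatAt f ρ * g z := by
  induction hn : analyticOrderNatAt f ρ generalizing f with
  | zero =>
    refine ⟨f, hf, fun h0 => ?_, by simp⟩
    have h1 := (hf.differentiable.analyticAt ρ).analyticOrderAt_ne_zero.2 h0
    have h2 := Nat.cast_analyticOrderNatAt (hf.differentiable.analyticOrderAt_ne_top hne ρ)
    rw [hn] at h2
    exact h1 h2.symm
  | succ n ih =>
    have h0 : f ρ = 0 := by
      by_contra h0
      have := (hf.differentiable.analyticAt ρ).analyticOrderAt_eq_zero.2 h0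
      rw [analyticOrderNatAt, this] at hn
      simp at hn
    obtain ⟨g, hg, hfg⟩ := hf.exists_div him h0
    have hgne : ∃ z, g z ≠ 0 := by
      obtain ⟨z, hz⟩ := hne
      exact ⟨z, fun h => hz (by rw [hfg, h, mul_zero])⟩
    have e : f = conjQuad ρ * g := funext hfg
    have hq := differentiable_conjQuad ρ
    have hord : analyticOrderNatAt g ρ = n := by
      rw [e, analyticOrderNatAt_mul (hq.analyticAt ρ) (hg.differentiable.analyticAt ρ)
        (hq.analyticOrderAt_ne_top ?_ ρ) (hg.differentiable.analyticOrderAt_ne_top hgne ρ),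
        analyticOrderNatAt_conjQuad him] at hn
      · omega
      · obtain ⟨z, hz⟩ := hne
        exact ⟨z, fun h => hz (by rw [hfg, h, zero_mul])⟩
    obtain ⟨u, hu, hu0, hgu⟩ := ih hg hgne hord
    exact ⟨u, hu, hu0, fun z => by rw [hfg, hgu, pow_succ]; ring⟩

theorem analyticOrderNatAt_mul_of_ne_zero {f g : ℂ → ℂ} {z : ℂ} (hf : AnalyticAt ℂ f z)
    (hg : AnalyticAt ℂ g z) (h : f z ≠ 0) : analyticOrderNatAt (f * g) z = analyticOrderNatAt g z := by
  rw [analyticOrderNatAt, analyticOrderNatAt, analyticOrderAt_mul hf hg, hf.analyticOrderAt_eq_zero.2 h, zero_add]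

theorem IsRealEntire.exists_factorization {f : ℂ → ℂ} (hf : IsRealEntire f) (hne : ∃ z, f z ≠ 0)
    (S : Finset ℂ) (hS : ∀ ρ ∈ S, 0 < ρ.im) : ∃ g, IsRealEntire g ∧ (∀ ρ ∈ S, g ρ ≠ 0) ∧
      ∀ z, f z = (∏ ρ ∈ S, conjQuad ρ z ^ analyticOrderNatAt f ρ) * g z := by
  classical
  induction S using Finset.induction_on with
  | empty => exact ⟨f, hf, by simp, by simp⟩
  | insert ρ S hρ ih =>
    obtain ⟨g, hg, hg0, hfg⟩ := ih fun σ hσ => hS σ (Finset.mem_insert_of_mem hσ)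
    have him := hS ρ (Finset.mem_insert_self ρ S)
    have hgne : ∃ z, g z ≠ 0 := by
      obtain ⟨z, hz⟩ := hne
      exact ⟨z, fun h => hz (by rw [hfg, h, mul_zero])⟩
    obtain ⟨u, hu, hu0, hgu⟩ := hg.exists_div_pow hgne him.ne'
    set P : ℂ → ℂ := fun z => ∏ σ ∈ S, conjQuad σ z ^ analyticOrderNatAt f σ with hP
    have hPd : Differentiable ℂ P := by
      have : ∀ σ ∈ S, Differentiable ℂ fun z => conjQuad σ z ^ analyticOrderNatAt f σ :=
        fun σ _ => (differentiable_conjQuad σ).pow _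
      exact Differentiable.fun_finsetProd this
    have hPne : P ρ ≠ 0 := by
      refine Finset.prod_ne_zero_iff.2 fun σ hσ => pow_ne_zero _ (conjQuad_ne_zero ?_ ?_)
      · rintro rfl; exact hρ hσ
      · intro h
        have h1 := hS σ (Finset.mem_insert_of_mem hσ)
        rw [h, Complex.conj_im] at him
        linarith
    have hord : analyticOrderNatAt f ρ = analyticOrderNatAt g ρ := by
      have e : f = P * g := funext hfg
      conv_lhs => rw [e]
      exact analyticOrderNatAt_mul_of_ne_zero (hPd.analyticAt ρ) (hg.differentiable.analyticAt ρ) hPne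
    refine ⟨u, hu, fun σ hσ h => ?_, fun z => ?_⟩
    · rcases Finset.mem_insert.1 hσ with rfl | hσ
      · exact hu0 h
      · exact hg0 σ hσ (by rw [hgu, h, mul_zero])
    · rw [Finset.prod_insert hρ, hfg z, hgu z, hord]; ring

theorem riemannZeta₁_eq {s : ℂ} (hs : s ≠ 1) : riemannZeta₁ s = (s - 1) * riemannZeta s := by
  have : s - 1 ≠ 0 := sub_ne_zero.2 hs
  rw [riemannZeta_eq_inv_sub_mul hs]; field_simp

theorem isRealEntire_riemannZeta₁ : IsRealEntire riemannZeta₁ := by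
  refine ⟨differentiable_riemannZeta₁, fun z => ?_⟩
  by_cases hz : z = 1
  · rw [hz, map_one, riemannZeta₁_one, map_one]
  · have hz' : starRingEnd ℂ z ≠ 1 := fun h => hz (by simpa using congrArg (starRingEnd ℂ) h)
    rw [riemannZeta₁_eq hz, riemannZeta₁_eq hz', riemannZeta_conj]; simp

theorem analyticOrderNatAt_riemannZeta₁ {ρ : ℂ} (hρ : ρ ≠ 1) :
    analyticOrderNatAt riemannZeta₁ ρ = analyticOrderNatAt riemannZeta ρ := by
  have hz : AnalyticAt ℂ riemannZeta ρ := by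
    have h : DifferentiableOn ℂ riemannZeta {1}ᶜ := fun z hz =>
      (differentiableAt_riemannZeta hz).differentiableWithinAt
    exact h.analyticAt (isOpen_compl_singleton.mem_nhds hρ)
  have h1 : AnalyticAt ℂ (fun s : ℂ => s - 1) ρ := by fun_prop
  have e : riemannZeta₁ =ᶠ[𝓝 ρ] (fun s : ℂ => s - 1) * riemannZeta := by
    filter_upwards [isOpen_compl_singleton.mem_nhds hρ] with s hs
    exact riemannZeta₁_eq hs
  rw [analyticOrderNatAt, analyticOrderAt_congr e]
  exact analyticOrderNatAt_mul_of_ne_zero h1 hz (sub_ne_zero.2 hρ)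

/-! ### The number of zeros below a parallel line -/

namespace LineFrame

variable {L : Set ℂ} {T : ℝ} (Φ : LineFrame L T) {κ : ℝ → ℂ} {θ : ℝ}

namespace IsSeparating

variable {Φ}

theorem re_left (h : Φ.IsSeparating κ θ) : 1 < (κ Φ.y₀).re := by rw [h.left]; exact Φ.one_lt_re

theorem re_right (h : Φ.IsSeparating κ θ) : (κ Φ.yP).re = -1 := by rw [h.right]; exact Φ.re_yP

theorem ne_one (h : Φ.IsSeparating κ θ) {z : ℂ} (hz : z ∈ contour κ Φ.y₀ Φ.yP) : z ≠ 1 := by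
  rintro rfl
  rcases contour_im Φ.lt.le h.im_pos hz with h1 | ⟨-, h1 | h1⟩
  · simp at h1
  · have := h.re_left; rw [← h1] at this; simp at this
  · have := h.re_right; rw [← h1] at this; norm_num at this

theorem zeta_ne_zero (h : Φ.IsSeparating κ θ) {z : ℂ} (hz : z ∈ contour κ Φ.y₀ Φ.yP) : riemannZeta z ≠ 0 := by
  rcases hz with (⟨τ, -, rfl⟩ | ⟨y, hy, rfl⟩) | ⟨τ, -, rfl⟩
  · exact riemannZeta_ne_zero_of_one_le_re (by rw [vertPath_re]; exact h.re_left.le)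
  · exact h.ne_zero y hy
  · have e : vertPath (κ Φ.yP) τ = -1 + (τ * (κ Φ.yP).im : ℝ) * Complex.I := by
      rw [vertPath, h.re_right]; push_cast; rfl
    rw [e]
    exact zeta_neg_one_add_ne_zero _

theorem continuousOn_zeta (h : Φ.IsSeparating κ θ) : ContinuousOn riemannZeta (contour κ Φ.y₀ Φ.yP) :=
  fun _ hz => (differentiableAt_riemannZeta (h.ne_one hz)).continuousAt.continuousWithinAt

/-- On the right vertical |ζ - 1| < 1 and ζ is real at both ends, so it contributes 0. The left
vertical is traversed downwards and contributes -`leftArg T`. -/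
theorem contourVar_zeta (h : Φ.IsSeparating κ θ) :
    contourVar riemannZeta κ Φ.y₀ Φ.yP = θ - leftArg T := by
  obtain ⟨f1, -, -⟩ := continuousOn_comp_contour h.continuousOn h.continuousOn_zeta
  have hpos : ∀ s : ℂ, (Φ.curve Φ.y₀).re ≤ s.re → 0 < (riemannZeta s).re := fun s hs => by
    have := (abs_lt.1 ((Complex.abs_re_le_norm _).trans_lt (Φ.norm_lt s hs))).1
    simp at this; linarith
  have harg : ∀ s : ℂ, (Φ.curve Φ.y₀).re ≤ s.re → (riemannZeta s).im = 0 → (1 * riemannZeta s).arg = 0 :=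
    fun s hs h0 => by rw [one_mul]; exact Complex.arg_eq_zero_iff.2 ⟨(hpos s hs).le, h0⟩
  have e1 : argVar (fun τ => riemannZeta (vertPath (κ Φ.y₀) τ)) 0 1 = 0 := by
    rw [argVar_of_mem_slitPlane 1 one_ne_zero zero_le_one f1 fun τ _ => ?_]
    · rw [vertPath_one, vertPath_zero, h.left, harg _ le_rfl (Φ.isLine.subset (Φ.mem _ Φ.y₀_mem)).2,
        harg _ (by simp) (zeta_ofReal_im _), sub_zero]
    · rw [one_mul]
      exact Or.inl (hpos _ (by rw [vertPath_re, h.left]))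
  have e2 : argVar (fun τ => riemannZeta (vertPath (κ Φ.yP) τ)) 0 1 = leftArg T := by
    have hc : Continuous leftLog := continuous_iff_continuousAt.2 fun t => (hasDerivAt_leftLog t).continuousAt
    rw [_root_.argVar_eq (l := fun τ => leftLog (τ * T)) zero_le_one (hc.comp (by fun_prop)).continuousOn fun τ _ => ?_]
    · simp [leftLog_im, leftArg_zero]
    · rw [exp_leftLog, h.right, Φ.curve_yP, vertPath]
      simp
  rw [contourVar, e1, e2, h.argVar_eq, zero_add]

theorem contourVar_zeta₁ (h : Φ.IsSeparating κ θ) :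
    contourVar riemannZeta₁ κ Φ.y₀ Φ.yP = Real.pi + θ - leftArg T := by
  have h1 : ∀ z ∈ contour κ Φ.y₀ Φ.yP, z - ((1 : ℝ) : ℂ) ≠ 0 := fun z hz => by
    rw [Complex.ofReal_one]; exact sub_ne_zero.2 (h.ne_one hz)
  have heq : EqOn riemannZeta₁ (fun z => (z - ((1 : ℝ) : ℂ)) * riemannZeta z) (contour κ Φ.y₀ Φ.yP) := fun z hz => by
    simp only [Complex.ofReal_one]; exact riemannZeta₁_eq (h.ne_one hz)
  rw [contourVar_congr Φ.lt.le h.continuousOn differentiable_riemannZeta₁.continuous.continuousOn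
      (fun z hz => ?_) heq,
    contourVar_mul Φ.lt.le h.continuousOn (by fun_prop) h.continuousOn_zeta h1 (fun z hz => h.zeta_ne_zero hz),
    contourVar_sub_real Φ.lt.le h.continuousOn h.im_pos h.re_left (by rw [h.re_right]; norm_num),
    h.contourVar_zeta]
  · ring
  · rw [heq hz]; exact mul_ne_zero (h1 z hz) (h.zeta_ne_zero hz)

theorem conjQuad_ne (h : Φ.IsSeparating κ θ) {ρ : ℂ} (h0 : riemannZeta ρ = 0) {z : ℂ}
    (hz : z ∈ contour κ Φ.y₀ Φ.yP) : conjQuad ρ z ≠ 0 := by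
  refine conjQuad_ne_zero (fun e => h.zeta_ne_zero hz (e ▸ h0)) fun e => h.zeta_ne_zero hz ?_
  rw [e, riemannZeta_conj, h0, map_zero]

/-- The zeros below or on the line, counted by the argument principle. -/
theorem finite_and_count (h : Φ.IsSeparating κ θ) : (zetaZerosIn (belowLine L ∪ L)).Finite ∧
    2 * Real.pi * zetaZeroCount (belowLine L ∪ L) = Real.pi + θ - leftArg T := by
  classical
  obtain ⟨C, hC⟩ := isCompact_Icc.exists_bound_of_continuousOn h.continuousOn
  have hK : IsCompact (Icc (-|C| - 1) (|C| + 1) ×ℂ Icc 0 |C|) := isCompact_Icc.reProdIm isCompact_Icc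
  -- The box reaches the height of the curve and beyond its abscissas, so it holds every zero on the
  -- verticals under it. Zeros below or on the line lie in it too: one above the box would
  -- contribute 0 instead of 2π.
  set S := hK.inter_riemannZetaZeros_finite.toFinset.filter fun ρ => 0 < ρ.im with hS
  have hmemS : ∀ ρ, ρ ∈ S ↔ (ρ.re ∈ Icc (-|C| - 1) (|C| + 1) ∧ ρ.im ∈ Icc 0 |C|) ∧
      riemannZeta ρ = 0 ∧ 0 < ρ.im := fun ρ => by
    simp only [hS, Finset.mem_filter, Set.Finite.mem_toFinset, mem_inter_iff, Complex.mem_reProdIm,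
      mem_riemannZetaZeros, and_assoc]
  have hbound : ∀ y ∈ Icc Φ.y₀ Φ.yP, |(κ y).re| ≤ |C| ∧ (κ y).im ≤ |C| := fun y hy =>
    ⟨(Complex.abs_re_le_norm _).trans ((hC y hy).trans (le_abs_self C)),
      (le_abs_self _).trans ((Complex.abs_im_le_norm _).trans ((hC y hy).trans (le_abs_self C)))⟩
  have hsub : ∀ ρ ∈ zetaZerosIn (belowLine L ∪ L), ρ ∈ S := by
    rintro ρ ⟨hρ, h0, -, him⟩
    obtain ⟨hr0, hr1⟩ := zero_re_mem h0 him
    refine (hmemS ρ).2 ⟨⟨⟨by linarith [abs_nonneg C], by linarith [abs_nonneg C]⟩, him.le, ?_⟩, h0, him⟩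
    by_contra! hlt
    have h1 := contourVar_conjQuad_high Φ.lt.le h.continuousOn h.im_pos
      fun y hy => (hbound y hy).2.trans_lt hlt
    rw [h.below ρ h0 him hρ] at h1
    linarith [Real.pi_pos]
  have hset : zetaZerosIn (belowLine L ∪ L) = ↑(S.filter fun ρ => ρ ∈ belowLine L ∪ L) := by
    ext ρ
    rw [Finset.coe_filter, mem_ofPred_eq]
    refine ⟨fun hρ => ⟨hsub ρ hρ, hρ.1⟩, fun ⟨hρS, hρ⟩ => ?_⟩
    obtain ⟨-, h0, him⟩ := (hmemS ρ).1 hρS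
    exact ⟨hρ, h0, (zero_re_mem h0 him).1, him⟩
  refine ⟨by rw [hset]; exact Finset.finite_toSet _, ?_⟩
  obtain ⟨u, hu, hu0, hfac⟩ := isRealEntire_riemannZeta₁.exists_factorization
    ⟨1, by rw [riemannZeta₁_one]; exact one_ne_zero⟩ S fun ρ hρ => ((hmemS ρ).1 hρ).2.2
  have hune : ∀ z, riemannZeta₁ z ≠ 0 → u z ≠ 0 := fun z hz h0 => hz (by rw [hfac, h0, mul_zero])
  -- Above the axis all zeros in the box have been divided out; on the axis (s - 1)ζ(s) has no zero
  -- to the right of -2, which is why a separating curve has to stay there.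
  have huv : ∀ y ∈ Icc Φ.y₀ Φ.yP, ∀ τ ∈ Icc (0 : ℝ) 1, u (vertPath (κ y) τ) ≠ 0 := by
    intro y hy τ hτ
    obtain ⟨b1, b2⟩ := hbound y hy
    have him := h.im_pos y hy
    rcases hτ.1.eq_or_lt with rfl | hτ0
    · refine hune _ ?_
      rw [vertPath_zero]
      by_cases h1 : (κ y).re = 1
      · rw [h1, Complex.ofReal_one, riemannZeta₁_one]; exact one_ne_zero
      · have h1' : ((κ y).re : ℂ) ≠ 1 := by exact_mod_cast h1
        rw [riemannZeta₁_eq h1']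
        exact mul_ne_zero (sub_ne_zero.2 h1') (zeta_ne_zero_of_real (h.lt_re y hy))
    · have hvim : 0 < (vertPath (κ y) τ).im := by rw [vertPath_im]; exact mul_pos hτ0 him
      have h1 : vertPath (κ y) τ ≠ 1 := fun e => by rw [e] at hvim; simp at hvim
      by_cases h0 : riemannZeta (vertPath (κ y) τ) = 0
      · refine hu0 _ ((hmemS _).2 ⟨⟨?_, hvim.le, ?_⟩, h0, hvim⟩)
        · rw [vertPath_re]
          obtain ⟨b3, b4⟩ := abs_le.1 b1
          exact ⟨by linarith, by linarith⟩
        · rw [vertPath_im]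
          exact (mul_le_of_le_one_left him.le hτ.2).trans b2
      · exact hune _ (by rw [riemannZeta₁_eq h1]; exact mul_ne_zero (sub_ne_zero.2 h1) h0)
  have hvu : contourVar u κ Φ.y₀ Φ.yP = 0 := by
    refine contourVar_eq_zero Φ.lt.le ?_ huv fun y _ => hu.im_ofReal _
    refine hu.differentiable.continuous.comp_continuousOn (continuous_vertPath.comp_continuousOn
      (f := fun p : ℝ × ℝ => (κ p.1, p.2)) ?_)
    exact (h.continuousOn.comp continuousOn_fst fun p hp => hp.1).prodMk continuousOn_snd
  have huc : ∀ z ∈ contour κ Φ.y₀ Φ.yP, u z ≠ 0 := by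
    intro z hz
    refine hune _ ?_
    rw [riemannZeta₁_eq (h.ne_one hz)]
    exact mul_ne_zero (sub_ne_zero.2 (h.ne_one hz)) (h.zeta_ne_zero hz)
  have hqc : ∀ ρ, ContinuousOn (conjQuad ρ) (contour κ Φ.y₀ Φ.yP) := fun ρ =>
    (continuous_conjQuad_right ρ).continuousOn
  have hq0 : ∀ ρ ∈ S, ∀ z ∈ contour κ Φ.y₀ Φ.yP, conjQuad ρ z ≠ 0 := fun ρ hρ z hz =>
    h.conjQuad_ne ((hmemS ρ).1 hρ).2.1 hz
  set m := fun ρ => analyticOrderNatAt riemannZeta₁ ρ with hm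
  have hqp : ∀ ρ, ContinuousOn (fun z => conjQuad ρ z ^ m ρ) (contour κ Φ.y₀ Φ.yP) := fun ρ => (hqc ρ).pow _
  have hvar : contourVar riemannZeta₁ κ Φ.y₀ Φ.yP =
      ∑ ρ ∈ S, (m ρ : ℝ) * contourVar (conjQuad ρ) κ Φ.y₀ Φ.yP := by
    have e : riemannZeta₁ = fun z => (∏ ρ ∈ S, conjQuad ρ z ^ m ρ) * u z := funext hfac
    rw [e, contourVar_mul Φ.lt.le h.continuousOn
        (continuousOn_finsetProd S fun ρ _ => hqp ρ) hu.differentiable.continuous.continuousOn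
        (fun z hz => Finset.prod_ne_zero_iff.2 fun ρ hρ => pow_ne_zero _ (hq0 ρ hρ z hz)) huc, hvu, add_zero,
      contourVar_prod S Φ.lt.le h.continuousOn (fun ρ _ => hqp ρ)
        fun ρ hρ z hz => pow_ne_zero _ (hq0 ρ hρ z hz)]
    exact Finset.sum_congr rfl fun ρ hρ => contourVar_pow Φ.lt.le h.continuousOn (hqc ρ) (hq0 ρ hρ) _
  rw [← h.contourVar_zeta₁, hvar, zetaZeroCount, hset, finsum_mem_coe_finset, Finset.sum_filter, Nat.cast_sum,
    Finset.mul_sum]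
  refine Finset.sum_congr rfl fun ρ hρ => ?_
  obtain ⟨-, h0, him⟩ := (hmemS ρ).1 hρ
  have hρ1 : ρ ≠ 1 := by rintro rfl; simp at him
  split_ifs with hρL
  · rw [h.below ρ h0 him hρL, hm]
    simp only [analyticOrderNatAt_riemannZeta₁ hρ1]
    ring
  · rw [h.above ρ h0 him hρL]; simp

end IsSeparating

end LineFrame

/-! ### The nearest integer -/

theorem isNearestInt_of_abs_lt {n : ℤ} {x : ℝ} (h : |x - n| < 1 / 2) : IsNearestInt n x := by
  intro m hm
  have h1 : (1 : ℝ) ≤ |(n : ℝ) - m| := by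
    have : (1 : ℤ) ≤ |n - m| := Int.one_le_abs (sub_ne_zero.2 hm.symm)
    exact_mod_cast this
  have h2 := abs_sub_abs_le_abs_sub ((n : ℝ) - m) (-(x - n))
  rw [abs_neg, show (n : ℝ) - m - -(x - n) = x - m by ring] at h2
  linarith

/-- After removal of the main term there remain arctan(T/2), with coefficient between 1 and 3/2, a
term of size at most 2/T < 0.23, and arg ζ(2 + iT), at most 0.4609. Together with 3π/4 these lie in
(-π, π). -/
theorem abs_leftArg_add_lt {T : ℝ} (hT : 8.7 < T) :
    |(leftArg T + (T * Real.log (T / (2 * Real.pi)) - T)) + 3 / 4 * Real.pi| < Real.pi := by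
  have h0 : 0 < T := by linarith
  have hp := Real.pi_gt_d2
  have h1 := logGammaSeries_im_le h0
  have h2 := le_logGammaSeries_im h0
  obtain ⟨h3, h4⟩ := abs_le.1 (abs_argZetaTwo_le T)
  have e : Real.log (T / (2 * Real.pi)) = Real.log T - Real.log (2 * Real.pi) :=
    Real.log_div h0.ne' (by positivity)
  have e2 : Real.log (4 + T ^ 2) = 2 * Real.log T + Real.log (1 + 4 / T ^ 2) := by
    rw [show 4 + T ^ 2 = T ^ 2 * (1 + 4 / T ^ 2) by field_simp; ring,
      Real.log_mul (by positivity) (by positivity), Real.log_pow]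
    norm_num
  have h5 : 0 ≤ Real.log (1 + 4 / T ^ 2) := Real.log_nonneg (by
    have : 0 ≤ 4 / T ^ 2 := by positivity
    linarith)
  have h6 : Real.log (1 + 4 / T ^ 2) ≤ 4 / T ^ 2 := by
    have := Real.log_le_sub_one_of_pos (x := 1 + 4 / T ^ 2) (by positivity)
    linarith
  have h7 : T / 2 * Real.log (1 + 4 / T ^ 2) ≤ 2 / T := by
    calc T / 2 * Real.log (1 + 4 / T ^ 2) ≤ T / 2 * (4 / T ^ 2) := by gcongr
      _ = 2 / T := by field_simp; norm_num
  have h8 : 0 ≤ T / 2 * Real.log (1 + 4 / T ^ 2) := by positivity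
  have h9 : 2 / T < 0.23 := by rw [div_lt_iff₀ h0]; linarith
  have h10 := Real.arctan_lt_pi_div_two (T / 2)
  have h11 : 0 ≤ Real.arctan (T / 2) := Real.arctan_nonneg.2 (by positivity)
  have e3 : T / 2 * (2 * Real.log T + Real.log (1 + 4 / T ^ 2)) =
      T * Real.log T + T / 2 * Real.log (1 + 4 / T ^ 2) := by ring
  have e4 : T * (Real.log T - Real.log (2 * Real.pi)) = T * Real.log T - T * Real.log (2 * Real.pi) := by ring
  rw [e2, e3] at h1 h2
  rw [leftArg, e, e4, abs_lt]
  constructor <;> linarith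

end

theorem mainTheorem2 (T : ℝ) (hT : 0 < T) (L : Set ℂ) (hL : IsParallelLine L)
    (hTL : (-1 + T * Complex.I : ℂ) ∈ L) :
    ((∀ s ∈ L, riemannZeta s ≠ 0) →
      (zetaZerosIn (belowLine L)).Finite ∧
      IsNearestInt (zetaZeroCount (belowLine L))
        (T / (2 * Real.pi) * Real.log (T / (2 * Real.pi)) - T / (2 * Real.pi) + 7 / 8)) ∧
    ((∃ s ∈ L, riemannZeta s = 0) →
      (zetaZerosIn (belowLine L ∪ L)).Finite ∧
      IsNearestInt (zetaZeroCount (belowLine L ∪ L))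
        (T / (2 * Real.pi) * Real.log (T / (2 * Real.pi)) - T / (2 * Real.pi) + 11 / 8)) := by
  obtain ⟨Φ⟩ := hL.nonempty_lineFrame hT hTL
  have hbound := abs_leftArg_add_lt (Φ.left_end hL hT Φ.yP_mem Φ.curve_yP).1
  have hpi := Real.pi_pos
  -- Since 2πN = π + θ - `leftArg T` and `leftArg T` is compared with -3π/4, the constant is (π +
  -- 3π/4 + θ)/2π: 7/8 for θ = 0 and 11/8 for θ = π. An error below π is less than 1/2 after
  -- division by 2π.
  have key : ∀ (N : ℕ) (x : ℝ), 2 * Real.pi * (x - N) =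
      (leftArg T + (T * Real.log (T / (2 * Real.pi)) - T)) + 3 / 4 * Real.pi → IsNearestInt N x := by
    intro N x h
    refine isNearestInt_of_abs_lt ?_
    rw [← h, abs_mul, abs_of_pos (by positivity)] at hbound
    push_cast
    nlinarith
  have hx : ∀ c : ℝ, 2 * Real.pi * (T / (2 * Real.pi) * Real.log (T / (2 * Real.pi)) - T / (2 * Real.pi) + c) =
      T * Real.log (T / (2 * Real.pi)) - T + 2 * Real.pi * c := fun c => by field_simp
  constructor
  · intro h
    have hsep := (Φ.isSeparating_curve h).finite_and_count
    have hset : zetaZerosIn (belowLine L ∪ L) = zetaZerosIn (belowLine L) := by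
      ext ρ
      refine ⟨fun ⟨h1, h2, h3⟩ => ⟨h1.resolve_right fun h' => h ρ h' h2, h2, h3⟩,
        fun ⟨h1, h2, h3⟩ => ⟨Or.inl h1, h2, h3⟩⟩
    rw [zetaZeroCount, hset, ← zetaZeroCount] at hsep
    refine ⟨hsep.1, key _ _ ?_⟩
    rw [mul_sub, hx, hsep.2]; ring
  · intro h
    obtain ⟨κ, hκ⟩ := Φ.exists_isSeparating h
    have hsep := hκ.finite_and_count
    refine ⟨hsep.1, key _ _ ?_⟩
    rw [mul_sub, hx, hsep.2]; ring
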